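/- A series-parallel network is either a single resistor (impedance $R$), inductor (impedance $Ls$) or capacitor (impedance $1/(Cs)$), with positive element value, or a series or parallel connection of two series-parallel networks; a series (resp. parallel) connection of networks with impedances $Z_1, Z_2$ has impedance $Z$ with $Z = Z_1+Z_2$ (resp. $1/Z = 1/Z_1+1/Z_2$). Let $\mathcal{Z}_{1,2}\subset\mathbb{R}(s)$ be the set of impedances of series-parallel networks containing at most one capacitor and at most two inductors (and any number of resistors). Call $Z\in\mathbb{R}(s)$ bicubic if its McMillan degree (the maximum of the degrees of numerator and denominator in a coprime factorization) is three. A set of real numbers is said to have the same sign if all are non-negative or all are non-positive. For polynomials $p=p_3s^3+\dots+p_0$ and $q=q_3s^3+\dots+q_0$, let $\mathcal{B}(q,p)$ be the $3\times 3$ Bezoutian matrix, defined by $\frac{q(z)p(w)-p(z)q(w)}{z-w}=\sum_{i,j=1}^{3}\mathcal{B}_{ij}z^{i-1}w^{j-1}$, and let $R_0(p,q)$ be the determinant of the $6\times 6$ Sylvester matrix with rows $(q_3,q_2,q_1,q_0,0,0)$, $(p_3,p_2,p_1,p_0,0,0)$, $(0,q_3,q_2,q_1,q_0,0)$, $(0,p_3,p_2,p_1,p_0,0)$,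 $(0,0,q_3,q_2,q_1,q_0)$, $(0,0,p_3,p_2,p_1,p_0)$. Given numbers $c_0,c_1,c_2,d_0,d_1,d_2$, put $$\alpha_1=c_1d_0-c_0d_1,\quad \alpha_2=c_2d_0-c_0d_2,\quad \alpha_3=c_2d_1-c_1d_2,$$ $$\lambda_1=d_1\alpha_1-d_0\alpha_2,\quad \lambda_2=c_1\alpha_3-c_2\alpha_2,\quad \lambda_3=d_2\alpha_2-d_1\alpha_3,\quad \lambda_4=c_0\alpha_2-c_1\alpha_1 .$$ Let $a(s)=\sum_{i=0}^3 a_is^i$ and $b(s)=\sum_{i=0}^3 b_is^i$ be real polynomials and $x\ge 0$. For (C1)-(C4), let $[c_0\ c_1\ c_2]=[1\ {-x}\ x^2]\,\mathcal{B}(a,b)$, $c(s)=c_2s^2+c_1s+c_0$, $\tilde a=a(-x)$, $\tilde b=b(-x)$, $\tilde c=c(-x)$, and $[d_0\ d_1\ d_2]=\tilde b\,[1\ {-x}\ x^2]\,\mathcal{B}(b,c)$. For (C5), let $[c_0\ c_1\ c_2]=-[x^2\ {-x}\ 1]\,\mathcal{B}(a,b)$, $c(s)=c_2s^3+c_1s^2+c_0s$,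 $\tilde a=-a_0x^3+a_1x^2-a_2x+a_3$, $\tilde b=-b_0x^3+b_1x^2-b_2x+b_3$, $\tilde c=c_0x^2-c_1x+c_2$, and $[d_0\ d_1\ d_2]=-\tilde b\,[x^2\ {-x}\ 1]\,\mathcal{B}(b,c)$. In each of the following conditions it is required that $a_i,b_i\ge 0$ for $i=0,1,2,3$, that $R_0(a,b)>0$, that $\tilde c\ge 0$, and moreover: * (C1) $\tilde a,\tilde b,c_0,c_1,c_2,d_0,d_1,d_2,\lambda_1$ have the same sign and $\alpha_2\ge 0$; * (C2) $\tilde a,\tilde b,c_0,c_1,c_2,d_0,d_1,d_2,\lambda_3$ have the same sign and $\alpha_2\le 0$; * (C3) $\tilde a,\tilde b,c_0,c_1,c_2,d_0,d_1,d_2,\lambda_4$ have the same sign and $\alpha_2\le 0$; * (C4) $\tilde a,\tilde b,c_0,c_1,c_2,d_0,d_1,d_2,\lambda_2$ have the same sign and $\alpha_2\ge 0$; * (C5) $\tilde a,\tilde b,c_0,c_1,c_2,d_0,d_1,d_2,\lambda_1$ have the same sign and $\alpha_2\ge 0$ (with the quantities defined for (C5)). **Theorem.** Let $Z\in\mathbb{R}(s)$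 be bicubic. Then $Z\in\mathcal{Z}_{1,2}$ if and only if there exist $x\ge 0$ and real $a_0,\dots,a_3,b_0,\dots,b_3$ such that either $$Z=\frac{a_3s^3+a_2s^2+a_1s+a_0}{b_3s^3+b_2s^2+b_1s+b_0}\ \text{ with some } b_i>0,\qquad\text{or}\qquad Z=\frac{b_0s^3+b_1s^2+b_2s+b_3}{a_0s^3+a_1s^2+a_2s+a_3}\ \text{ with some } a_i>0,$$ and at least one of the following holds: 1. (C1) holds and $x=0$ or $\lambda_1=0$ or $c_0=0$; 2. (C2) holds and $x=0$ or $\lambda_3=0$ or $c_2=0$; 3. (C3) holds and $x=0$ or $\lambda_4=0$ or $d_0=0$; 4. (C4) holds and $x=0$ or $\lambda_2=0$ or $d_2=0$; 5. (C5) holds and $x=0$ or $c_0=0$ or $d_2=0$. -/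

import Mathlib

/-- Series-parallel networks: a single resistor, inductor or capacitor (with a positive element
value) is a series-parallel network, and so is any series or parallel connection of two
series-parallel networks. -/
inductive SPNetwork : Type
  | resistor (R : ℝ) (hR : 0 < R) : SPNetwork
  | inductor (L : ℝ) (hL : 0 < L) : SPNetwork
  | capacitor (K : ℝ) (hK : 0 < K) : SPNetwork
  | series (N₁ N₂ : SPNetwork) : SPNetwork
  | parallel (N₁ N₂ : SPNetwork) : SPNetwork

/-- The impedance of a series-parallel network, as an element of `ℝ(s)`: `R`, `L s` and `1/(K s)`
for the single elements, `Z = Z₁ + Z₂` for a series connection and `1/Z = 1/Z₁ + 1/Z₂` for a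
parallel connection. -/
noncomputable def SPNetwork.impedance : SPNetwork → RatFunc ℝ
  | .resistor R _ => RatFunc.C R
  | .inductor L _ => RatFunc.C L * RatFunc.X
  | .capacitor K _ => (RatFunc.C K * RatFunc.X)⁻¹
  | .series N₁ N₂ => N₁.impedance + N₂.impedance
  | .parallel N₁ N₂ => (N₁.impedance⁻¹ + N₂.impedance⁻¹)⁻¹

/-- The number of capacitors in a network. -/
def SPNetwork.numCapacitors : SPNetwork → ℕ
  | .resistor _ _ => 0
  | .inductor _ _ => 0
  | .capacitor _ _ => 1
  | .series N₁ N₂ => N₁.numCapacitors + N₂.numCapacitors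
  | .parallel N₁ N₂ => N₁.numCapacitors + N₂.numCapacitors

/-- The number of inductors in a network. -/
def SPNetwork.numInductors : SPNetwork → ℕ
  | .resistor _ _ => 0
  | .inductor _ _ => 1
  | .capacitor _ _ => 0
  | .series N₁ N₂ => N₁.numInductors + N₂.numInductors
  | .parallel N₁ N₂ => N₁.numInductors + N₂.numInductors

/-- `impedanceSet m n`: the impedances of the series-parallel networks that contain at most `m`
capacitors and at most `n` inductors (and any number of resistors). -/
def impedanceSet (m n : ℕ) : Set (RatFunc ℝ) :=
  {Z | ∃ N : SPNetwork, N.numCapacitors ≤ m ∧ N.numInductors ≤ n ∧ N.impedance = Z}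

/-- The McMillan degree of a rational function: the larger of the degrees of the numerator and of
the denominator in a coprime factorization. -/
noncomputable def mcMillanDegree (Z : RatFunc ℝ) : ℕ :=
  max Z.num.natDegree Z.denom.natDegree

/-- A bicubic is a rational function of McMillan degree three. -/
def IsBicubic (Z : RatFunc ℝ) : Prop := mcMillanDegree Z = 3

/-- The polynomial `p₃ s³ + p₂ s² + p₁ s + p₀`, viewed in `ℝ(s)`. -/
noncomputable def cubic (p : Fin 4 → ℝ) : RatFunc ℝ :=
  ∑ i : Fin 4, RatFunc.C (p i) * RatFunc.X ^ (i : ℕ)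

/-- `Z = (a₃s³ + a₂s² + a₁s + a₀) / (b₃s³ + b₂s² + b₁s + b₀)`, with some `bᵢ > 0`. -/
def HasDirectForm (Z : RatFunc ℝ) (a b : Fin 4 → ℝ) : Prop :=
  (∃ i, 0 < b i) ∧ Z = cubic a / cubic b

/-- `Z = (b₀s³ + b₁s² + b₂s + b₃) / (a₀s³ + a₁s² + a₂s + a₃)`, with some `aᵢ > 0`. -/
def HasDualForm (Z : RatFunc ℝ) (a b : Fin 4 → ℝ) : Prop :=
  (∃ i, 0 < a i) ∧ Z = cubic ![b 3, b 2, b 1, b 0] / cubic ![a 3, a 2, a 1, a 0]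

/-- The value `∑ pᵢ sⁱ` of a polynomial given by its coefficients. -/
def evalCoeffs {n : ℕ} (p : Fin n → ℝ) (s : ℝ) : ℝ := ∑ i : Fin n, p i * s ^ (i : ℕ)

/-- The Bezoutian matrix `𝓑(q, p)` of two polynomials of degree at most three (given by their
coefficients); see `bezoutian_spec`, which characterizes it. -/
def bezoutian (q p : Fin 4 → ℝ) : Matrix (Fin 3) (Fin 3) ℝ :=
  !![q 1 * p 0 - q 0 * p 1, q 2 * p 0 - q 0 * p 2, q 3 * p 0 - q 0 * p 3;
     q 2 * p 0 - q 0 * p 2, (q 3 * p 0 - q 0 * p 3) + (q 2 * p 1 - q 1 * p 2),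
       q 3 * p 1 - q 1 * p 3;
     q 3 * p 0 - q 0 * p 3, q 3 * p 1 - q 1 * p 3, q 3 * p 2 - q 2 * p 3]

/-- `(q(z) p(w) - p(z) q(w)) / (z - w) = ∑ᵢⱼ 𝓑(q, p)ᵢⱼ zⁱ wʲ`, with indices starting at `0`. -/
theorem bezoutian_spec (q p : Fin 4 → ℝ) (z w : ℝ) :
    evalCoeffs q z * evalCoeffs p w - evalCoeffs p z * evalCoeffs q w =
      (z - w) * ∑ i : Fin 3, ∑ j : Fin 3, bezoutian q p i j * z ^ (i : ℕ) * w ^ (j : ℕ) := by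
  simp [evalCoeffs, bezoutian, Fin.sum_univ_succ]
  ring

/-- The Sylvester matrix `𝓢₀(p, q)` of two polynomials of degree at most three. -/
def sylvesterZero (p q : Fin 4 → ℝ) : Matrix (Fin 6) (Fin 6) ℝ :=
  !![q 3, q 2, q 1, q 0, 0, 0;
     p 3, p 2, p 1, p 0, 0, 0;
     0, q 3, q 2, q 1, q 0, 0;
     0, p 3, p 2, p 1, p 0, 0;
     0, 0, q 3, q 2, q 1, q 0;
     0, 0, p 3, p 2, p 1, p 0]

/-- `R₀(p, q)`, the determinant of the Sylvester matrix `𝓢₀(p, q)`. -/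
def resultantZero (p q : Fin 4 → ℝ) : ℝ := (sylvesterZero p q).det

/-- The real numbers in a list have the same sign: all are non-negative or all are non-positive. -/
def SameSign (l : List ℝ) : Prop := (∀ r ∈ l, 0 ≤ r) ∨ (∀ r ∈ l, r ≤ 0)

/-- The quantities `ã, b̃, c̃, c₀, c₁, c₂, d₀, d₁, d₂` attached to `a`, `b` and `x`. -/
structure Params where
  ta : ℝ
  tb : ℝ
  tc : ℝ
  c : Fin 3 → ℝ
  d : Fin 3 → ℝ

namespace Params

variable (P : Params)

def α₁ : ℝ := P.c 1 * P.d 0 - P.c 0 * P.d 1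

def α₂ : ℝ := P.c 2 * P.d 0 - P.c 0 * P.d 2

def α₃ : ℝ := P.c 2 * P.d 1 - P.c 1 * P.d 2

def lam₁ : ℝ := P.d 1 * P.α₁ - P.d 0 * P.α₂

def lam₂ : ℝ := P.c 1 * P.α₃ - P.c 2 * P.α₂

def lam₃ : ℝ := P.d 2 * P.α₂ - P.d 1 * P.α₃

def lam₄ : ℝ := P.c 0 * P.α₂ - P.c 1 * P.α₁

/-- `ã, b̃, c₀, c₁, c₂, d₀, d₁, d₂` and `r` have the same sign. -/
def SameSignWith (r : ℝ) : Prop :=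
  SameSign [P.ta, P.tb, P.c 0, P.c 1, P.c 2, P.d 0, P.d 1, P.d 2, r]

end Params

/-- The quantities used in (C1)-(C4):
`[c₀ c₁ c₂] = [1 -x x²] 𝓑(a, b)`, `c(s) = c₂s² + c₁s + c₀`, `ã = a(-x)`, `b̃ = b(-x)`,
`c̃ = c(-x)` and `[d₀ d₁ d₂] = b̃ [1 -x x²] 𝓑(b, c)`. -/
def paramsL (a b : Fin 4 → ℝ) (x : ℝ) : Params :=
  let c : Fin 3 → ℝ := Matrix.vecMul ![1, -x, x ^ 2] (bezoutian a b)
  let tb : ℝ := evalCoeffs b (-x)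
  { ta := evalCoeffs a (-x)
    tb := tb
    tc := evalCoeffs c (-x)
    c := c
    d := tb • Matrix.vecMul ![1, -x, x ^ 2] (bezoutian b ![c 0, c 1, c 2, 0]) }

/-- The quantities used in (C5):
`[c₀ c₁ c₂] = -[x² -x 1] 𝓑(a, b)`, `c(s) = c₂s³ + c₁s² + c₀s`,
`ã = -a₀x³ + a₁x² - a₂x + a₃`, `b̃ = -b₀x³ + b₁x² - b₂x + b₃`, `c̃ = c₀x² - c₁x + c₂` and
`[d₀ d₁ d₂] = -b̃ [x² -x 1] 𝓑(b, c)`. -/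
def paramsC (a b : Fin 4 → ℝ) (x : ℝ) : Params :=
  let c : Fin 3 → ℝ := -Matrix.vecMul ![x ^ 2, -x, 1] (bezoutian a b)
  let tb : ℝ := -b 0 * x ^ 3 + b 1 * x ^ 2 - b 2 * x + b 3
  { ta := -a 0 * x ^ 3 + a 1 * x ^ 2 - a 2 * x + a 3
    tb := tb
    tc := c 0 * x ^ 2 - c 1 * x + c 2
    c := c
    d := -(tb • Matrix.vecMul ![x ^ 2, -x, 1] (bezoutian b ![0, c 0, c 1, c 2])) }

/-- The part common to (C1)-(C5): `aᵢ, bᵢ ≥ 0` for all `i`, and `R₀(a, b) > 0`. -/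
def CondBase (a b : Fin 4 → ℝ) : Prop :=
  (∀ i, 0 ≤ a i ∧ 0 ≤ b i) ∧ 0 < resultantZero a b

def CondC1 (a b : Fin 4 → ℝ) (x : ℝ) : Prop :=
  CondBase a b ∧ (paramsL a b x).SameSignWith (paramsL a b x).lam₁ ∧
    0 ≤ (paramsL a b x).tc ∧ 0 ≤ (paramsL a b x).α₂

def CondC2 (a b : Fin 4 → ℝ) (x : ℝ) : Prop :=
  CondBase a b ∧ (paramsL a b x).SameSignWith (paramsL a b x).lam₃ ∧
    0 ≤ (paramsL a b x).tc ∧ 0 ≤ -(paramsL a b x).α₂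

def CondC3 (a b : Fin 4 → ℝ) (x : ℝ) : Prop :=
  CondBase a b ∧ (paramsL a b x).SameSignWith (paramsL a b x).lam₄ ∧
    0 ≤ (paramsL a b x).tc ∧ 0 ≤ -(paramsL a b x).α₂

def CondC4 (a b : Fin 4 → ℝ) (x : ℝ) : Prop :=
  CondBase a b ∧ (paramsL a b x).SameSignWith (paramsL a b x).lam₂ ∧
    0 ≤ (paramsL a b x).tc ∧ 0 ≤ (paramsL a b x).α₂

def CondC5 (a b : Fin 4 → ℝ) (x : ℝ) : Prop :=
  CondBase a b ∧ (paramsC a b x).SameSignWith (paramsC a b x).lam₁ ∧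
    0 ≤ (paramsC a b x).tc ∧ 0 ≤ (paramsC a b x).α₂

/-! The McMillan degree is at most the number of reactive elements
(`SPNetwork.mcMillanDegree_impedance_le`), so a bicubic uses all three. Apart from resistors added
around it, the outermost connection joins a part with one reactive element to a part with two. The
duality `Z(s) ↦ 1 / Z(1/s)` exchanges series and parallel, keeps the kind of each reactive element
and accounts for the second form of `Z`, so the connection may be taken parallel. The surrounding
resistors can be absorbed, which leaves `Z = R + 1/W` with either `W = K/(s+x) + d/c`, where `c/d`
uses one inductor and one capacitor, or `W = K s/(1+x s) + d/c`, where `c/d` uses two inductors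
(`SPNetwork.isCoreImpedance_or_dual`).

In the first case `Z = a/b` with `b = K c + (s+x) d` and `a = R b + (s+x) c`. At `s = -x` this gives
`b̃ = K c(-x)` and `ã = R b̃`. Then `(b̃ a - ã b)/(s+x)`, a combination of rows of a Bezoutian, is a
multiple of `c`, and the same device applied to `b, c` returns `d` (`paramsL_synth`, with inverse
`eq_synth`). The sign conditions therefore say that `R`, `K` and the coefficients of `c, d` have the
right signs and that `c/d` is realizable. Since `R₀(a, b)` is a negative multiple of the resultant
expression `res` of `c, d`, its sign separates the two cases. Reversing coefficients turns the
second case into the same computation (`paramsC_eq`), and this is (C5).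

Realizability of `c/d` is the two-element problem. For necessity, the sign classes survive series
and parallel resistors, so they are checked on bare connections (`regularPair_series`,
`twoInd_series`, `twoInd_parallel`). For sufficiency, a continued fraction of `c/d` has element
values whose signs are those of `λ₁`, `α₂` and `res` (`quad_div_quad_eq`); inversion and `s ↦ 1/s`
carry the other sign patterns to this one.

The extra alternatives come from minimality. The admissible `x` form a closed set, so there is a
least non-negative one. If it is positive and none of the listed quantities vanishes, the relevant
inequalities are strict and a smaller `x` works too. As `x` decreases `α₂` may change sign, which
exchanges (C1) with (C2) and (C3) with (C4); each pair is therefore minimized together. -/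

namespace Params

variable (P : Params)

/-- The resultant of the quadratics with coefficients `c` and `d`, up to sign. -/
def res : ℝ := P.α₁ * P.α₃ - P.α₂ ^ 2

end Params

/-- The pair of quadratics `c`, `d`, seen as parameters. -/
def quadPair (c d : Fin 3 → ℝ) : Params := ⟨0, 0, 0, c, d⟩

theorem resultantZero_eq (a b : Fin 4 → ℝ) :
    resultantZero a b = -(bezoutian a b).det := by
  simp [resultantZero, sylvesterZero, bezoutian, Matrix.det_succ_row_zero, Fin.sum_univ_succ,
    Fin.succAbove]
  ring

/-! ### Numerator and denominator of the normal form -/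

/-- Coefficients of `K c(s) + (s + x) d(s)`. -/
def synthDen (K x : ℝ) (c d : Fin 3 → ℝ) : Fin 4 → ℝ :=
  ![K * c 0 + x * d 0, K * c 1 + d 0 + x * d 1, K * c 2 + d 1 + x * d 2, d 2]

/-- Coefficients of `R (K c(s) + (s + x) d(s)) + (s + x) c(s)`. -/
def synthNum (R K x : ℝ) (c d : Fin 3 → ℝ) : Fin 4 → ℝ :=
  ![R * (K * c 0 + x * d 0) + x * c 0, R * (K * c 1 + d 0 + x * d 1) + c 0 + x * c 1,
    R * (K * c 2 + d 1 + x * d 2) + c 1 + x * c 2, R * d 2 + c 2]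

/-- At `s = -x` every term with the factor `s + x` drops out, so `b̃ = K g` and `ã = R b̃`.
Eliminating `b` from `a`, and then `c` from `b`, leaves `(s+x) c` and `(s+x) d` up to the displayed
scalars. -/
theorem paramsL_synth (R K x : ℝ) (c d : Fin 3 → ℝ) (g : ℝ) (hg : g = c 0 - c 1 * x + c 2 * x ^ 2) :
    paramsL (synthNum R K x c d) (synthDen K x c d) x =
      ⟨R * (K * g), K * g, K * g ^ 2, (K * g) • c, (K ^ 2 * g ^ 3) • d⟩ := by
  subst hg
  simp only [paramsL, Params.mk.injEq]
  refine ⟨?_, ?_, ?_, ?_, ?_⟩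
  · simp [synthNum, evalCoeffs, Fin.sum_univ_succ]; ring
  · simp [synthDen, evalCoeffs, Fin.sum_univ_succ]; ring
  · simp [synthNum, synthDen, evalCoeffs, Fin.sum_univ_succ, bezoutian, Matrix.vecMul,
      dotProduct]; ring
  · ext i
    fin_cases i <;> simp [synthNum, synthDen, Fin.sum_univ_succ, bezoutian, Matrix.vecMul,
      dotProduct] <;> ring
  · ext i
    fin_cases i <;> simp [synthNum, synthDen, evalCoeffs, Fin.sum_univ_succ, bezoutian, Matrix.vecMul,
      dotProduct] <;> ring

/-- Makes the sign of `R₀` independent of `R` and `x`: for `K > 0` it is opposite to that of `res`,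
unless `c(-x) = 0`. -/
theorem resultantZero_synth (R K x : ℝ) (c d : Fin 3 → ℝ) :
    resultantZero (synthNum R K x c d) (synthDen K x c d) =
      -(K * (c 0 - c 1 * x + c 2 * x ^ 2) ^ 2 * (quadPair c d).res) := by
  rw [resultantZero_eq, Matrix.det_fin_three]
  simp [bezoutian, synthNum, synthDen, Params.res, Params.α₁, Params.α₂, Params.α₃, quadPair]
  ring

/-! ### Sign classes of pairs of quadratics and their symmetries -/

/-- The sign conditions on `c / d` that are shared by the four families of networks with one
inductor and one capacitor. -/
def RegularPair (c d : Fin 3 → ℝ) : Prop :=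
  (0 ≤ (quadPair c d).lam₁ ∧ 0 ≤ (quadPair c d).α₂) ∨
  (0 ≤ (quadPair c d).lam₃ ∧ (quadPair c d).α₂ ≤ 0) ∨
  (0 ≤ (quadPair c d).lam₄ ∧ (quadPair c d).α₂ ≤ 0) ∨
  (0 ≤ (quadPair c d).lam₂ ∧ 0 ≤ (quadPair c d).α₂)

/-- Conditions satisfied by the impedances `c / d` of the series-parallel networks with one inductor
and one capacitor. -/
def OneCapOneInd (c d : Fin 3 → ℝ) : Prop :=
  RegularPair c d ∧ (quadPair c d).res ≤ 0

/-- Conditions satisfied by the impedances `c / d` of the series-parallel networks with two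
inductors. -/
def TwoInd (c d : Fin 3 → ℝ) : Prop :=
  0 ≤ (quadPair c d).α₁ ∧ 0 ≤ (quadPair c d).α₂ ∧ 0 ≤ (quadPair c d).α₃ ∧ 0 ≤ (quadPair c d).res

/-- Reversal of the coefficients of a quadratic. -/
def rev₃ (c : Fin 3 → ℝ) : Fin 3 → ℝ := ![c 2, c 1, c 0]

section Symmetry

variable (c d : Fin 3 → ℝ)

@[simp] theorem rev₃_rev₃ : rev₃ (rev₃ c) = c := by
  ext i; fin_cases i <;> rfl

@[simp] theorem rev₃_zero : rev₃ c 0 = c 2 := rfl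
@[simp] theorem rev₃_one : rev₃ c 1 = c 1 := rfl
@[simp] theorem rev₃_two : rev₃ c 2 = c 0 := rfl

theorem α₁_swap : (quadPair d c).α₁ = -(quadPair c d).α₁ := by
  simp only [Params.α₁, quadPair]; ring
theorem α₂_swap : (quadPair d c).α₂ = -(quadPair c d).α₂ := by
  simp only [Params.α₂, quadPair]; ring
theorem α₃_swap : (quadPair d c).α₃ = -(quadPair c d).α₃ := by
  simp only [Params.α₃, quadPair]; ring
theorem res_swap : (quadPair d c).res = (quadPair c d).res := by
  simp only [Params.res, α₁_swap c d, α₂_swap c d, α₃_swap c d]; ring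
theorem lam₁_swap : (quadPair d c).lam₁ = (quadPair c d).lam₄ := by
  simp only [Params.lam₁, Params.lam₄, Params.α₁, Params.α₂, quadPair]; ring
theorem lam₃_swap : (quadPair d c).lam₃ = (quadPair c d).lam₂ := by
  simp only [Params.lam₃, Params.lam₂, Params.α₃, Params.α₂, quadPair]; ring

theorem α₁_rev : (quadPair (rev₃ c) (rev₃ d)).α₁ = -(quadPair c d).α₃ := by
  simp only [Params.α₁, Params.α₃, quadPair, rev₃_zero, rev₃_one]; ring
theorem α₂_rev : (quadPair (rev₃ c) (rev₃ d)).α₂ = -(quadPair c d).α₂ := by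
  simp only [Params.α₂, quadPair, rev₃_zero, rev₃_two]; ring
theorem α₃_rev : (quadPair (rev₃ c) (rev₃ d)).α₃ = -(quadPair c d).α₁ := by
  simp only [Params.α₁, Params.α₃, quadPair, rev₃_two, rev₃_one]; ring
theorem res_rev : (quadPair (rev₃ c) (rev₃ d)).res = (quadPair c d).res := by
  simp only [Params.res, α₁_rev, α₂_rev, α₃_rev]; ring
theorem lam₁_rev : (quadPair (rev₃ c) (rev₃ d)).lam₁ = (quadPair c d).lam₃ := by
  simp only [Params.lam₁, Params.lam₃, Params.α₁, Params.α₂, Params.α₃, quadPair, rev₃_zero,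
    rev₃_one, rev₃_two]; ring
theorem lam₂_rev : (quadPair (rev₃ c) (rev₃ d)).lam₂ = (quadPair c d).lam₄ := by
  simp only [Params.lam₂, Params.lam₄, Params.α₁, Params.α₂, Params.α₃, quadPair, rev₃_zero,
    rev₃_one, rev₃_two]; ring
theorem lam₃_rev : (quadPair (rev₃ c) (rev₃ d)).lam₃ = (quadPair c d).lam₁ := by
  simpa using (lam₁_rev (rev₃ c) (rev₃ d)).symm
theorem lam₄_rev : (quadPair (rev₃ c) (rev₃ d)).lam₄ = (quadPair c d).lam₂ := by
  simpa using (lam₂_rev (rev₃ c) (rev₃ d)).symm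

variable {c d}

theorem RegularPair.swap (h : RegularPair c d) : RegularPair d c := by
  unfold RegularPair at *
  rw [α₂_swap c d, lam₁_swap c d, lam₃_swap c d, ← lam₁_swap d c, ← lam₃_swap d c]
  rcases h with h | h | h | h
  · exact Or.inr (Or.inr (Or.inl ⟨h.1, by linarith [h.2]⟩))
  · exact Or.inr (Or.inr (Or.inr ⟨h.1, by linarith [h.2]⟩))
  · exact Or.inl ⟨h.1, by linarith [h.2]⟩
  · exact Or.inr (Or.inl ⟨h.1, by linarith [h.2]⟩)

theorem OneCapOneInd.swap (h : OneCapOneInd c d) : OneCapOneInd d c :=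
  ⟨h.1.swap, by rw [res_swap c d]; exact h.2⟩

end Symmetry

/-! ### Stability under adding a resistor -/

section AddConst

variable {c d : Fin 3 → ℝ} {r : ℝ}

theorem α₁_add : (quadPair (c + r • d) d).α₁ = (quadPair c d).α₁ := by
  simp [Params.α₁, quadPair]; ring
theorem α₂_add : (quadPair (c + r • d) d).α₂ = (quadPair c d).α₂ := by
  simp [Params.α₂, quadPair]; ring
theorem α₃_add : (quadPair (c + r • d) d).α₃ = (quadPair c d).α₃ := by
  simp [Params.α₃, quadPair]; ring
theorem res_add : (quadPair (c + r • d) d).res = (quadPair c d).res := by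
  simp only [Params.res, α₁_add, α₂_add, α₃_add]
theorem lam₁_add : (quadPair (c + r • d) d).lam₁ = (quadPair c d).lam₁ := by
  simp only [Params.lam₁, α₁_add, α₂_add]; rfl
theorem lam₃_add : (quadPair (c + r • d) d).lam₃ = (quadPair c d).lam₃ := by
  simp only [Params.lam₃, α₃_add, α₂_add]; rfl
theorem lam₄_add : (quadPair (c + r • d) d).lam₄ =
    (quadPair c d).lam₄ - r * (quadPair c d).lam₁ := by
  simp only [Params.lam₄, Params.lam₁, α₁_add, α₂_add]; simp [quadPair]; ring
theorem lam₂_add : (quadPair (c + r • d) d).lam₂ =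
    (quadPair c d).lam₂ - r * (quadPair c d).lam₃ := by
  simp only [Params.lam₂, Params.lam₃, α₃_add, α₂_add]; simp [quadPair]; ring

/-- Behind this is the identity `c₀ λ₁ + d₀ λ₄ = -α₁²`, used below multiplied by `-α₂` once the
signs of `α₁`, `α₂`, `d₀` are pinned down. By `lam₄_add`, it is what keeps `λ₄ ≥ 0` when a multiple
of `d` is added to `c`. -/
theorem lam₁_nonpos_of_lam₄ (hc : ∀ i, 0 ≤ c i) (hd : ∀ i, 0 ≤ d i)
    (h : 0 ≤ (quadPair c d).lam₄) (hα : (quadPair c d).α₂ ≤ 0) : (quadPair c d).lam₁ ≤ 0 := by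
  have h1 : (quadPair c d).α₁ = c 1 * d 0 - c 0 * d 1 := rfl
  have h4 : (quadPair c d).lam₄ = c 0 * (quadPair c d).α₂ - c 1 * (quadPair c d).α₁ := rfl
  have h1' : (quadPair c d).lam₁ = d 1 * (quadPair c d).α₁ - d 0 * (quadPair c d).α₂ := rfl
  have h2 : (quadPair c d).α₂ = c 2 * d 0 - c 0 * d 2 := rfl
  generalize (quadPair c d).α₁ = A at *
  generalize (quadPair c d).α₂ = B at *
  rw [h4] at h
  rw [h1']
  have c0 := hc 0
  have c1 := hc 1
  have c2 := hc 2
  have d0 := hd 0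
  have d1 := hd 1
  have d2 := hd 2
  by_contra! hl
  have hcB : c 0 * B ≤ 0 := mul_nonpos_of_nonneg_of_nonpos c0 hα
  have hA : A ≤ 0 := by
    by_contra! hA
    have : 0 < c 1 := by
      by_contra! h0
      have : c 1 = 0 := le_antisymm h0 c1
      rw [this] at h1
      nlinarith [mul_nonneg c0 d1]
    nlinarith [mul_pos this hA]
  have hd0 : 0 < d 0 := by
    by_contra! h0
    have : d 0 = 0 := le_antisymm h0 d0
    rw [this] at hl
    nlinarith [mul_nonneg d1 (neg_nonneg.2 hA)]
  have hB : B < 0 := by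
    by_contra! h0
    nlinarith [mul_nonneg d1 (neg_nonneg.2 hA), mul_nonneg d0 h0]
  rcases hA.lt_or_eq with hA | hA
  · have e1 : c 0 * B * (d 0 * -B) ≥ c 1 * A * (d 0 * -B) :=
      mul_le_mul_of_nonneg_right (by linarith) (by nlinarith)
    have e2 : (c 1 * d 0 - c 0 * d 1) * (A * B) ≥ c 0 * (-B) * (d 1 * A - d 0 * B) := by
      nlinarith
    have e3 : 0 ≤ c 0 * (-B) * (d 1 * A - d 0 * B) := by
      have : 0 ≤ c 0 * -B := by nlinarith
      positivity
    have : A * (A * B) < 0 := by nlinarith [mul_pos (neg_pos.2 hA) (neg_pos.2 hB)]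
    rw [← h1] at e2
    linarith
  · rw [hA] at h h1
    have hc0 : c 0 = 0 := by nlinarith
    have : c 2 * d 0 ≥ 0 := mul_nonneg c2 d0
    rw [hc0] at h2
    linarith

theorem lam₃_nonpos_of_lam₂ (hc : ∀ i, 0 ≤ c i) (hd : ∀ i, 0 ≤ d i)
    (h : 0 ≤ (quadPair c d).lam₂) (hα : 0 ≤ (quadPair c d).α₂) : (quadPair c d).lam₃ ≤ 0 := by
  have := lam₁_nonpos_of_lam₄ (c := rev₃ c) (d := rev₃ d)
    (by intro i; fin_cases i <;> simp [hc]) (by intro i; fin_cases i <;> simp [hd])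
  rw [lam₄_rev, α₂_rev, lam₁_rev] at this
  exact this h (by linarith)

theorem RegularPair.add (hc : ∀ i, 0 ≤ c i) (hd : ∀ i, 0 ≤ d i) (hr : 0 ≤ r)
    (h : RegularPair c d) : RegularPair (c + r • d) d := by
  unfold RegularPair
  rw [lam₁_add, lam₂_add, lam₃_add, lam₄_add, α₂_add]
  rcases h with h | h | h | h
  · exact Or.inl h
  · exact Or.inr (Or.inl h)
  · refine Or.inr (Or.inr (Or.inl ⟨?_, h.2⟩))
    nlinarith [lam₁_nonpos_of_lam₄ hc hd h.1 h.2]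
  · refine Or.inr (Or.inr (Or.inr ⟨?_, h.2⟩))
    nlinarith [lam₃_nonpos_of_lam₂ hc hd h.1 h.2]

theorem OneCapOneInd.add (hc : ∀ i, 0 ≤ c i) (hd : ∀ i, 0 ≤ d i) (hr : 0 ≤ r)
    (h : OneCapOneInd c d) : OneCapOneInd (c + r • d) d :=
  ⟨h.1.add hc hd hr, by rw [res_add]; exact h.2⟩

theorem TwoInd.add (h : TwoInd c d) : TwoInd (c + r • d) d := by
  unfold TwoInd
  rwa [α₁_add, α₂_add, α₃_add, res_add]

theorem TwoInd.add_right (h : TwoInd c d) : TwoInd c (d + r • c) := by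
  unfold TwoInd at *
  rwa [α₁_swap (d + r • c), α₂_swap (d + r • c), α₃_swap (d + r • c), res_swap (d + r • c),
    α₁_add, α₂_add, α₃_add, res_add, ← α₁_swap, ← α₂_swap, ← α₃_swap, ← res_swap]

end AddConst

/-! ### Bare connections of two first-degree networks -/

section Series

variable {h k y z : ℝ}

/-- `k s / (1 + y s) + h / (s + z)`. -/
theorem regularPair_series (hh : 0 < h) (hk : 0 < k) (hy : 0 ≤ y) (hz : 0 ≤ z) :
    RegularPair ![h, k * z + h * y, k] ![z, 1 + y * z, y] := by
  -- Here `α₂ = k z - h y`, and the two alternatives are `λ₁ ≥ 0` and `λ₂ ≥ 0`. If `λ₁ < 0`, then `k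
  -- z (y z)² < h y ≤ k z` forces `y z < 1`, whence `h y² ≤ k y z < k` and `λ₂ ≥ 0`. The case `α₂ ≤
  -- 0` is the same statement with `h, k` and `y, z` exchanged, which is the effect of `s ↦ 1/s`.
  have key : ∀ {h k y z : ℝ}, 0 < h → 0 < k → 0 ≤ y → 0 ≤ z → h * y ≤ k * z →
      0 ≤ k * y * z ^ 3 - h ∨ 0 ≤ h * y * (2 * k - k * z * y - h * y ^ 2) := by
    intro h k y z hh hk hy hz hle
    by_contra! hcon
    obtain ⟨h1, h2⟩ := hcon
    have hyp : 0 < y := by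
      rcases hy.lt_or_eq with h0 | h0
      · exact h0
      · subst h0; simp at h2
    have hzp : 0 < z := by
      by_contra! h0
      nlinarith [mul_pos hh hyp]
    have : y * z < 1 := by
      by_contra! h0
      have e : k * z * (y * z) ^ 2 < k * z := by
        calc k * z * (y * z) ^ 2 = y * (k * y * z ^ 3) := by ring
          _ < y * h := by nlinarith
          _ ≤ k * z := by linarith
      linarith [mul_le_mul_of_nonneg_left (one_le_pow₀ h0 : 1 ≤ (y * z) ^ 2) (mul_pos hk hzp).le]
    have h3 : 0 ≤ 2 * k - k * z * y - h * y ^ 2 := by nlinarith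
    nlinarith [mul_nonneg (mul_pos hh hyp).le h3]
  unfold RegularPair
  rcases le_total (h * y) (k * z) with hle | hle
  · rcases key hh hk hy hz hle with h1 | h1
    · left
      simp [Params.lam₁, Params.α₁, Params.α₂, quadPair]
      constructor <;> nlinarith
    · right; right; right
      simp [Params.lam₂, Params.α₃, Params.α₂, quadPair]
      constructor <;> nlinarith
  · rcases key hk hh hz hy hle with h1 | h1
    · right; left
      simp [Params.lam₃, Params.α₃, Params.α₂, quadPair]
      constructor <;> nlinarith
    · right; right; left
      simp [Params.lam₄, Params.α₁, Params.α₂, quadPair]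
      constructor <;> nlinarith

theorem oneCapOneInd_series (hh : 0 < h) (hk : 0 < k) (hy : 0 ≤ y) (hz : 0 ≤ z) :
    OneCapOneInd ![h, k * z + h * y, k] ![z, 1 + y * z, y] := by
  refine ⟨regularPair_series hh hk hy hz, ?_⟩
  have : 0 ≤ h * k * (1 - y * z) ^ 2 := by positivity
  simp [Params.res, Params.α₁, Params.α₂, Params.α₃, quadPair]
  nlinarith

/-- `k s / (1 + y s) + h s / (1 + z s)`. -/
theorem twoInd_series (hh : 0 < h) (hk : 0 < k) (hy : 0 ≤ y) (hz : 0 ≤ z) :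
    TwoInd ![0, k + h, k * z + h * y] ![1, y + z, y * z] := by
  unfold TwoInd
  simp [Params.res, Params.α₁, Params.α₂, Params.α₃, quadPair]
  refine ⟨by positivity, by positivity, ?_, ?_⟩
  · have : 0 ≤ k * z ^ 2 + h * y ^ 2 := by positivity
    nlinarith
  · have : 0 ≤ k * h * (y - z) ^ 2 := by positivity
    nlinarith

/-- `((h / (s + y)) + k / (s + z))⁻¹`. -/
theorem twoInd_parallel (hh : 0 < h) (hk : 0 < k) (hy : 0 ≤ y) (hz : 0 ≤ z) :
    TwoInd ![y * z, y + z, 1] ![h * z + k * y, h + k, 0] := by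
  unfold TwoInd
  simp [Params.res, Params.α₁, Params.α₂, Params.α₃, quadPair]
  refine ⟨?_, by positivity, by positivity, ?_⟩
  · have : 0 ≤ h * z ^ 2 + k * y ^ 2 := by positivity
    nlinarith
  · have : 0 ≤ k * h * (y - z) ^ 2 := by positivity
    nlinarith

end Series

/-! ### Non-degeneracy and strict positivity -/

section Strict

variable {c d : Fin 3 → ℝ}

/-- From `d₁ α₁ ≥ d₀ α₂ ≥ 0`, every degenerate case collapses to `α₁ = α₂ = 0`, hence to `res = 0`.
These two numbers are denominators in the continued fraction of `c/d`. -/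
theorem α₁_pos_of_lam₁ (hc : ∀ i, 0 ≤ c i) (hd : ∀ i, 0 ≤ d i) (h : 0 ≤ (quadPair c d).lam₁)
    (hα : 0 ≤ (quadPair c d).α₂) (hr : (quadPair c d).res ≠ 0) :
    0 < d 0 ∧ 0 < (quadPair c d).α₁ := by
  have h1 : (quadPair c d).α₁ = c 1 * d 0 - c 0 * d 1 := rfl
  have h2 : (quadPair c d).α₂ = c 2 * d 0 - c 0 * d 2 := rfl
  have h1' : (quadPair c d).lam₁ = d 1 * (quadPair c d).α₁ - d 0 * (quadPair c d).α₂ := rfl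
  have hr' : (quadPair c d).res = (quadPair c d).α₁ * (quadPair c d).α₃ - (quadPair c d).α₂ ^ 2 :=
    rfl
  rw [h1'] at h
  rw [hr'] at hr
  have c0 := hc 0
  have c1 := hc 1
  have d0 := hd 0
  have d1 := hd 1
  have d2 := hd 2
  generalize (quadPair c d).α₁ = A at *
  generalize (quadPair c d).α₂ = B at *
  have hd0 : 0 < d 0 := by
    by_contra! h0
    have hd0 : d 0 = 0 := le_antisymm h0 d0
    rw [hd0] at h1 h2 h
    have hB : B = 0 := by nlinarith
    rw [h1] at h hr
    rw [hB] at hr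
    have : c 0 * d 1 = 0 := by
      rcases d1.lt_or_eq with hp | hp
      · have := mul_nonneg c0 d1
        nlinarith
      · rw [← hp]; ring
    apply hr
    rw [this]; ring
  refine ⟨hd0, ?_⟩
  have hB : 0 ≤ d 0 * B := mul_nonneg d0 hα
  rcases d1.lt_or_eq with hp | hp
  · by_contra! h0
    have hA : A = 0 := by nlinarith
    rw [hA] at h hr
    have : B = 0 := by nlinarith
    apply hr; rw [this]; ring
  · rw [← hp] at h h1
    have : B = 0 := by nlinarith
    rw [this] at hr
    have hA : 0 ≤ A := by rw [h1]; nlinarith [mul_nonneg c1 d0]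
    rcases hA.lt_or_eq with hA | hA
    · exact hA
    · rw [← hA] at hr
      simp at hr

/-- Follows from the relation `d₀ α₃ - d₁ α₂ + d₂ α₁ = 0`. It ties the sign conditions to `res`:
with `λ₁, α₂ ≥ 0` and `d₀ > 0`, `res < 0` forces `d₂ > 0`, while `res > 0` forces `λ₁ α₂ > 0` when
`d₂ ≥ 0`. -/
theorem lam₁_mul_α₂ : (quadPair c d).lam₁ * (quadPair c d).α₂ =
    d 2 * (quadPair c d).α₁ ^ 2 + d 0 * (quadPair c d).res := by
  simp only [Params.lam₁, Params.res, Params.α₁, Params.α₂, Params.α₃, quadPair]; ring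

/-- Strictness is what makes the conditions open in `x`: only `λ₁ = 0` or `c₀ = 0` can let a
coefficient vanish. -/
theorem strict_of_lam₁ (hc : ∀ i, 0 ≤ c i) (hd : ∀ i, 0 ≤ d i) (h : 0 ≤ (quadPair c d).lam₁)
    (hα : 0 ≤ (quadPair c d).α₂) (hr : (quadPair c d).res < 0)
    (hl0 : (quadPair c d).lam₁ ≠ 0) (hc0 : c 0 ≠ 0) : (∀ i, 0 < c i) ∧ ∀ i, 0 < d i := by
  obtain ⟨d0, a1⟩ := α₁_pos_of_lam₁ hc hd h hα hr.ne
  have h1 : (quadPair c d).α₁ = c 1 * d 0 - c 0 * d 1 := rfl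
  have h2 : (quadPair c d).α₂ = c 2 * d 0 - c 0 * d 2 := rfl
  have h1' : (quadPair c d).lam₁ = d 1 * (quadPair c d).α₁ - d 0 * (quadPair c d).α₂ := rfl
  have hlp := lt_of_le_of_ne h hl0.symm
  have c0 := lt_of_le_of_ne (hc 0) hc0.symm
  have e := lam₁_mul_α₂ (c := c) (d := d)
  have d1 : 0 < d 1 := by nlinarith [mul_nonneg d0.le hα, hd 1]
  have c1 : 0 < c 1 := by nlinarith [mul_pos c0 d1]
  have d2 : 0 < d 2 := by
    by_contra! h0
    have : d 0 * (quadPair c d).res < 0 := mul_neg_of_pos_of_neg d0 hr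
    nlinarith [mul_nonneg h hα, sq_nonneg (quadPair c d).α₁]
  have c2 : 0 < c 2 := by nlinarith [mul_pos c0 d2]
  constructor <;> intro i <;> fin_cases i <;> assumption

theorem strict_of_lam₁_of_res_pos (hc : ∀ i, 0 ≤ c i) (hd : ∀ i, 0 ≤ d i)
    (h : 0 ≤ (quadPair c d).lam₁)
    (hα : 0 ≤ (quadPair c d).α₂) (hr : 0 < (quadPair c d).res)
    (hc0 : c 0 ≠ 0) (hd2 : d 2 ≠ 0) : (∀ i, 0 < c i) ∧ (∀ i, 0 < d i) ∧
      0 < (quadPair c d).lam₁ ∧ 0 < (quadPair c d).α₂ := by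
  obtain ⟨d0, a1⟩ := α₁_pos_of_lam₁ hc hd h hα hr.ne'
  have h1 : (quadPair c d).α₁ = c 1 * d 0 - c 0 * d 1 := rfl
  have h2 : (quadPair c d).α₂ = c 2 * d 0 - c 0 * d 2 := rfl
  have h1' : (quadPair c d).lam₁ = d 1 * (quadPair c d).α₁ - d 0 * (quadPair c d).α₂ := rfl
  have c0 := lt_of_le_of_ne (hc 0) hc0.symm
  have d2 := lt_of_le_of_ne (hd 2) hd2.symm
  have e := lam₁_mul_α₂ (c := c) (d := d)
  have e' : 0 < (quadPair c d).lam₁ * (quadPair c d).α₂ := by rw [e]; positivity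
  have hlp : 0 < (quadPair c d).lam₁ := lt_of_le_of_ne h (by rintro h0; simp [← h0] at e')
  have hαp : 0 < (quadPair c d).α₂ := lt_of_le_of_ne hα (by rintro h0; simp [← h0] at e')
  have d1 : 0 < d 1 := by nlinarith [mul_nonneg d0.le hα, hd 1]
  have c1 : 0 < c 1 := by nlinarith [mul_pos c0 d1]
  have c2 : 0 < c 2 := by nlinarith [mul_pos c0 d2]
  refine ⟨?_, ?_, hlp, hαp⟩ <;> intro i <;> fin_cases i <;> assumption

/-- If `α₂ > 0`, the sign is read off from `lam₁_mul_α₂`; if `α₂ = 0`, then `λ₁ = d₁ α₁`. -/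
theorem TwoInd.lam₁_nonneg (hd : ∀ i, 0 ≤ d i) (h : TwoInd c d) :
    0 ≤ (quadPair c d).lam₁ := by
  obtain ⟨h1, h2, -, hr⟩ := h
  rcases h2.lt_or_eq with hp | hp
  · by_contra! h0
    have e := lam₁_mul_α₂ (c := c) (d := d)
    have : 0 ≤ d 2 * (quadPair c d).α₁ ^ 2 + d 0 * (quadPair c d).res := by
      have := hd 2
      have := hd 0
      positivity
    nlinarith [mul_pos (neg_pos.2 h0) hp]
  · have h1' : (quadPair c d).lam₁ = d 1 * (quadPair c d).α₁ - d 0 * (quadPair c d).α₂ := rfl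
    rw [h1', ← hp]
    have := mul_nonneg (hd 1) h1
    linarith

end Strict

open Filter Topology Set

/-! ### Recovering the network data from `a`, `b` and `x` -/

/-- Reversal of the coefficients of a cubic. -/
def rev₄ (a : Fin 4 → ℝ) : Fin 4 → ℝ := ![a 3, a 2, a 1, a 0]

@[simp] theorem rev₄_rev₄ (a : Fin 4 → ℝ) : rev₄ (rev₄ a) = a := by
  ext i; fin_cases i <;> rfl

theorem resultantZero_rev (a b : Fin 4 → ℝ) :
    resultantZero (rev₄ a) (rev₄ b) = -resultantZero a b := by
  rw [resultantZero_eq, resultantZero_eq, Matrix.det_fin_three, Matrix.det_fin_three]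
  simp [bezoutian, rev₄]
  ring

theorem resultantZero_swap (a b : Fin 4 → ℝ) :
    resultantZero b a = -resultantZero a b := by
  rw [resultantZero_eq, resultantZero_eq, Matrix.det_fin_three, Matrix.det_fin_three]
  simp [bezoutian]
  ring

/-- Reversal of the coefficients of the quadratics. -/
def Params.rev (P : Params) : Params := { P with c := rev₃ P.c, d := rev₃ P.d }

/-- The quantities of (C5) are those of (C1)-(C4) computed for `s³ a(1/s)` and `s³ b(1/s)`, with the
resulting quadratics reversed again. No separate theory of (C5) is needed. -/
theorem paramsC_eq (a b : Fin 4 → ℝ) (x : ℝ) :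
    paramsC a b x = (paramsL (rev₄ a) (rev₄ b) x).rev := by
  simp only [paramsC, paramsL, Params.rev, Params.mk.injEq]
  refine ⟨?_, ?_, ?_, ?_, ?_⟩
  · simp [rev₄, evalCoeffs, Fin.sum_univ_succ]; ring
  · simp [rev₄, evalCoeffs, Fin.sum_univ_succ]; ring
  · simp [rev₄, evalCoeffs, Fin.sum_univ_succ, bezoutian, Matrix.vecMul,
      dotProduct]; ring
  · ext i
    fin_cases i <;> simp [rev₄, rev₃, Fin.sum_univ_succ, bezoutian, Matrix.vecMul,
      dotProduct] <;> ring
  · ext i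
    fin_cases i <;> simp [rev₄, rev₃, evalCoeffs, Fin.sum_univ_succ, bezoutian, Matrix.vecMul,
      dotProduct] <;> ring

section ParamsL

variable (a b : Fin 4 → ℝ) (x : ℝ)

/-- The coefficients of `(s + x) c(s) = b̃ a(s) - ã b(s)`, the Bezoutian identity at `w = -x`. -/
theorem paramsL_c : x * (paramsL a b x).c 0 = a 0 * (paramsL a b x).tb - b 0 * (paramsL a b x).ta ∧
    (paramsL a b x).c 0 + x * (paramsL a b x).c 1 =
      a 1 * (paramsL a b x).tb - b 1 * (paramsL a b x).ta ∧
    (paramsL a b x).c 1 + x * (paramsL a b x).c 2 =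
      a 2 * (paramsL a b x).tb - b 2 * (paramsL a b x).ta ∧
    (paramsL a b x).c 2 = a 3 * (paramsL a b x).tb - b 3 * (paramsL a b x).ta := by
  simp only [paramsL]
  refine ⟨?_, ?_, ?_, ?_⟩ <;>
  simp [evalCoeffs, Fin.sum_univ_succ, bezoutian, Matrix.vecMul, dotProduct] <;> ring

theorem paramsL_tc : (paramsL a b x).tc =
    (paramsL a b x).c 0 - (paramsL a b x).c 1 * x + (paramsL a b x).c 2 * x ^ 2 := by
  simp only [paramsL]
  simp [evalCoeffs, Fin.sum_univ_succ]
  ring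

/-- The coefficients of `(s + x) d(s) = b̃ (c̃ b(s) - b̃ c(s))`. -/
theorem paramsL_d :
    x * (paramsL a b x).d 0 = (paramsL a b x).tb *
      (b 0 * (paramsL a b x).tc - (paramsL a b x).c 0 * (paramsL a b x).tb) ∧
    (paramsL a b x).d 0 + x * (paramsL a b x).d 1 = (paramsL a b x).tb *
      (b 1 * (paramsL a b x).tc - (paramsL a b x).c 1 * (paramsL a b x).tb) ∧
    (paramsL a b x).d 1 + x * (paramsL a b x).d 2 = (paramsL a b x).tb *
      (b 2 * (paramsL a b x).tc - (paramsL a b x).c 2 * (paramsL a b x).tb) ∧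
    (paramsL a b x).d 2 = (paramsL a b x).tb * (b 3 * (paramsL a b x).tc) := by
  rw [paramsL_tc]
  have h : ∀ i, (paramsL a b x).d i = ((paramsL a b x).tb • Matrix.vecMul ![1, -x, x ^ 2]
    (bezoutian b ![(paramsL a b x).c 0, (paramsL a b x).c 1, (paramsL a b x).c 2, 0])) i :=
    fun i => rfl
  have htb : (paramsL a b x).tb = evalCoeffs b (-x) := rfl
  rw [h, h, h]
  generalize (paramsL a b x).c = c
  generalize (paramsL a b x).tb = t at *
  simp [evalCoeffs, Fin.sum_univ_succ, bezoutian,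
    -mul_eq_mul_left_iff] at htb ⊢
  subst htb
  refine ⟨?_, ?_, ?_, ?_⟩ <;> ring

/-- The vector `[1 -x x²]` would be a nonzero left kernel vector of the Bezoutian. -/
theorem resultantZero_eq_zero (h : (paramsL a b x).c = 0) : resultantZero a b = 0 := by
  rw [resultantZero_eq, neg_eq_zero]
  exact Matrix.exists_vecMul_eq_zero_iff.1 ⟨![1, -x, x ^ 2],
    fun h0 => by simpa using congrFun h0 0, h⟩

theorem evalCoeffs_cross (y : ℝ) :
    evalCoeffs a (-y) * (paramsL a b x).tb - evalCoeffs b (-y) * (paramsL a b x).ta =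
      (x - y) * evalCoeffs (paramsL a b x).c (-y) := by
  obtain ⟨h0, h1, h2, h3⟩ := paramsL_c a b x
  generalize (paramsL a b x).c = c at *
  simp [evalCoeffs, Fin.sum_univ_succ]
  linear_combination (-1) * h0 + y * h1 - y ^ 2 * h2 + y ^ 3 * h3

variable {a b x}

/-- Solving the two identities above for `b`, then for `a`, gives `R = ã/b̃` and `K = b̃²/c̃`, with
`c` and `d` divided by `b̃` and `b̃ c̃`. -/
theorem eq_synth (ht : (paramsL a b x).tb ≠ 0) (hc : (paramsL a b x).tc ≠ 0) :
    a = synthNum ((paramsL a b x).ta / (paramsL a b x).tb)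
      ((paramsL a b x).tb ^ 2 / (paramsL a b x).tc) x ((paramsL a b x).tb⁻¹ • (paramsL a b x).c)
      (((paramsL a b x).tb * (paramsL a b x).tc)⁻¹ • (paramsL a b x).d) ∧
    b = synthDen ((paramsL a b x).tb ^ 2 / (paramsL a b x).tc) x
      ((paramsL a b x).tb⁻¹ • (paramsL a b x).c)
      (((paramsL a b x).tb * (paramsL a b x).tc)⁻¹ • (paramsL a b x).d) := by
  obtain ⟨h0, h1, h2, h3⟩ := paramsL_c a b x
  obtain ⟨e0, e1, e2, e3⟩ := paramsL_d a b x
  generalize (paramsL a b x).c = c at *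
  generalize (paramsL a b x).d = d at *
  generalize (paramsL a b x).tb = t at *
  generalize (paramsL a b x).ta = u at *
  generalize (paramsL a b x).tc = v at *
  have hb : b = synthDen (t ^ 2 / v) x (t⁻¹ • c) ((t * v)⁻¹ • d) := by
    ext i
    fin_cases i <;> simp [synthDen] <;> field_simp
    · linear_combination -e0
    · linear_combination -e1
    · linear_combination -e2
    · linear_combination -e3
  refine ⟨?_, hb⟩
  have : synthNum (u / t) (t ^ 2 / v) x (t⁻¹ • c) ((t * v)⁻¹ • d) =
      fun i => (u / t) * b i + t⁻¹ * ![x * c 0, c 0 + x * c 1, c 1 + x * c 2, c 2] i := by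
    rw [hb]
    ext i
    fin_cases i <;> simp [synthDen, synthNum] <;> ring
  rw [this]
  ext i
  fin_cases i <;> simp <;> field_simp
  · linear_combination -h0
  · linear_combination -h1
  · linear_combination -h2
  · linear_combination -h3

end ParamsL

/-! ### Normalizing signs by `b̃` -/

namespace Params

/-- All of `ã`, `cᵢ`, `dᵢ` have weakly the sign of the nonzero `b̃`. -/
structure SignBase (P : Params) : Prop where
  ne : P.tb ≠ 0
  ta : 0 ≤ P.tb * P.ta
  c : ∀ i, 0 ≤ P.tb * P.c i
  d : ∀ i, 0 ≤ P.tb * P.d i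

theorem sameSignWith_iff {P : Params} {r : ℝ} (ht : P.tb ≠ 0) :
    P.SameSignWith r ↔ P.SignBase ∧ 0 ≤ P.tb * r := by
  have key : ∀ l : List ℝ, P.tb ∈ l → (SameSign l ↔ ∀ r ∈ l, 0 ≤ P.tb * r) := by
    intro l hl
    constructor
    · rintro (h | h) r hr
      · exact mul_nonneg (h _ hl) (h _ hr)
      · exact mul_nonneg_of_nonpos_of_nonpos (h _ hl) (h _ hr)
    · intro h
      rcases lt_or_gt_of_ne ht with h0 | h0
      · exact Or.inr fun r hr => by
          by_contra! hr'
          exact absurd (h r hr) (not_le.2 (mul_neg_of_neg_of_pos h0 hr'))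
      · exact Or.inl fun r hr => by
          by_contra! hr'
          exact absurd (h r hr) (not_le.2 (mul_neg_of_pos_of_neg h0 hr'))
  rw [SameSignWith, key _ (by simp)]
  simp only [List.mem_cons, List.not_mem_nil, or_false, forall_eq_or_imp, forall_eq]
  constructor
  · rintro ⟨h1, -, h2, h3, h4, h5, h6, h7, h8⟩
    refine ⟨⟨ht, h1, ?_, ?_⟩, h8⟩ <;> intro i <;> fin_cases i <;> assumption
  · rintro ⟨⟨-, h1, h2, h3⟩, h8⟩
    exact ⟨h1, mul_self_nonneg _, h2 0, h2 1, h2 2, h3 0, h3 1, h3 2, h8⟩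

end Params

/-- If `b̃ = 0` then `(s+x) c = -ã b`, and if `c̃ = 0` then `(s+x) d = -b̃² c`. In either case the
common sign puts the coefficients of the two sides on opposite sides of zero, so `c = 0`, against
`R₀ ≠ 0`. -/
theorem tb_ne_zero_and_tc_ne_zero {a b : Fin 4 → ℝ} {x r : ℝ} (hx : 0 ≤ x)
    (hb : ∀ i, 0 ≤ b i) (hR : resultantZero a b ≠ 0) (h : (paramsL a b x).SameSignWith r) :
    (paramsL a b x).tb ≠ 0 ∧ (paramsL a b x).tc ≠ 0 := by
  have hc0 : (paramsL a b x).c ≠ 0 := fun h0 => hR (resultantZero_eq_zero a b x h0)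
  obtain ⟨h0, h1, h2, h3⟩ := paramsL_c a b x
  obtain ⟨e0, e1, e2, e3⟩ := paramsL_d a b x
  have htb : (paramsL a b x).tb ≠ 0 := by
    intro ht
    simp only [Params.SameSignWith, SameSign, List.mem_cons, List.not_mem_nil, or_false,
      forall_eq_or_imp, forall_eq] at h
    apply hc0
    generalize (paramsL a b x).c = c at *
    generalize (paramsL a b x).ta = u at *
    rw [ht] at h0 h1 h2 h3
    rcases h with ⟨hu, -, p0, p1, p2, -⟩ | ⟨hu, -, p0, p1, p2, -⟩
    · have q0 := mul_nonneg (hb 0) hu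
      have q1 := mul_nonneg (hb 1) hu
      have q2 := mul_nonneg (hb 2) hu
      have q3 := mul_nonneg (hb 3) hu
      have r0 := mul_nonneg hx p0
      have r1 := mul_nonneg hx p1
      have r2 := mul_nonneg hx p2
      ext i
      fin_cases i <;> simp <;> linarith
    · have q0 := mul_nonneg (hb 0) (neg_nonneg.2 hu)
      have q1 := mul_nonneg (hb 1) (neg_nonneg.2 hu)
      have q2 := mul_nonneg (hb 2) (neg_nonneg.2 hu)
      have q3 := mul_nonneg (hb 3) (neg_nonneg.2 hu)
      have r0 := mul_nonneg hx (neg_nonneg.2 p0)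
      have r1 := mul_nonneg hx (neg_nonneg.2 p1)
      have r2 := mul_nonneg hx (neg_nonneg.2 p2)
      ext i
      fin_cases i <;> simp <;> linarith
  refine ⟨htb, fun hv => hc0 ?_⟩
  obtain ⟨⟨-, -, hc, hd⟩, -⟩ := (Params.sameSignWith_iff htb).1 h
  generalize (paramsL a b x).c = c at *
  generalize (paramsL a b x).d = d at *
  generalize (paramsL a b x).tb = t at *
  rw [hv] at e0 e1 e2 e3
  have t2 : 0 < t ^ 2 := by positivity
  have key : ∀ i, t * c i = 0 := by
    have r0 := mul_nonneg hx (hd 0)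
    have r1 := mul_nonneg hx (hd 1)
    have r2 := mul_nonneg hx (hd 2)
    have p0 := hc 0
    have p1 := hc 1
    have p2 := hc 2
    have s0 := hd 0
    have s1 := hd 1
    have f0 : x * (t * d 0) = -(t ^ 2 * (t * c 0)) := by linear_combination t * e0
    have f1 : t * d 0 + x * (t * d 1) = -(t ^ 2 * (t * c 1)) := by linear_combination t * e1
    have f2 : t * d 1 + x * (t * d 2) = -(t ^ 2 * (t * c 2)) := by linear_combination t * e2
    intro i
    fin_cases i
    · show t * c 0 = 0
      nlinarith
    · show t * c 1 = 0
      nlinarith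
    · show t * c 2 = 0
      nlinarith
  ext i
  exact (mul_eq_zero.1 (key i)).resolve_left htb

section Scale

variable {c d : Fin 3 → ℝ} {u v : ℝ}

theorem α₂_smul : (quadPair (u • c) (v • d)).α₂ = u * v * (quadPair c d).α₂ := by
  simp [Params.α₂, quadPair]; ring
theorem res_smul : (quadPair (u • c) (v • d)).res = u ^ 2 * v ^ 2 * (quadPair c d).res := by
  simp [Params.res, Params.α₁, Params.α₂, Params.α₃, quadPair]; ring
theorem lam₁_smul : (quadPair (u • c) (v • d)).lam₁ = u * v ^ 2 * (quadPair c d).lam₁ := by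
  simp [Params.lam₁, Params.α₁, Params.α₂, quadPair]; ring
theorem lam₂_smul : (quadPair (u • c) (v • d)).lam₂ = u ^ 2 * v * (quadPair c d).lam₂ := by
  simp [Params.lam₂, Params.α₃, Params.α₂, quadPair]; ring
theorem lam₃_smul : (quadPair (u • c) (v • d)).lam₃ = u * v ^ 2 * (quadPair c d).lam₃ := by
  simp [Params.lam₃, Params.α₃, Params.α₂, quadPair]; ring
theorem lam₄_smul : (quadPair (u • c) (v • d)).lam₄ = u ^ 2 * v * (quadPair c d).lam₄ := by
  simp [Params.lam₄, Params.α₁, Params.α₂, quadPair]; ring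

end Scale

/-! ### Continuity in `x` and closedness of the conditions -/

section Continuity

variable (a b : Fin 4 → ℝ)

theorem continuous_paramsL_ta : Continuous fun x => (paramsL a b x).ta := by
  simp only [paramsL, evalCoeffs]
  fun_prop

theorem continuous_paramsL_tb : Continuous fun x => (paramsL a b x).tb := by
  simp only [paramsL, evalCoeffs]
  fun_prop

theorem continuous_paramsL_c (i : Fin 3) : Continuous fun x => (paramsL a b x).c i := by
  simp only [paramsL]
  fin_cases i <;> simp [Matrix.vecMul, dotProduct, Fin.sum_univ_succ] <;> fun_prop

theorem continuous_paramsL_tc : Continuous fun x => (paramsL a b x).tc := by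
  have h0 := continuous_paramsL_c a b 0
  have h1 := continuous_paramsL_c a b 1
  have h2 := continuous_paramsL_c a b 2
  simp only [paramsL_tc]
  fun_prop

theorem continuous_paramsL_d (i : Fin 3) : Continuous fun x => (paramsL a b x).d i := by
  have h : ∀ x, (paramsL a b x).d i = ((paramsL a b x).tb • Matrix.vecMul ![1, -x, x ^ 2]
    (bezoutian b ![(paramsL a b x).c 0, (paramsL a b x).c 1, (paramsL a b x).c 2, 0])) i :=
    fun x => rfl
  simp only [h]
  have h0 := continuous_paramsL_c a b 0
  have h1 := continuous_paramsL_c a b 1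
  have h2 := continuous_paramsL_c a b 2
  have ht := continuous_paramsL_tb a b
  fin_cases i <;> simp [bezoutian] <;> fun_prop

theorem continuous_paramsL_α₁ : Continuous fun x => (paramsL a b x).α₁ := by
  have hc := continuous_paramsL_c a b
  have hd := continuous_paramsL_d a b
  simp only [Params.α₁]
  exact ((hc 1).mul (hd 0)).sub ((hc 0).mul (hd 1))

theorem continuous_paramsL_α₂ : Continuous fun x => (paramsL a b x).α₂ := by
  have hc := continuous_paramsL_c a b
  have hd := continuous_paramsL_d a b
  simp only [Params.α₂]
  exact ((hc 2).mul (hd 0)).sub ((hc 0).mul (hd 2))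

theorem continuous_paramsL_α₃ : Continuous fun x => (paramsL a b x).α₃ := by
  have hc := continuous_paramsL_c a b
  have hd := continuous_paramsL_d a b
  simp only [Params.α₃]
  exact ((hc 2).mul (hd 1)).sub ((hc 1).mul (hd 2))

theorem continuous_paramsL_lam₁ : Continuous fun x => (paramsL a b x).lam₁ :=
  ((continuous_paramsL_d a b 1).mul (continuous_paramsL_α₁ a b)).sub
    ((continuous_paramsL_d a b 0).mul (continuous_paramsL_α₂ a b))

theorem continuous_paramsL_lam₂ : Continuous fun x => (paramsL a b x).lam₂ :=
  ((continuous_paramsL_c a b 1).mul (continuous_paramsL_α₃ a b)).sub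
    ((continuous_paramsL_c a b 2).mul (continuous_paramsL_α₂ a b))

theorem continuous_paramsL_lam₃ : Continuous fun x => (paramsL a b x).lam₃ :=
  ((continuous_paramsL_d a b 2).mul (continuous_paramsL_α₂ a b)).sub
    ((continuous_paramsL_d a b 1).mul (continuous_paramsL_α₃ a b))

theorem continuous_paramsL_lam₄ : Continuous fun x => (paramsL a b x).lam₄ :=
  ((continuous_paramsL_c a b 0).mul (continuous_paramsL_α₂ a b)).sub
    ((continuous_paramsL_c a b 1).mul (continuous_paramsL_α₁ a b))

theorem isClosed_sameSignWith {r : ℝ → ℝ} (hr : Continuous r) :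
    IsClosed {x | (paramsL a b x).SameSignWith (r x)} := by
  have hta := continuous_paramsL_ta a b
  have htb := continuous_paramsL_tb a b
  have hc := continuous_paramsL_c a b
  have hd := continuous_paramsL_d a b
  simp only [Params.SameSignWith, SameSign, List.mem_cons, List.not_mem_nil, or_false,
      forall_eq_or_imp, forall_eq, ofPred_or, ofPred_and]
  have le : ∀ {f : ℝ → ℝ}, Continuous f → IsClosed {x | 0 ≤ f x} :=
    fun hf => isClosed_le continuous_const hf
  have ge : ∀ {f : ℝ → ℝ}, Continuous f → IsClosed {x | f x ≤ 0} :=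
    fun hf => isClosed_le hf continuous_const
  exact ((le hta).inter <| (le htb).inter <| (le (hc 0)).inter <| (le (hc 1)).inter <|
      (le (hc 2)).inter <| (le (hd 0)).inter <| (le (hd 1)).inter <|
      (le (hd 2)).inter (le hr)).union
    ((ge hta).inter <| (ge htb).inter <| (ge (hc 0)).inter <| (ge (hc 1)).inter <|
      (ge (hc 2)).inter <| (ge (hd 0)).inter <| (ge (hd 1)).inter <|
      (ge (hd 2)).inter (ge hr))

/-- Closedness in `x` of a condition of the type of (C1)-(C4). -/
theorem isClosed_cond {r s : ℝ → ℝ} (hr : Continuous r) (hs : Continuous s) (p : Prop) :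
    IsClosed {x | p ∧ (paramsL a b x).SameSignWith (r x) ∧ 0 ≤ (paramsL a b x).tc ∧ 0 ≤ s x} := by
  simp only [ofPred_and]
  exact isClosed_const.inter ((isClosed_sameSignWith a b hr).inter
    ((isClosed_le continuous_const (continuous_paramsL_tc a b)).inter
      (isClosed_le continuous_const hs)))

end Continuity

/-! ### Moving `x` to the left -/

/-- A closed set of reals with a non-negative element has a smallest non-negative element; if a
positive element is never smallest unless it has the property `T`, then that element is `0` or
has the property `T`. -/
theorem exists_mem_eq_zero_or {S : Set ℝ} (hS : IsClosed S) {T : ℝ → Prop} {x : ℝ} (hx : 0 ≤ x)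
    (hxS : x ∈ S)
    (h : ∀ y ∈ S, 0 < y → ¬ T y → ∃ᶠ z in 𝓝[<] y, z ∈ S) :
    ∃ y, 0 ≤ y ∧ y ∈ S ∧ (y = 0 ∨ T y) := by
  have hcomp : IsCompact (Icc 0 x ∩ S) := isCompact_Icc.inter_right hS
  obtain ⟨y, ⟨⟨hy0, hyx⟩, hyS⟩, hmin⟩ := hcomp.exists_isLeast ⟨x, ⟨hx, le_rfl⟩, hxS⟩
  refine ⟨y, hy0, hyS, ?_⟩
  by_contra! hcon
  have hpos : 0 < y := lt_of_le_of_ne hy0 hcon.1.symm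
  have hev : ∀ᶠ z in 𝓝[<] y, 0 < z ∧ z < y :=
    ((lt_mem_nhds hpos).filter_mono nhdsWithin_le_nhds).and self_mem_nhdsWithin
  obtain ⟨z, hzS, hz0, hzy⟩ := ((h y hyS hpos hcon.2).and_eventually hev).exists
  exact absurd (hmin ⟨⟨hz0.le, by linarith⟩, hzS⟩) (not_le.2 hzy)

/-- Applied with `h = ±α₂` and `f, g` the two `λ`'s of a pair of conditions. Where `h` vanishes both
`λ`'s are positive, so whichever sign `h` takes nearby, one of the two conditions is available. -/
theorem eventually_switch {f g h : ℝ → ℝ} (hf : Continuous f) (hg : Continuous g)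
    (hh : Continuous h) {x : ℝ} (hfx : 0 < f x) (hhx : 0 ≤ h x) (hgx : h x = 0 → 0 < g x) :
    ∀ᶠ y in 𝓝[<] x, (0 ≤ f y ∧ 0 ≤ h y) ∨ (0 ≤ g y ∧ h y ≤ 0) := by
  refine Filter.Eventually.filter_mono nhdsWithin_le_nhds ?_
  have h1 := hf.continuousAt.eventually (lt_mem_nhds hfx)
  rcases hhx.lt_or_eq with h0 | h0
  · filter_upwards [h1, hh.continuousAt.eventually (lt_mem_nhds h0)] with y h1 h2
    exact Or.inl ⟨h1.le, h2.le⟩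
  · filter_upwards [h1, hg.continuousAt.eventually (lt_mem_nhds (hgx h0.symm))] with y h1 h2
    rcases le_total 0 (h y) with h3 | h3
    · exact Or.inl ⟨h1.le, h3⟩
    · exact Or.inr ⟨h2.le, h3⟩

theorem eventually_signBase {a b : Fin 4 → ℝ} {x : ℝ}
    (hP : (paramsL a b x).SignBase) (hc : ∀ i, 0 < (paramsL a b x).tb * (paramsL a b x).c i)
    (hd : ∀ i, 0 < (paramsL a b x).tb * (paramsL a b x).d i) (htc : 0 < (paramsL a b x).tc) :
    ∀ᶠ y in 𝓝[<] x, (paramsL a b y).SignBase ∧ 0 ≤ (paramsL a b y).tc := by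
  have ct := continuous_paramsL_tb a b
  have cc := fun i => (ct.mul (continuous_paramsL_c a b i)).continuousAt.eventually
    (lt_mem_nhds (hc i))
  have cd := fun i => (ct.mul (continuous_paramsL_d a b i)).continuousAt.eventually
    (lt_mem_nhds (hd i))
  have ctc := (continuous_paramsL_tc a b).continuousAt.eventually (lt_mem_nhds htc)
  have ctt : ∀ᶠ y in 𝓝 x, 0 < (paramsL a b x).tb * (paramsL a b y).tb :=
    (continuous_const.mul ct).continuousAt.eventually
      (lt_mem_nhds (mul_self_pos.2 hP.ne))
  have hcx : Continuous fun y => evalCoeffs (paramsL a b x).c (-y) := by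
    simp only [evalCoeffs]
    fun_prop
  have ccx : ∀ᶠ y in 𝓝 x, 0 < evalCoeffs (paramsL a b x).c (-y) :=
    hcx.continuousAt.eventually (lt_mem_nhds htc)
  have ev := (((eventually_all.2 cc).and (eventually_all.2 cd)).and
    ((ctc.and ctt).and ccx)).filter_mono (nhdsWithin_le_nhds (s := Iio x))
  filter_upwards [ev, self_mem_nhdsWithin] with y ⟨⟨h1, h2⟩, ⟨h3, h4⟩, h5⟩ hy
  refine ⟨⟨?_, ?_, fun i => (h1 i).le, fun i => (h2 i).le⟩, h3.le⟩
  · rintro h0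
    simp [h0] at h4
  -- Continuity does not suffice for `ã`, which may be zero at `x`. Instead `ã(y)/b̃(y) -
  -- ã(x)/b̃(x)` has the sign of `(x - y) c(-y)`, so the ratio increases as `y` moves left of `x`.
  · have e : (paramsL a b y).ta * (paramsL a b x).tb - (paramsL a b y).tb * (paramsL a b x).ta =
      (x - y) * evalCoeffs (paramsL a b x).c (-y) := evalCoeffs_cross a b x y
    have hta := hP.ta
    have hne := hP.ne
    have hxy : 0 < x - y := sub_pos.2 hy
    generalize evalCoeffs (paramsL a b x).c (-y) = w at *
    generalize (paramsL a b x).tb = t at *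
    have h6 : 0 ≤ t ^ 2 * ((paramsL a b y).tb * (paramsL a b y).ta) := by
      have : t ^ 2 * ((paramsL a b y).tb * (paramsL a b y).ta) =
        (paramsL a b y).tb ^ 2 * (t * (paramsL a b x).ta) +
          (t * (paramsL a b y).tb) * ((x - y) * w) := by
        linear_combination (t * (paramsL a b y).tb) * e
      rw [this]
      positivity
    exact nonneg_of_mul_nonneg_right h6 (by positivity)

/-- Transfers `resultantZero_synth` to arbitrary `a, b` through `eq_synth`; only the sign of the
factor matters. -/
theorem exists_resultantZero_eq {a b : Fin 4 → ℝ} {x : ℝ} (ht : (paramsL a b x).tb ≠ 0)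
    (hc : 0 < (paramsL a b x).tc) :
    ∃ k, 0 < k ∧ resultantZero a b = -(k * (paramsL a b x).res) := by
  obtain ⟨h1, h2⟩ := eq_synth ht hc.ne'
  have e := resultantZero_synth ((paramsL a b x).ta / (paramsL a b x).tb)
      ((paramsL a b x).tb ^ 2 / (paramsL a b x).tc) x ((paramsL a b x).tb⁻¹ • (paramsL a b x).c)
      (((paramsL a b x).tb * (paramsL a b x).tc)⁻¹ • (paramsL a b x).d)
  rw [← h1, ← h2, res_smul] at e
  have hg : ((paramsL a b x).tb⁻¹ • (paramsL a b x).c) 0 -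
      ((paramsL a b x).tb⁻¹ • (paramsL a b x).c) 1 * x +
      ((paramsL a b x).tb⁻¹ • (paramsL a b x).c) 2 * x ^ 2 =
      (paramsL a b x).tb⁻¹ * (paramsL a b x).tc := by
    rw [paramsL_tc]
    simp only [Pi.smul_apply, smul_eq_mul]
    ring
  rw [hg] at e
  refine ⟨(paramsL a b x).tb ^ 2 / (paramsL a b x).tc *
    ((paramsL a b x).tb⁻¹ * (paramsL a b x).tc) ^ 2 *
    ((paramsL a b x).tb⁻¹ ^ 2 * ((paramsL a b x).tb * (paramsL a b x).tc)⁻¹ ^ 2), by positivity, ?_⟩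
  rw [e, mul_assoc _ _ (paramsL a b x).res]
  rfl

namespace Params

variable {P : Params}

theorem SignBase.smul_c (h : P.SignBase) : ∀ i, 0 ≤ (P.tb • P.c) i := h.c
theorem SignBase.smul_d (h : P.SignBase) : ∀ i, 0 ≤ (P.tb • P.d) i := h.d

theorem scaled_α₂ : (quadPair (P.tb • P.c) (P.tb • P.d)).α₂ = P.tb ^ 2 * P.α₂ := by
  rw [α₂_smul, sq]; rfl
theorem scaled_res : (quadPair (P.tb • P.c) (P.tb • P.d)).res = P.tb ^ 4 * P.res := by
  rw [res_smul, ← pow_add]; rfl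
theorem scaled_lam₁ : (quadPair (P.tb • P.c) (P.tb • P.d)).lam₁ = P.tb ^ 2 * (P.tb * P.lam₁) := by
  rw [lam₁_smul, show P.lam₁ = (quadPair P.c P.d).lam₁ from rfl]; ring
theorem scaled_lam₃ : (quadPair (P.tb • P.c) (P.tb • P.d)).lam₃ = P.tb ^ 2 * (P.tb * P.lam₃) := by
  rw [lam₃_smul, show P.lam₃ = (quadPair P.c P.d).lam₃ from rfl]; ring

/-- Multiplying both quadratics by `b̃` reduces to non-negative coefficients. The last clause
handles the crossing to (C2): at `α₂ = 0` one has `res = α₁ α₃ < 0` with `α₁ > 0`, so `α₃ < 0` and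
`λ₃ = -d₁ α₃` has the required sign. The variants for `λ₃`, `λ₄`, `λ₂` follow by reversal and
interchange. -/
theorem SignBase.strict₁ (h : P.SignBase) (hl : 0 ≤ P.tb * P.lam₁) (hα : 0 ≤ P.α₂)
    (hr : P.res < 0) (hl0 : P.lam₁ ≠ 0) (hc0 : P.c 0 ≠ 0) :
    (∀ i, 0 < P.tb * P.c i) ∧ (∀ i, 0 < P.tb * P.d i) ∧ 0 < P.tb * P.lam₁ ∧
      (P.α₂ = 0 → 0 < P.tb * P.lam₃) := by
  have ht := h.ne
  have t2 : 0 < P.tb ^ 2 := by positivity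
  have t4 : 0 < P.tb ^ 4 := by positivity
  have hl' : 0 ≤ (quadPair (P.tb • P.c) (P.tb • P.d)).lam₁ := by
    rw [scaled_lam₁]; positivity
  have hα' : 0 ≤ (quadPair (P.tb • P.c) (P.tb • P.d)).α₂ := by
    rw [scaled_α₂]; positivity
  have hr' : (quadPair (P.tb • P.c) (P.tb • P.d)).res < 0 := by
    rw [scaled_res]; exact mul_neg_of_pos_of_neg t4 hr
  obtain ⟨p1, p2⟩ := strict_of_lam₁ h.smul_c h.smul_d hl' hα' hr'
    (by rw [scaled_lam₁]; positivity) (mul_ne_zero ht hc0)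
  refine ⟨p1, p2, lt_of_le_of_ne hl (mul_ne_zero ht hl0).symm, fun h0 => ?_⟩
  refine pos_of_mul_pos_right (a := P.tb ^ 2) ?_ t2.le
  rw [← scaled_lam₃]
  have a1 := (α₁_pos_of_lam₁ h.smul_c h.smul_d hl' hα' hr'.ne).2
  have a2 : (quadPair (P.tb • P.c) (P.tb • P.d)).α₂ = 0 := by rw [scaled_α₂, h0, mul_zero]
  have er : (quadPair (P.tb • P.c) (P.tb • P.d)).res =
    (quadPair (P.tb • P.c) (P.tb • P.d)).α₁ * (quadPair (P.tb • P.c) (P.tb • P.d)).α₃ -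
      (quadPair (P.tb • P.c) (P.tb • P.d)).α₂ ^ 2 := rfl
  have el : (quadPair (P.tb • P.c) (P.tb • P.d)).lam₃ =
    P.tb * P.d 2 * (quadPair (P.tb • P.c) (P.tb • P.d)).α₂ -
      P.tb * P.d 1 * (quadPair (P.tb • P.c) (P.tb • P.d)).α₃ := rfl
  rw [el, a2]
  rw [er, a2] at hr'
  have a3 : (quadPair (P.tb • P.c) (P.tb • P.d)).α₃ < 0 := by
    by_contra! h3
    nlinarith [mul_nonneg a1.le h3]
  have := mul_pos (p2 1) (neg_pos.2 a3)
  rw [Pi.smul_apply, smul_eq_mul] at this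
  linarith

theorem SignBase.strict_of_res_pos (h : P.SignBase) (hl : 0 ≤ P.tb * P.lam₁) (hα : 0 ≤ P.α₂)
    (hr : 0 < P.res) (hc0 : P.c 0 ≠ 0) (hd2 : P.d 2 ≠ 0) :
    (∀ i, 0 < P.tb * P.c i) ∧ (∀ i, 0 < P.tb * P.d i) ∧ 0 < P.tb * P.lam₁ ∧ 0 < P.α₂ := by
  have ht := h.ne
  have t2 : 0 < P.tb ^ 2 := by positivity
  obtain ⟨p1, p2, p3, p4⟩ := strict_of_lam₁_of_res_pos h.smul_c h.smul_d
    (by rw [scaled_lam₁]; positivity) (by rw [scaled_α₂]; positivity)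
    (by rw [scaled_res]; positivity) (mul_ne_zero ht hc0) (mul_ne_zero ht hd2)
  rw [scaled_lam₁] at p3
  rw [scaled_α₂] at p4
  exact ⟨p1, p2, pos_of_mul_pos_right p3 t2.le, pos_of_mul_pos_right p4 t2.le⟩

/-- Interchange of the two quadratics. -/
def swap (P : Params) : Params := { P with c := P.d, d := P.c }

theorem SignBase.swap (h : P.SignBase) : P.swap.SignBase := ⟨h.ne, h.ta, h.d, h.c⟩

theorem rev_c (P : Params) (i : Fin 3) : P.rev.c i = P.c i.rev := by fin_cases i <;> rfl
theorem rev_d (P : Params) (i : Fin 3) : P.rev.d i = P.d i.rev := by fin_cases i <;> rfl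

theorem SignBase.rev (h : P.SignBase) : P.rev.SignBase :=
  ⟨h.ne, h.ta, fun i => by rw [rev_c]; exact h.c _, fun i => by rw [rev_d]; exact h.d _⟩

theorem SignBase.strict₃ (h : P.SignBase) (hl : 0 ≤ P.tb * P.lam₃) (hα : 0 ≤ -P.α₂)
    (hr : P.res < 0) (hl0 : P.lam₃ ≠ 0) (hc2 : P.c 2 ≠ 0) :
    (∀ i, 0 < P.tb * P.c i) ∧ (∀ i, 0 < P.tb * P.d i) ∧ 0 < P.tb * P.lam₃ ∧
      (-P.α₂ = 0 → 0 < P.tb * P.lam₁) := by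
  have e1 : P.rev.lam₁ = P.lam₃ := lam₁_rev P.c P.d
  have e3 : P.rev.lam₃ = P.lam₁ := lam₃_rev P.c P.d
  have eα : P.rev.α₂ = -P.α₂ := α₂_rev P.c P.d
  have er : P.rev.res = P.res := res_rev P.c P.d
  have key := h.rev.strict₁ (by rw [e1]; exact hl) (by rw [eα]; exact hα) (by rw [er]; exact hr)
    (by rw [e1]; exact hl0) hc2
  rw [e1, e3, eα] at key
  obtain ⟨k1, k2, k3, k4⟩ := key
  refine ⟨fun i => ?_, fun i => ?_, k3, k4⟩
  · have := k1 i.rev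
    rwa [rev_c, Fin.rev_rev] at this
  · have := k2 i.rev
    rwa [rev_d, Fin.rev_rev] at this

theorem SignBase.strict₄ (h : P.SignBase) (hl : 0 ≤ P.tb * P.lam₄) (hα : 0 ≤ -P.α₂)
    (hr : P.res < 0) (hl0 : P.lam₄ ≠ 0) (hd0 : P.d 0 ≠ 0) :
    (∀ i, 0 < P.tb * P.c i) ∧ (∀ i, 0 < P.tb * P.d i) ∧ 0 < P.tb * P.lam₄ ∧
      (-P.α₂ = 0 → 0 < P.tb * P.lam₂) := by
  have e1 : P.swap.lam₁ = P.lam₄ := lam₁_swap P.c P.d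
  have e3 : P.swap.lam₃ = P.lam₂ := lam₃_swap P.c P.d
  have eα : P.swap.α₂ = -P.α₂ := α₂_swap P.c P.d
  have er : P.swap.res = P.res := res_swap P.c P.d
  have key := h.swap.strict₁ (by rw [e1]; exact hl) (by rw [eα]; exact hα) (by rw [er]; exact hr)
    (by rw [e1]; exact hl0) hd0
  rw [e1, e3, eα] at key
  exact ⟨key.2.1, key.1, key.2.2⟩

theorem SignBase.strict₂ (h : P.SignBase) (hl : 0 ≤ P.tb * P.lam₂) (hα : 0 ≤ P.α₂)
    (hr : P.res < 0) (hl0 : P.lam₂ ≠ 0) (hd2 : P.d 2 ≠ 0) :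
    (∀ i, 0 < P.tb * P.c i) ∧ (∀ i, 0 < P.tb * P.d i) ∧ 0 < P.tb * P.lam₂ ∧
      (P.α₂ = 0 → 0 < P.tb * P.lam₄) := by
  have e1 : P.swap.lam₁ = P.lam₄ := lam₁_swap P.c P.d
  have e3 : P.swap.lam₃ = P.lam₂ := lam₃_swap P.c P.d
  have eα : P.swap.α₂ = -P.α₂ := α₂_swap P.c P.d
  have er : P.swap.res = P.res := res_swap P.c P.d
  have key := h.swap.strict₃ (by rw [e3]; exact hl) (by rw [eα, neg_neg]; exact hα)
    (by rw [er]; exact hr) (by rw [e3]; exact hl0) hd2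
  rw [e1, e3, eα, neg_neg] at key
  exact ⟨key.2.1, key.1, key.2.2⟩

end Params

theorem signBase_of_sameSignWith {a b : Fin 4 → ℝ} {x r : ℝ} (hx : 0 ≤ x) (hb : ∀ i, 0 ≤ b i)
    (hR : resultantZero a b ≠ 0) (hs : (paramsL a b x).SameSignWith r)
    (hc : 0 ≤ (paramsL a b x).tc) :
    (paramsL a b x).SignBase ∧ 0 ≤ (paramsL a b x).tb * r ∧ 0 < (paramsL a b x).tc := by
  obtain ⟨h1, h2⟩ := tb_ne_zero_and_tc_ne_zero hx hb hR hs
  obtain ⟨h3, h4⟩ := (Params.sameSignWith_iff h1).1 hs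
  exact ⟨h3, h4, lt_of_le_of_ne hc h2.symm⟩

theorem CondBase.signBase {a b : Fin 4 → ℝ} {x r : ℝ} (h : CondBase a b) (hx : 0 ≤ x)
    (hs : (paramsL a b x).SameSignWith r) (hc : 0 ≤ (paramsL a b x).tc) :
    (paramsL a b x).SignBase ∧ 0 ≤ (paramsL a b x).tb * r ∧ 0 < (paramsL a b x).tc ∧
      (paramsL a b x).res < 0 := by
  obtain ⟨h1, h2, h3⟩ := signBase_of_sameSignWith hx (fun i => (h.1 i).2) h.2.ne' hs hc
  refine ⟨h1, h2, h3, ?_⟩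
  obtain ⟨k, hk, e⟩ := exists_resultantZero_eq h1.ne h3
  have := h.2
  rw [e] at this
  by_contra! h0
  nlinarith [mul_nonneg hk.le h0]

/-! ### The least admissible `x` -/

section Tight

variable {a b : Fin 4 → ℝ} {x : ℝ}

theorem exists_tight_of_condC1_or_condC2 (hx : 0 ≤ x) (h : CondC1 a b x ∨ CondC2 a b x) :
    ∃ y, 0 ≤ y ∧
      ((CondC1 a b y ∧ (y = 0 ∨ (paramsL a b y).lam₁ = 0 ∨ (paramsL a b y).c 0 = 0)) ∨
       (CondC2 a b y ∧ (y = 0 ∨ (paramsL a b y).lam₃ = 0 ∨ (paramsL a b y).c 2 = 0))) := by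
  have c1 := continuous_paramsL_lam₁ a b
  have c3 := continuous_paramsL_lam₃ a b
  have cα := continuous_paramsL_α₂ a b
  have ct := continuous_paramsL_tb a b
  have hcl : IsClosed {y | CondC1 a b y ∨ CondC2 a b y} :=
    (isClosed_cond a b c1 cα _).union (isClosed_cond a b c3 cα.neg _)
  -- The stopping property keeps each vanishing quantity attached to its own condition, so when it
  -- fails, strictness is available for whichever condition holds at `y`.
  obtain ⟨y, hy, hyS, hT⟩ := exists_mem_eq_zero_or hcl (T := fun y =>
    (CondC1 a b y ∧ ((paramsL a b y).lam₁ = 0 ∨ (paramsL a b y).c 0 = 0)) ∨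
    (CondC2 a b y ∧ ((paramsL a b y).lam₃ = 0 ∨ (paramsL a b y).c 2 = 0))) hx h (by
    intro y hyS hy hT
    have hT1 := not_or.1 hT
    apply Eventually.frequently
    rcases id hyS with ⟨hb, hs, htc, hα⟩ | ⟨hb, hs, htc, hα⟩
    · obtain ⟨p1, p2, p3, p4⟩ := hb.signBase hy.le hs htc
      have hT2 := not_or.1 fun h => hT1.1 ⟨⟨hb, hs, htc, hα⟩, h⟩
      obtain ⟨q1, q2, q3, q4⟩ := p1.strict₁ p2 hα p4 hT2.1 hT2.2
      filter_upwards [eventually_signBase p1 q1 q2 p3,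
        eventually_switch (ct.mul c1) (ct.mul c3) cα q3 hα q4] with z hz1 hz2
      rcases hz2 with hz2 | hz2
      · exact Or.inl ⟨hb, (Params.sameSignWith_iff hz1.1.ne).2 ⟨hz1.1, hz2.1⟩, hz1.2, hz2.2⟩
      · exact Or.inr ⟨hb, (Params.sameSignWith_iff hz1.1.ne).2 ⟨hz1.1, hz2.1⟩, hz1.2,
          neg_nonneg.2 hz2.2⟩
    · obtain ⟨p1, p2, p3, p4⟩ := hb.signBase hy.le hs htc
      have hT2 := not_or.1 fun h => hT1.2 ⟨⟨hb, hs, htc, hα⟩, h⟩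
      obtain ⟨q1, q2, q3, q4⟩ := p1.strict₃ p2 hα p4 hT2.1 hT2.2
      filter_upwards [eventually_signBase p1 q1 q2 p3,
        eventually_switch (ct.mul c3) (ct.mul c1) cα.neg q3 hα q4] with z hz1 hz2
      rcases hz2 with hz2 | hz2
      · exact Or.inr ⟨hb, (Params.sameSignWith_iff hz1.1.ne).2 ⟨hz1.1, hz2.1⟩, hz1.2, hz2.2⟩
      · exact Or.inl ⟨hb, (Params.sameSignWith_iff hz1.1.ne).2 ⟨hz1.1, hz2.1⟩, hz1.2,
          neg_nonpos.1 hz2.2⟩)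
  refine ⟨y, hy, ?_⟩
  have hyS' : CondC1 a b y ∨ CondC2 a b y := hyS
  tauto

theorem exists_tight_of_condC3_or_condC4 (hx : 0 ≤ x) (h : CondC3 a b x ∨ CondC4 a b x) :
    ∃ y, 0 ≤ y ∧
      ((CondC3 a b y ∧ (y = 0 ∨ (paramsL a b y).lam₄ = 0 ∨ (paramsL a b y).d 0 = 0)) ∨
       (CondC4 a b y ∧ (y = 0 ∨ (paramsL a b y).lam₂ = 0 ∨ (paramsL a b y).d 2 = 0))) := by
  have c4 := continuous_paramsL_lam₄ a b
  have c2 := continuous_paramsL_lam₂ a b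
  have cα := continuous_paramsL_α₂ a b
  have ct := continuous_paramsL_tb a b
  have hcl : IsClosed {y | CondC3 a b y ∨ CondC4 a b y} :=
    (isClosed_cond a b c4 cα.neg _).union (isClosed_cond a b c2 cα _)
  obtain ⟨y, hy, hyS, hT⟩ := exists_mem_eq_zero_or hcl (T := fun y =>
    (CondC3 a b y ∧ ((paramsL a b y).lam₄ = 0 ∨ (paramsL a b y).d 0 = 0)) ∨
    (CondC4 a b y ∧ ((paramsL a b y).lam₂ = 0 ∨ (paramsL a b y).d 2 = 0))) hx h (by
    intro y hyS hy hT
    have hT1 := not_or.1 hT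
    apply Eventually.frequently
    rcases id hyS with ⟨hb, hs, htc, hα⟩ | ⟨hb, hs, htc, hα⟩
    · obtain ⟨p1, p2, p3, p4⟩ := hb.signBase hy.le hs htc
      have hT2 := not_or.1 fun h => hT1.1 ⟨⟨hb, hs, htc, hα⟩, h⟩
      obtain ⟨q1, q2, q3, q4⟩ := p1.strict₄ p2 hα p4 hT2.1 hT2.2
      filter_upwards [eventually_signBase p1 q1 q2 p3,
        eventually_switch (ct.mul c4) (ct.mul c2) cα.neg q3 hα q4] with z hz1 hz2
      rcases hz2 with hz2 | hz2
      · exact Or.inl ⟨hb, (Params.sameSignWith_iff hz1.1.ne).2 ⟨hz1.1, hz2.1⟩, hz1.2, hz2.2⟩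
      · exact Or.inr ⟨hb, (Params.sameSignWith_iff hz1.1.ne).2 ⟨hz1.1, hz2.1⟩, hz1.2,
          neg_nonpos.1 hz2.2⟩
    · obtain ⟨p1, p2, p3, p4⟩ := hb.signBase hy.le hs htc
      have hT2 := not_or.1 fun h => hT1.2 ⟨⟨hb, hs, htc, hα⟩, h⟩
      obtain ⟨q1, q2, q3, q4⟩ := p1.strict₂ p2 hα p4 hT2.1 hT2.2
      filter_upwards [eventually_signBase p1 q1 q2 p3,
        eventually_switch (ct.mul c2) (ct.mul c4) cα q3 hα q4] with z hz1 hz2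
      rcases hz2 with hz2 | hz2
      · exact Or.inr ⟨hb, (Params.sameSignWith_iff hz1.1.ne).2 ⟨hz1.1, hz2.1⟩, hz1.2, hz2.2⟩
      · exact Or.inl ⟨hb, (Params.sameSignWith_iff hz1.1.ne).2 ⟨hz1.1, hz2.1⟩, hz1.2,
          neg_nonneg.2 hz2.2⟩)
  refine ⟨y, hy, ?_⟩
  have hyS' : CondC3 a b y ∨ CondC4 a b y := hyS
  tauto

theorem Params.sameSignWith_rev {P : Params} {r : ℝ} :
    P.rev.SameSignWith r ↔ P.SameSignWith r := by
  simp only [Params.SameSignWith, SameSign, List.mem_cons, List.not_mem_nil, or_false,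
    forall_eq_or_imp, forall_eq, Params.rev, rev₃_zero, rev₃_one, rev₃_two]
  tauto

/-- Reversal turns `λ₁` into `λ₃` and negates `α₂`: apart from the sign of the resultant, (C5) is
(C2) for the reversed cubics, so the closedness and perturbation lemmas apply. -/
theorem condC5_iff : CondC5 a b x ↔ CondBase a b ∧
    (paramsL (rev₄ a) (rev₄ b) x).SameSignWith (paramsL (rev₄ a) (rev₄ b) x).lam₃ ∧
    0 ≤ (paramsL (rev₄ a) (rev₄ b) x).tc ∧ 0 ≤ -(paramsL (rev₄ a) (rev₄ b) x).α₂ := by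
  have e1 (P : Params) : P.rev.lam₁ = P.lam₃ := lam₁_rev P.c P.d
  have eα (P : Params) : P.rev.α₂ = -P.α₂ := α₂_rev P.c P.d
  rw [CondC5, paramsC_eq, Params.sameSignWith_rev, e1, eα]
  rfl

theorem CondBase.rev_nonneg (h : CondBase a b) (i : Fin 4) : 0 ≤ rev₄ b i := by
  fin_cases i
  exacts [(h.1 3).2, (h.1 2).2, (h.1 1).2, (h.1 0).2]

theorem CondBase.resultantZero_rev_neg (h : CondBase a b) :
    resultantZero (rev₄ a) (rev₄ b) < 0 := by
  rw [resultantZero_rev]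
  exact neg_neg_of_pos h.2

theorem CondC5.signBase (hx : 0 ≤ x) (h : CondC5 a b x) :
    (paramsL (rev₄ a) (rev₄ b) x).SignBase ∧ 0 < (paramsL (rev₄ a) (rev₄ b) x).tc ∧
    0 < (paramsL (rev₄ a) (rev₄ b) x).res ∧
    0 ≤ (paramsL (rev₄ a) (rev₄ b) x).tb * (paramsL (rev₄ a) (rev₄ b) x).lam₃ ∧
    0 ≤ -(paramsL (rev₄ a) (rev₄ b) x).α₂ := by
  obtain ⟨hb, hs, htc, hα⟩ := condC5_iff.1 h
  obtain ⟨h1, h2, h3⟩ := signBase_of_sameSignWith hx hb.rev_nonneg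
    hb.resultantZero_rev_neg.ne hs htc
  refine ⟨h1, h3, ?_, h2, hα⟩
  obtain ⟨k, hk, e⟩ := exists_resultantZero_eq h1.ne h3
  have := hb.resultantZero_rev_neg
  rw [e] at this
  by_contra! h0
  nlinarith [mul_nonneg hk.le (neg_nonneg.2 h0)]

/-- Here `res > 0` makes `λ₁` and `α₂` strictly of the right sign unless `c₀` or `d₂` vanishes.
Hence no crossing of `α₂ = 0` occurs and no alternative `λ₁ = 0` is needed. -/
theorem exists_tight_of_condC5 (hx : 0 ≤ x) (h : CondC5 a b x) :
    ∃ y, 0 ≤ y ∧ CondC5 a b y ∧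
      (y = 0 ∨ (paramsC a b y).c 0 = 0 ∨ (paramsC a b y).d 2 = 0) := by
  have c3 := continuous_paramsL_lam₃ (rev₄ a) (rev₄ b)
  have cα := (continuous_paramsL_α₂ (rev₄ a) (rev₄ b)).neg
  have ct := continuous_paramsL_tb (rev₄ a) (rev₄ b)
  have hcl : IsClosed {y | CondC5 a b y} := by
    simp only [condC5_iff]
    exact isClosed_cond (rev₄ a) (rev₄ b) c3 cα _
  refine exists_mem_eq_zero_or hcl (T := fun y =>
    (paramsC a b y).c 0 = 0 ∨ (paramsC a b y).d 2 = 0) hx h ?_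
  intro y hyS hy hT
  obtain ⟨p1, p2, p3, p4, p5⟩ := CondC5.signBase hy.le hyS
  rw [not_or, paramsC_eq] at hT
  have e1 (P : Params) : P.rev.lam₁ = P.lam₃ := lam₁_rev P.c P.d
  have eα (P : Params) : P.rev.α₂ = -P.α₂ := α₂_rev P.c P.d
  have er (P : Params) : P.rev.res = P.res := res_rev P.c P.d
  obtain ⟨q1, q2, q3, q4⟩ := p1.rev.strict_of_res_pos (by rw [e1]; exact p4)
    (by rw [eα]; exact p5) (by rw [er]; exact p3) hT.1 hT.2
  rw [e1] at q3
  rw [eα] at q4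
  apply Eventually.frequently
  have q1' := fun i : Fin 3 => q1 i.rev
  have q2' := fun i : Fin 3 => q2 i.rev
  simp only [Params.rev_c, Params.rev_d, Fin.rev_rev] at q1' q2'
  filter_upwards [eventually_signBase p1 q1' q2' p2,
    ((ct.mul c3).continuousAt.eventually (lt_mem_nhds q3)).filter_mono nhdsWithin_le_nhds,
    (cα.continuousAt.eventually (lt_mem_nhds q4)).filter_mono nhdsWithin_le_nhds] with z z1 z2 z3
  exact condC5_iff.2 ⟨(condC5_iff.1 hyS).1,
    (Params.sameSignWith_iff z1.1.ne).2 ⟨z1.1, z2.le⟩, z1.2, z3.le⟩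

end Tight

/-! ### Positivity on the half-line, as a source of nonzero denominators in `ℝ(s)` -/

open Polynomial in
/-- A ratio of two polynomials that are positive on the positive half-line. -/
def IsPosRat (Z : RatFunc ℝ) : Prop :=
  ∃ p q : ℝ[X], (∀ t, 0 < t → 0 < p.eval t) ∧ (∀ t, 0 < t → 0 < q.eval t) ∧
    Z = algebraMap ℝ[X] (RatFunc ℝ) p / algebraMap ℝ[X] (RatFunc ℝ) q

theorem algebraMap_ne_zero_of_pos {p : Polynomial ℝ} (hp : ∀ t, 0 < t → 0 < p.eval t) :
    algebraMap (Polynomial ℝ) (RatFunc ℝ) p ≠ 0 :=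
  RatFunc.algebraMap_ne_zero fun h => by simpa [h] using hp 1 one_pos

namespace IsPosRat

variable {Z W : RatFunc ℝ}

theorem ne_zero (h : IsPosRat Z) : Z ≠ 0 := by
  obtain ⟨p, q, hp, hq, rfl⟩ := h
  exact div_ne_zero (algebraMap_ne_zero_of_pos hp) (algebraMap_ne_zero_of_pos hq)

theorem inv (h : IsPosRat Z) : IsPosRat Z⁻¹ := by
  obtain ⟨p, q, hp, hq, rfl⟩ := h
  exact ⟨q, p, hq, hp, inv_div _ _⟩

theorem mul (h : IsPosRat Z) (h' : IsPosRat W) : IsPosRat (Z * W) := by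
  obtain ⟨p, q, hp, hq, rfl⟩ := h
  obtain ⟨p', q', hp', hq', rfl⟩ := h'
  refine ⟨p * p', q * q', fun t ht => ?_, fun t ht => ?_, ?_⟩
  · rw [Polynomial.eval_mul]; exact mul_pos (hp t ht) (hp' t ht)
  · rw [Polynomial.eval_mul]; exact mul_pos (hq t ht) (hq' t ht)
  · rw [map_mul, map_mul, div_mul_div_comm]

theorem add (h : IsPosRat Z) (h' : IsPosRat W) : IsPosRat (Z + W) := by
  obtain ⟨p, q, hp, hq, rfl⟩ := h
  obtain ⟨p', q', hp', hq', rfl⟩ := h'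
  refine ⟨p * q' + q * p', q * q', fun t ht => ?_, fun t ht => ?_, ?_⟩
  · rw [Polynomial.eval_add, Polynomial.eval_mul, Polynomial.eval_mul]
    exact add_pos (mul_pos (hp t ht) (hq' t ht)) (mul_pos (hq t ht) (hp' t ht))
  · rw [Polynomial.eval_mul]; exact mul_pos (hq t ht) (hq' t ht)
  · rw [map_add, map_mul, map_mul, map_mul,
      div_add_div _ _ (algebraMap_ne_zero_of_pos hq) (algebraMap_ne_zero_of_pos hq')]

theorem div (h : IsPosRat Z) (h' : IsPosRat W) : IsPosRat (Z / W) := by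
  rw [div_eq_mul_inv]; exact h.mul h'.inv

theorem C {r : ℝ} (hr : 0 < r) : IsPosRat (RatFunc.C r) :=
  ⟨Polynomial.C r, 1, fun t _ => by simpa using hr, fun t _ => by simp, by simp⟩

theorem X : IsPosRat RatFunc.X :=
  ⟨Polynomial.X, 1, fun t ht => by simpa using ht, fun t _ => by simp, by simp⟩

theorem one : IsPosRat 1 := by simpa using C one_pos

theorem C_add {r : ℝ} (hr : 0 ≤ r) (h : IsPosRat Z) : IsPosRat (RatFunc.C r + Z) := by
  rcases hr.lt_or_eq with h0 | rfl
  · exact (C h0).add h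
  · simpa using h

theorem add_C_mul {r : ℝ} (hr : 0 ≤ r) (h : IsPosRat Z) (h' : IsPosRat W) :
    IsPosRat (Z + RatFunc.C r * W) := by
  rcases hr.lt_or_eq with h0 | rfl
  · exact h.add ((C h0).mul h')
  · simpa using h

end IsPosRat

/-- The polynomial `c₂ s² + c₁ s + c₀`, viewed in `ℝ(s)`. -/
noncomputable def quad (c : Fin 3 → ℝ) : RatFunc ℝ :=
  RatFunc.C (c 0) + RatFunc.C (c 1) * RatFunc.X + RatFunc.C (c 2) * RatFunc.X ^ 2

theorem isPosRat_quad {c : Fin 3 → ℝ} (hc : ∀ i, 0 ≤ c i) (h : c ≠ 0) : IsPosRat (quad c) := by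
  refine ⟨Polynomial.C (c 0) + Polynomial.C (c 1) * Polynomial.X +
    Polynomial.C (c 2) * Polynomial.X ^ 2, 1, fun t ht => ?_, fun t _ => by simp, ?_⟩
  · have h0 := hc 0
    have h1 := hc 1
    have h2 := hc 2
    simp only [Polynomial.eval_add, Polynomial.eval_mul, Polynomial.eval_C, Polynomial.eval_X,
      Polynomial.eval_pow]
    rcases h0.lt_or_eq with h0' | h0'
    · positivity
    rcases h1.lt_or_eq with h1' | h1'
    · positivity
    rcases h2.lt_or_eq with h2' | h2'
    · positivity
    exact absurd (by ext i; fin_cases i <;> simp [← h0', ← h1', ← h2']) h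
  · simp [quad]

theorem quad_add_smul (c d : Fin 3 → ℝ) (r : ℝ) : quad (c + r • d) = quad c + RatFunc.C r * quad d := by
  simp [quad]; ring

theorem quad_smul (c : Fin 3 → ℝ) (r : ℝ) : quad (r • c) = RatFunc.C r * quad c := by
  simp [quad]; ring

/-! ### Impedances with one inductor -/

/-- The class of ratios `(α s + β) / (γ s + δ)` with non-negative coefficients and
`α δ - β γ > 0`. -/
def IsRL (Z : RatFunc ℝ) : Prop :=
  ∃ α β γ δ : ℝ, 0 ≤ α ∧ 0 ≤ β ∧ 0 ≤ γ ∧ 0 ≤ δ ∧ β * γ < α * δ ∧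
    Z = (RatFunc.C α * RatFunc.X + RatFunc.C β) / (RatFunc.C γ * RatFunc.X + RatFunc.C δ)

theorem isPosRat_linear {α β : ℝ} (hα : 0 ≤ α) (hβ : 0 ≤ β) (h : 0 < α + β) :
    IsPosRat (RatFunc.C α * RatFunc.X + RatFunc.C β) := by
  rcases hα.lt_or_eq with h0 | rfl
  · rw [add_comm]
    exact IsPosRat.C_add hβ ((IsPosRat.C h0).mul IsPosRat.X)
  · simpa using IsPosRat.C (by linarith)

/-- Normal form of an impedance with one inductor. -/
theorem IsRL.exists_eq {Z : RatFunc ℝ} (h : IsRL Z) : ∃ p k y : ℝ, 0 ≤ p ∧ 0 < k ∧ 0 ≤ y ∧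
    Z = RatFunc.C p + RatFunc.C k * RatFunc.X / (1 + RatFunc.C y * RatFunc.X) := by
  obtain ⟨α, β, γ, δ, hα, hβ, hγ, hδ, h, rfl⟩ := h
  have hδ' : 0 < δ := lt_of_le_of_ne hδ (by rintro rfl; nlinarith [mul_nonneg hβ hγ])
  refine ⟨β / δ, (α * δ - β * γ) / δ ^ 2, γ / δ, by positivity,
    div_pos (by linarith) (by positivity), by positivity, ?_⟩
  have h1 := (isPosRat_linear hγ hδ (by linarith)).ne_zero
  have h2 := (IsPosRat.C hδ').ne_zero
  have h3 : 1 + RatFunc.C (γ / δ) * RatFunc.X =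
      (RatFunc.C γ * RatFunc.X + RatFunc.C δ) / RatFunc.C δ := by
    rw [map_div₀]
    field_simp
    ring
  rw [h3]
  simp only [map_div₀, map_sub, map_mul, map_pow]
  obtain ⟨D, hD⟩ : ∃ D, D = RatFunc.C γ * RatFunc.X + RatFunc.C δ := ⟨_, rfl⟩
  rw [← hD] at h1 ⊢
  field_simp
  rw [hD]
  ring

/-- Normal form of an admittance with one inductor. -/
theorem IsRL.exists_inv_eq {Z : RatFunc ℝ} (h : IsRL Z) : ∃ p k y : ℝ, 0 ≤ p ∧ 0 < k ∧ 0 ≤ y ∧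
    Z⁻¹ = RatFunc.C p + RatFunc.C k / (RatFunc.X + RatFunc.C y) := by
  obtain ⟨α, β, γ, δ, hα, hβ, hγ, hδ, h, rfl⟩ := h
  have hα' : 0 < α := lt_of_le_of_ne hα (by rintro rfl; nlinarith [mul_nonneg hβ hγ])
  refine ⟨γ / α, (α * δ - β * γ) / α ^ 2, β / α, by positivity,
    div_pos (by linarith) (by positivity), by positivity, ?_⟩
  have h1 := (isPosRat_linear hα hβ (by linarith)).ne_zero
  have h2 := (IsPosRat.C hα').ne_zero
  have h3 : RatFunc.X + RatFunc.C (β / α) =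
      (RatFunc.C α * RatFunc.X + RatFunc.C β) / RatFunc.C α := by
    rw [map_div₀]
    field_simp
  rw [inv_div, h3]
  simp only [map_div₀, map_sub, map_mul, map_pow]
  obtain ⟨D, hD⟩ : ∃ D, D = RatFunc.C α * RatFunc.X + RatFunc.C β := ⟨_, rfl⟩
  rw [← hD] at h1 ⊢
  field_simp
  rw [hD]
  ring

theorem IsRL.add_C {Z : RatFunc ℝ} (h : IsRL Z) {r : ℝ} (hr : 0 < r) :
    IsRL (Z + RatFunc.C r) := by
  obtain ⟨α, β, γ, δ, hα, hβ, hγ, hδ, h, rfl⟩ := h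
  have hδ' : 0 < δ := lt_of_le_of_ne hδ (by rintro rfl; nlinarith [mul_nonneg hβ hγ])
  refine ⟨α + r * γ, β + r * δ, γ, δ, by positivity, by positivity, hγ, hδ, by nlinarith, ?_⟩
  have h1 := (isPosRat_linear hγ hδ (by linarith)).ne_zero
  simp only [map_add, map_mul]
  rw [div_add' _ _ _ h1]
  ring

theorem IsRL.inv_add_C {Z : RatFunc ℝ} (h : IsRL Z) {r : ℝ} (hr : 0 < r) :
    IsRL (Z⁻¹ + RatFunc.C r)⁻¹ := by
  obtain ⟨α, β, γ, δ, hα, hβ, hγ, hδ, h, rfl⟩ := h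
  have hα' : 0 < α := lt_of_le_of_ne hα (by rintro rfl; nlinarith [mul_nonneg hβ hγ])
  refine ⟨α, β, γ + r * α, δ + r * β, hα, hβ, by positivity, by positivity, by nlinarith, ?_⟩
  have h1 := (isPosRat_linear hα hβ (by linarith)).ne_zero
  rw [← inv_div (RatFunc.C (γ + r * α) * RatFunc.X + RatFunc.C (δ + r * β)), inv_div]
  congr 1
  simp only [map_add, map_mul]
  rw [div_add' _ _ _ h1]
  ring

theorem isRL_inductor {L : ℝ} (hL : 0 < L) : IsRL (RatFunc.C L * RatFunc.X) :=
  ⟨L, 0, 0, 1, hL.le, le_rfl, le_rfl, zero_le_one, by simpa using hL, by simp⟩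

/-! ### Impedances with two reactive elements, as ratios of quadratics -/

/-- `Z = c / d` for a pair of quadratics with non-negative coefficients in the class `Q`. -/
def IsQuadRatio (Q : (Fin 3 → ℝ) → (Fin 3 → ℝ) → Prop) (Z : RatFunc ℝ) : Prop :=
  ∃ c d : Fin 3 → ℝ, (∀ i, 0 ≤ c i) ∧ (∀ i, 0 ≤ d i) ∧ c ≠ 0 ∧ d ≠ 0 ∧ Q c d ∧
    Z = quad c / quad d

theorem add_smul_nonneg {c d : Fin 3 → ℝ} (hc : ∀ i, 0 ≤ c i) (hd : ∀ i, 0 ≤ d i) {r : ℝ}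
    (hr : 0 ≤ r) (i : Fin 3) : 0 ≤ (c + r • d) i :=
  add_nonneg (hc i) (mul_nonneg hr (hd i))

theorem add_smul_ne_zero {c d : Fin 3 → ℝ} (hc : ∀ i, 0 ≤ c i) (hd : ∀ i, 0 ≤ d i) {r : ℝ}
    (hr : 0 ≤ r) (h : c ≠ 0) : c + r • d ≠ 0 := by
  intro h0
  apply h
  ext i
  have h1 := congrFun h0 i
  have h2 := mul_nonneg hr (hd i)
  have h3 := hc i
  simp only [Pi.add_apply, Pi.smul_apply, smul_eq_mul, Pi.zero_apply] at *
  linarith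

namespace IsQuadRatio

variable {Q : (Fin 3 → ℝ) → (Fin 3 → ℝ) → Prop} {Z : RatFunc ℝ} {r : ℝ}

theorem isPosRat (h : IsQuadRatio Q Z) : IsPosRat Z := by
  obtain ⟨c, d, hc, hd, hc0, hd0, -, rfl⟩ := h
  exact (isPosRat_quad hc hc0).div (isPosRat_quad hd hd0)

theorem add_C
    (hQ : ∀ {c d : Fin 3 → ℝ} {r : ℝ}, (∀ i, 0 ≤ c i) → (∀ i, 0 ≤ d i) → 0 ≤ r →
      Q c d → Q (c + r • d) d)
    (h : IsQuadRatio Q Z) (hr : 0 ≤ r) : IsQuadRatio Q (Z + RatFunc.C r) := by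
  obtain ⟨c, d, hc, hd, hc0, hd0, hcd, rfl⟩ := h
  refine ⟨c + r • d, d, add_smul_nonneg hc hd hr, hd, add_smul_ne_zero hc hd hr hc0, hd0,
    hQ hc hd hr hcd, ?_⟩
  have := (isPosRat_quad hd hd0).ne_zero
  rw [quad_add_smul]
  field_simp

theorem inv_add_C
    (hQ : ∀ {c d : Fin 3 → ℝ} {r : ℝ}, (∀ i, 0 ≤ c i) → (∀ i, 0 ≤ d i) → 0 ≤ r →
      Q c d → Q c (d + r • c))
    (h : IsQuadRatio Q Z) (hr : 0 ≤ r) : IsQuadRatio Q (Z⁻¹ + RatFunc.C r)⁻¹ := by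
  obtain ⟨c, d, hc, hd, hc0, hd0, hcd, rfl⟩ := h
  refine ⟨c, d + r • c, hc, add_smul_nonneg hd hc hr, hc0, add_smul_ne_zero hd hc hr hd0,
    hQ hc hd hr hcd, ?_⟩
  have := (isPosRat_quad hc hc0).ne_zero
  rw [quad_add_smul, ← inv_div (_ + _), inv_div]
  congr 1
  field_simp

end IsQuadRatio

/-- An impedance with one inductor plus an impedance with one capacitor. -/
theorem isQuadRatio_series_RL_RC {Z W : RatFunc ℝ} (hZ : IsRL Z) (hW : IsRL W) :
    IsQuadRatio OneCapOneInd (Z + W⁻¹) := by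
  obtain ⟨p, k, y, hp, hk, hy, rfl⟩ := hZ.exists_eq
  obtain ⟨q, h, z, hq, hh, hz, e⟩ := hW.exists_inv_eq
  rw [e]
  have key : IsQuadRatio OneCapOneInd (RatFunc.C k * RatFunc.X / (1 + RatFunc.C y * RatFunc.X) +
      RatFunc.C h / (RatFunc.X + RatFunc.C z)) := by
    refine ⟨![h, k * z + h * y, k], ![z, 1 + y * z, y], ?_, ?_, ?_, ?_,
      oneCapOneInd_series hh hk hy hz, ?_⟩
    · intro i; fin_cases i <;> simp <;> positivity
    · intro i; fin_cases i <;> simp <;> positivity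
    · intro h0; simpa [hh.ne'] using congrFun h0 0
    · intro h0
      have := congrFun h0 1
      simp at this
      nlinarith [mul_nonneg hy hz]
    · have h1 : 1 + RatFunc.C y * RatFunc.X ≠ 0 :=
        (IsPosRat.one.add_C_mul hy IsPosRat.X).ne_zero
      have h2 : RatFunc.X + RatFunc.C z ≠ 0 := by
        rw [add_comm]; exact (IsPosRat.C_add hz IsPosRat.X).ne_zero
      have h3 : quad ![z, 1 + y * z, y] =
          (1 + RatFunc.C y * RatFunc.X) * (RatFunc.X + RatFunc.C z) := by
        simp [quad]; ring
      rw [h3, div_add_div _ _ h1 h2]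
      congr 1
      simp [quad]; ring
  have := key.add_C OneCapOneInd.add (add_nonneg hp hq)
  convert! this using 1
  simp only [map_add]
  ring

theorem isQuadRatio_series_RL_RL {Z W : RatFunc ℝ} (hZ : IsRL Z) (hW : IsRL W) :
    IsQuadRatio TwoInd (Z + W) := by
  obtain ⟨p, k, y, hp, hk, hy, rfl⟩ := hZ.exists_eq
  obtain ⟨q, h, z, hq, hh, hz, rfl⟩ := hW.exists_eq
  have key : IsQuadRatio TwoInd (RatFunc.C k * RatFunc.X / (1 + RatFunc.C y * RatFunc.X) +
      RatFunc.C h * RatFunc.X / (1 + RatFunc.C z * RatFunc.X)) := by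
    refine ⟨![0, k + h, k * z + h * y], ![1, y + z, y * z], ?_, ?_, ?_, ?_,
      twoInd_series hh hk hy hz, ?_⟩
    · intro i; fin_cases i <;> simp <;> positivity
    · intro i; fin_cases i <;> simp <;> positivity
    · intro h0; have := congrFun h0 1; simp at this; linarith
    · intro h0; simpa using congrFun h0 0
    · have h1 : 1 + RatFunc.C y * RatFunc.X ≠ 0 :=
        (IsPosRat.one.add_C_mul hy IsPosRat.X).ne_zero
      have h2 : 1 + RatFunc.C z * RatFunc.X ≠ 0 :=
        (IsPosRat.one.add_C_mul hz IsPosRat.X).ne_zero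
      have h3 : quad ![1, y + z, y * z] =
          (1 + RatFunc.C y * RatFunc.X) * (1 + RatFunc.C z * RatFunc.X) := by
        simp [quad]; ring
      rw [h3, div_add_div _ _ h1 h2]
      congr 1
      simp [quad]; ring
  have := key.add_C (fun _ _ _ h => h.add) (add_nonneg hp hq)
  convert! this using 1
  simp only [map_add]
  ring

theorem isQuadRatio_parallel_RL_RL {Z W : RatFunc ℝ} (hZ : IsRL Z) (hW : IsRL W) :
    IsQuadRatio TwoInd (Z⁻¹ + W⁻¹)⁻¹ := by
  obtain ⟨p, h, y, hp, hh, hy, e⟩ := hZ.exists_inv_eq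
  obtain ⟨q, k, z, hq, hk, hz, e'⟩ := hW.exists_inv_eq
  rw [e, e']
  have key : IsQuadRatio TwoInd (RatFunc.C h / (RatFunc.X + RatFunc.C y) +
      RatFunc.C k / (RatFunc.X + RatFunc.C z))⁻¹ := by
    refine ⟨![y * z, y + z, 1], ![h * z + k * y, h + k, 0], ?_, ?_, ?_, ?_,
      twoInd_parallel hh hk hy hz, ?_⟩
    · intro i; fin_cases i <;> simp <;> positivity
    · intro i; fin_cases i <;> simp <;> positivity
    · intro h0; simpa using congrFun h0 2
    · intro h0; have := congrFun h0 1; simp at this; linarith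
    · have h1 : RatFunc.X + RatFunc.C y ≠ 0 := by
        rw [add_comm]; exact (IsPosRat.C_add hy IsPosRat.X).ne_zero
      have h2 : RatFunc.X + RatFunc.C z ≠ 0 := by
        rw [add_comm]; exact (IsPosRat.C_add hz IsPosRat.X).ne_zero
      have h3 : quad ![y * z, y + z, 1] =
          (RatFunc.X + RatFunc.C y) * (RatFunc.X + RatFunc.C z) := by
        simp [quad]; ring
      rw [h3, div_add_div _ _ h1 h2, inv_div]
      congr 1
      simp [quad]; ring
  have := key.inv_add_C (fun _ _ _ h => h.add_right) (add_nonneg hp hq)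
  convert! this using 1
  rw [inv_inv]
  simp only [map_add]
  ring

/-! ### The substitution `s ↦ 1/s`, network dualities and degree bounds -/

open Polynomial in
-- Up to a power of `s`, `p(1/s)` is the reversed polynomial, which is nonzero. This lets the
-- substitution extend from polynomials to `ℝ(s)`.
theorem eval₂_inv_X_ne_zero {p : ℝ[X]} (hp : p ≠ 0) :
    eval₂ RatFunc.C (RatFunc.X : RatFunc ℝ)⁻¹ p ≠ 0 := by
  intro h
  let _ : Invertible (RatFunc.X : RatFunc ℝ)⁻¹ := invertibleOfNonzero (inv_ne_zero RatFunc.X_ne_zero)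
  rw [← eval₂_reverse_eq_zero_iff, invOf_eq_inv, inv_inv] at h
  have e : ∀ q : ℝ[X], eval₂ RatFunc.C (RatFunc.X : RatFunc ℝ) q =
      algebraMap ℝ[X] (RatFunc ℝ) q := by
    intro q
    have : eval₂RingHom RatFunc.C (RatFunc.X : RatFunc ℝ) = algebraMap ℝ[X] (RatFunc ℝ) := by
      apply Polynomial.ringHom_ext
      · intro r; simp [RatFunc.algebraMap_C]
      · simp [RatFunc.algebraMap_X]
    exact RingHom.congr_fun this q
  rw [e] at h
  exact RatFunc.algebraMap_ne_zero (mt reverse_eq_zero.mp hp) h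

/-- The substitution `s ↦ 1 / s` on `ℝ(s)`. -/
noncomputable def substInv : RatFunc ℝ →+* RatFunc ℝ :=
  RatFunc.liftRingHom (Polynomial.eval₂RingHom RatFunc.C (RatFunc.X : RatFunc ℝ)⁻¹)
    (fun p hp => by
      simpa using eval₂_inv_X_ne_zero (nonZeroDivisors.ne_zero hp))

@[simp] theorem substInv_C (r : ℝ) : substInv (RatFunc.C r) = RatFunc.C r := by
  rw [substInv, ← RatFunc.algebraMap_C, RatFunc.liftRingHom_algebraMap]
  simp

@[simp] theorem substInv_X : substInv RatFunc.X = RatFunc.X⁻¹ := by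
  have := RatFunc.liftRingHom_algebraMap (Polynomial.eval₂RingHom RatFunc.C
    (RatFunc.X : RatFunc ℝ)⁻¹) (fun p hp => by
      simpa using eval₂_inv_X_ne_zero (nonZeroDivisors.ne_zero hp)) Polynomial.X
  rw [RatFunc.algebraMap_X] at this
  exact this.trans (Polynomial.eval₂_X _ _)

theorem substInv_substInv (Z : RatFunc ℝ) : substInv (substInv Z) = Z := by
  have : substInv.comp substInv = RingHom.id (RatFunc ℝ) := by
    apply IsLocalization.ringHom_ext (nonZeroDivisors (Polynomial ℝ))
    apply Polynomial.ringHom_ext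
    · intro r
      simp [RatFunc.algebraMap_C]
    · simp [RatFunc.algebraMap_X]
  exact RingHom.congr_fun this Z

namespace SPNetwork

/-- The network whose impedance is `1 / Z`. -/
noncomputable def recip : SPNetwork → SPNetwork
  | .resistor R hR => .resistor R⁻¹ (inv_pos.2 hR)
  | .inductor L hL => .capacitor L hL
  | .capacitor K hK => .inductor K hK
  | .series N₁ N₂ => .parallel N₁.recip N₂.recip
  | .parallel N₁ N₂ => .series N₁.recip N₂.recip

theorem impedance_recip (N : SPNetwork) : N.recip.impedance = N.impedance⁻¹ := by
  induction N with
  | resistor R hR => simp [recip, impedance]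
  | inductor L hL => simp [recip, impedance]
  | capacitor K hK => simp [recip, impedance]
  | series N₁ N₂ h₁ h₂ => simp [recip, impedance, h₁, h₂]
  | parallel N₁ N₂ h₁ h₂ => simp [recip, impedance, h₁, h₂]

theorem numCapacitors_recip (N : SPNetwork) : N.recip.numCapacitors = N.numInductors := by
  induction N <;> simp_all [recip, numCapacitors, numInductors]

theorem numInductors_recip (N : SPNetwork) : N.recip.numInductors = N.numCapacitors := by
  induction N <;> simp_all [recip, numCapacitors, numInductors]

/-- The network whose impedance is `1 / Z(1 / s)`. -/
noncomputable def dual : SPNetwork → SPNetwork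
  | .resistor R hR => .resistor R⁻¹ (inv_pos.2 hR)
  | .inductor L hL => .inductor L⁻¹ (inv_pos.2 hL)
  | .capacitor K hK => .capacitor K⁻¹ (inv_pos.2 hK)
  | .series N₁ N₂ => .parallel N₁.dual N₂.dual
  | .parallel N₁ N₂ => .series N₁.dual N₂.dual

theorem impedance_dual (N : SPNetwork) : N.dual.impedance = (substInv N.impedance)⁻¹ := by
  induction N with
  | resistor R hR => simp [dual, impedance]
  | inductor L hL => simp [dual, impedance]; ring
  | capacitor K hK => simp [dual, impedance]; ring
  | series N₁ N₂ h₁ h₂ => simp [dual, impedance, h₁, h₂]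
  | parallel N₁ N₂ h₁ h₂ => simp [dual, impedance, h₁, h₂]

theorem numCapacitors_dual (N : SPNetwork) : N.dual.numCapacitors = N.numCapacitors := by
  induction N <;> simp_all [dual, numCapacitors]

theorem numInductors_dual (N : SPNetwork) : N.dual.numInductors = N.numInductors := by
  induction N <;> simp_all [dual, numInductors]

theorem isPosRat_impedance (N : SPNetwork) : IsPosRat N.impedance := by
  induction N with
  | resistor R hR => exact IsPosRat.C hR
  | inductor L hL => exact (IsPosRat.C hL).mul IsPosRat.X
  | capacitor K hK => exact ((IsPosRat.C hK).mul IsPosRat.X).inv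
  | series N₁ N₂ h₁ h₂ => exact h₁.add h₂
  | parallel N₁ N₂ h₁ h₂ => exact (h₁.inv.add h₂.inv).inv

open Polynomial in
-- Degrees of fractions add under a sum. A parallel connection is the reciprocal of a series
-- connection of reciprocals, and reciprocation only exchanges numerator with denominator and the
-- two element counts.
theorem exists_natDegree_le (N : SPNetwork) : ∃ p q : ℝ[X], q ≠ 0 ∧
    p.natDegree ≤ N.numCapacitors + N.numInductors ∧
    q.natDegree ≤ N.numCapacitors + N.numInductors ∧
    N.impedance = algebraMap ℝ[X] (RatFunc ℝ) p / algebraMap ℝ[X] (RatFunc ℝ) q := by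
  have key : ∀ N : SPNetwork, (∃ p q : ℝ[X], q ≠ 0 ∧
    p.natDegree ≤ N.numCapacitors + N.numInductors ∧
    q.natDegree ≤ N.numCapacitors + N.numInductors ∧
    N.impedance = algebraMap ℝ[X] (RatFunc ℝ) p / algebraMap ℝ[X] (RatFunc ℝ) q) →
    ∃ p q : ℝ[X], q ≠ 0 ∧
    p.natDegree ≤ N.recip.numCapacitors + N.recip.numInductors ∧
    q.natDegree ≤ N.recip.numCapacitors + N.recip.numInductors ∧
    N.recip.impedance = algebraMap ℝ[X] (RatFunc ℝ) p / algebraMap ℝ[X] (RatFunc ℝ) q := by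
    rintro N ⟨p, q, hq, h1, h2, e⟩
    rw [numCapacitors_recip, numInductors_recip, add_comm]
    refine ⟨q, p, ?_, h2, h1, by rw [impedance_recip, e, inv_div]⟩
    rintro rfl
    exact N.isPosRat_impedance.ne_zero (by rw [e]; simp)
  have add : ∀ {Z W : RatFunc ℝ} {m n : ℕ}, (∃ p q : ℝ[X], q ≠ 0 ∧
      p.natDegree ≤ m ∧ q.natDegree ≤ m ∧
      Z = algebraMap ℝ[X] (RatFunc ℝ) p / algebraMap ℝ[X] (RatFunc ℝ) q) →
      (∃ p q : ℝ[X], q ≠ 0 ∧ p.natDegree ≤ n ∧ q.natDegree ≤ n ∧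
      W = algebraMap ℝ[X] (RatFunc ℝ) p / algebraMap ℝ[X] (RatFunc ℝ) q) →
      ∃ p q : ℝ[X], q ≠ 0 ∧ p.natDegree ≤ m + n ∧ q.natDegree ≤ m + n ∧
      Z + W = algebraMap ℝ[X] (RatFunc ℝ) p / algebraMap ℝ[X] (RatFunc ℝ) q := by
    rintro Z W m n ⟨p, q, hq, h1, h2, rfl⟩ ⟨p', q', hq', h1', h2', rfl⟩
    refine ⟨p * q' + q * p', q * q', mul_ne_zero hq hq', ?_, ?_, ?_⟩
    · exact natDegree_add_le_of_degree_le (natDegree_mul_le_of_le h1 h2')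
        (natDegree_mul_le_of_le h2 h1')
    · exact natDegree_mul_le_of_le h2 h2'
    · rw [map_add, map_mul, map_mul, map_mul, div_add_div _ _
        (RatFunc.algebraMap_ne_zero hq) (RatFunc.algebraMap_ne_zero hq')]
  have recip_recip : ∀ N : SPNetwork, N.recip.recip.impedance = N.impedance := fun N => by
    rw [impedance_recip, impedance_recip, inv_inv]
  induction N with
  | resistor R hR => exact ⟨C R, 1, one_ne_zero, by simp, by simp, by simp [impedance]⟩
  | inductor L hL =>
    exact ⟨C L * X, 1, one_ne_zero, (natDegree_C_mul_X_pow_le L 1).trans' (by simp), by simp,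
      by simp [impedance]⟩
  | capacitor K hK =>
    exact ⟨1, C K * X, by simp [hK.ne'], by simp, (natDegree_C_mul_X_pow_le K 1).trans' (by simp),
      by simp [impedance]⟩
  | series N₁ N₂ h₁ h₂ =>
    have := add h₁ h₂
    simp only [impedance, numCapacitors, numInductors]
    rwa [add_add_add_comm]
  | parallel N₁ N₂ h₁ h₂ =>
    have h : ∃ p q : ℝ[X], q ≠ 0 ∧
        p.natDegree ≤ (series N₁.recip N₂.recip).numCapacitors +
          (series N₁.recip N₂.recip).numInductors ∧
        q.natDegree ≤ (series N₁.recip N₂.recip).numCapacitors +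
          (series N₁.recip N₂.recip).numInductors ∧
        (series N₁.recip N₂.recip).impedance =
          algebraMap ℝ[X] (RatFunc ℝ) p / algebraMap ℝ[X] (RatFunc ℝ) q := by
      have := add (key _ h₁) (key _ h₂)
      simp only [impedance, numCapacitors, numInductors]
      rwa [add_add_add_comm]
    have := key _ h
    simpa only [recip, impedance, numCapacitors, numInductors, recip_recip, numCapacitors_recip,
      numInductors_recip] using this

end SPNetwork

open Polynomial in
theorem mcMillanDegree_le {p q : ℝ[X]} {n : ℕ} (hq : q ≠ 0) (hp' : p.natDegree ≤ n)
    (hq' : q.natDegree ≤ n) :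
    mcMillanDegree (algebraMap ℝ[X] (RatFunc ℝ) p / algebraMap ℝ[X] (RatFunc ℝ) q) ≤ n := by
  rw [mcMillanDegree]
  apply max_le
  · rcases eq_or_ne p 0 with rfl | hp
    · simp
    · exact (natDegree_le_of_dvd (RatFunc.num_div_dvd p hq) hp).trans hp'
  · exact (natDegree_le_of_dvd (RatFunc.denom_div_dvd p q) hq).trans hq'

theorem SPNetwork.mcMillanDegree_impedance_le (N : SPNetwork) :
    mcMillanDegree N.impedance ≤ N.numCapacitors + N.numInductors := by
  obtain ⟨p, q, hq, h1, h2, e⟩ := N.exists_natDegree_le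
  rw [e]
  exact mcMillanDegree_le hq h1 h2

namespace IsQuadRatio

variable {Z : RatFunc ℝ}

theorem inv (h : IsQuadRatio OneCapOneInd Z) : IsQuadRatio OneCapOneInd Z⁻¹ := by
  obtain ⟨c, d, hc, hd, hc0, hd0, hcd, rfl⟩ := h
  exact ⟨d, c, hd, hc, hd0, hc0, hcd.swap, inv_div _ _⟩

theorem inv_add_C_of_oneCapOneInd (h : IsQuadRatio OneCapOneInd Z) {r : ℝ} (hr : 0 ≤ r) :
    IsQuadRatio OneCapOneInd (Z⁻¹ + RatFunc.C r)⁻¹ :=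
  (h.inv.add_C OneCapOneInd.add hr).inv

theorem smul_inv {Q : (Fin 3 → ℝ) → (Fin 3 → ℝ) → Prop}
    (hQ : ∀ {c d : Fin 3 → ℝ} {v : ℝ}, 0 < v → Q c d → Q c (v • d)) {k : ℝ} (hk : 0 < k)
    (h : IsQuadRatio Q Z) : IsQuadRatio Q (RatFunc.C k * Z⁻¹)⁻¹ := by
  obtain ⟨c, d, hc, hd, hc0, hd0, hcd, rfl⟩ := h
  refine ⟨c, k • d, hc, fun i => mul_nonneg hk.le (hd i), hc0, smul_ne_zero hk.ne' hd0,
    hQ hk hcd, ?_⟩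
  rw [quad_smul, inv_div, ← mul_div_assoc, inv_div]

end IsQuadRatio

theorem OneCapOneInd.smul_right {c d : Fin 3 → ℝ} {v : ℝ} (hv : 0 < v) (h : OneCapOneInd c d) :
    OneCapOneInd c (v • d) := by
  have e1 := lam₁_smul (c := c) (d := d) (u := 1) (v := v)
  have e2 := lam₂_smul (c := c) (d := d) (u := 1) (v := v)
  have e3 := lam₃_smul (c := c) (d := d) (u := 1) (v := v)
  have e4 := lam₄_smul (c := c) (d := d) (u := 1) (v := v)
  have eα := α₂_smul (c := c) (d := d) (u := 1) (v := v)
  have er := res_smul (c := c) (d := d) (u := 1) (v := v)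
  rw [one_smul] at er e1 e2 e3 e4 eα
  refine ⟨?_, by rw [er]; exact mul_nonpos_of_nonneg_of_nonpos (by positivity) h.2⟩
  have h' := h.1
  unfold RegularPair at *
  rw [e1, e2, e3, e4, eα]
  have hv2 : 0 < 1 * v ^ 2 := by positivity
  have hv1 : 0 < 1 * v := by positivity
  have hv3 : 0 < 1 ^ 2 * v := by positivity
  have hv4 : ∀ r : ℝ, 1 * v * r ≤ 0 ↔ r ≤ 0 := fun r => by
    rw [← neg_nonneg, ← mul_neg, mul_nonneg_iff_of_pos_left hv1, neg_nonneg]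
  simpa only [mul_nonneg_iff_of_pos_left hv2, mul_nonneg_iff_of_pos_left hv1,
    mul_nonneg_iff_of_pos_left hv3, hv4] using h'

theorem TwoInd.smul_right {c d : Fin 3 → ℝ} {v : ℝ} (hv : 0 < v) (h : TwoInd c d) :
    TwoInd c (v • d) := by
  have er := res_smul (c := c) (d := d) (u := 1) (v := v)
  have e2 := α₂_smul (c := c) (d := d) (u := 1) (v := v)
  have e1 : (quadPair c (v • d)).α₁ = v * (quadPair c d).α₁ := by
    simp [Params.α₁, quadPair]; ring
  have e3 : (quadPair c (v • d)).α₃ = v * (quadPair c d).α₃ := by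
    simp [Params.α₃, quadPair]; ring
  rw [one_smul] at er e2
  unfold TwoInd at *
  obtain ⟨h1, h2, h3, h4⟩ := h
  rw [e1, e2, e3, er]
  exact ⟨by positivity, by positivity, by positivity, by positivity⟩

namespace SPNetwork

theorem exists_impedance_eq_C (N : SPNetwork) (hC : N.numCapacitors = 0) (hL : N.numInductors = 0) :
    ∃ r, 0 < r ∧ N.impedance = RatFunc.C r := by
  induction N with
  | resistor R hR => exact ⟨R, hR, rfl⟩
  | inductor L hL' => simp [numInductors] at hL
  | capacitor K hK => simp [numCapacitors] at hC
  | series N₁ N₂ h₁ h₂ =>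
    simp only [numCapacitors, numInductors, Nat.add_eq_zero_iff] at hC hL
    obtain ⟨r, hr, e⟩ := h₁ hC.1 hL.1
    obtain ⟨s, hs, e'⟩ := h₂ hC.2 hL.2
    exact ⟨r + s, add_pos hr hs, by rw [impedance, e, e', map_add]⟩
  | parallel N₁ N₂ h₁ h₂ =>
    simp only [numCapacitors, numInductors, Nat.add_eq_zero_iff] at hC hL
    obtain ⟨r, hr, e⟩ := h₁ hC.1 hL.1
    obtain ⟨s, hs, e'⟩ := h₂ hC.2 hL.2
    exact ⟨(r⁻¹ + s⁻¹)⁻¹, by positivity, by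
      rw [impedance, e, e', map_inv₀, map_add, map_inv₀, map_inv₀]⟩

/-- To prove a property of the impedances of the networks with `m` capacitors and `n` inductors
that is stable under series and parallel connection with a resistor, it suffices to consider
single elements and connections of networks that both contain an energy storage element. -/
theorem impedance_induction {P : RatFunc ℝ → Prop} {m n : ℕ} (hmn : 0 < m + n)
    (hadd : ∀ {Z : RatFunc ℝ} {r : ℝ}, IsPosRat Z → 0 < r → P Z → P (Z + RatFunc.C r))
    (hpar : ∀ {Z : RatFunc ℝ} {r : ℝ}, IsPosRat Z → 0 < r → P Z → P (Z⁻¹ + RatFunc.C r)⁻¹)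
    (hL : m = 0 → n = 1 → ∀ L : ℝ, 0 < L → P (RatFunc.C L * RatFunc.X))
    (hC : m = 1 → n = 0 → ∀ K : ℝ, 0 < K → P (RatFunc.C K * RatFunc.X)⁻¹)
    (hconn : ∀ N₁ N₂ : SPNetwork, N₁.numCapacitors + N₂.numCapacitors = m →
      N₁.numInductors + N₂.numInductors = n →
      0 < N₁.numCapacitors + N₁.numInductors → 0 < N₂.numCapacitors + N₂.numInductors →
      P (series N₁ N₂).impedance ∧ P (parallel N₁ N₂).impedance)
    (N : SPNetwork) (h1 : N.numCapacitors = m) (h2 : N.numInductors = n) : P N.impedance := by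
  induction N with
  | resistor R hR => simp only [numCapacitors, numInductors] at h1 h2; omega
  | inductor L hL' => exact hL h1.symm h2.symm L hL'
  | capacitor K hK => exact hC h1.symm h2.symm K hK
  | series N₁ N₂ ih₁ ih₂ =>
    simp only [numCapacitors, numInductors] at h1 h2
    by_cases c1 : N₁.numCapacitors + N₁.numInductors = 0
    · obtain ⟨r, hr, e⟩ := N₁.exists_impedance_eq_C (by omega) (by omega)
      rw [impedance, e, add_comm]
      exact hadd N₂.isPosRat_impedance hr (ih₂ (by omega) (by omega))
    by_cases c2 : N₂.numCapacitors + N₂.numInductors = 0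
    · obtain ⟨r, hr, e⟩ := N₂.exists_impedance_eq_C (by omega) (by omega)
      rw [impedance, e]
      exact hadd N₁.isPosRat_impedance hr (ih₁ (by omega) (by omega))
    exact (hconn N₁ N₂ h1 h2 (by omega) (by omega)).1
  | parallel N₁ N₂ ih₁ ih₂ =>
    simp only [numCapacitors, numInductors] at h1 h2
    by_cases c1 : N₁.numCapacitors + N₁.numInductors = 0
    · obtain ⟨r, hr, e⟩ := N₁.exists_impedance_eq_C (by omega) (by omega)
      rw [impedance, e, add_comm, ← map_inv₀]
      exact hpar N₂.isPosRat_impedance (inv_pos.2 hr) (ih₂ (by omega) (by omega))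
    by_cases c2 : N₂.numCapacitors + N₂.numInductors = 0
    · obtain ⟨r, hr, e⟩ := N₂.exists_impedance_eq_C (by omega) (by omega)
      rw [impedance, e, ← map_inv₀]
      exact hpar N₁.isPosRat_impedance (inv_pos.2 hr) (ih₁ (by omega) (by omega))
    exact (hconn N₁ N₂ h1 h2 (by omega) (by omega)).2

theorem isRL_impedance (N : SPNetwork) (hC : N.numCapacitors = 0) (hL : N.numInductors = 1) :
    IsRL N.impedance :=
  impedance_induction (m := 0) (n := 1) one_pos (fun _ hr h => h.add_C hr)
    (fun _ hr h => h.inv_add_C hr) (fun _ _ _ hL => isRL_inductor hL) (by omega)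
    (fun N₁ N₂ _ _ _ _ => by omega) N hC hL

theorem isRL_inv_impedance (N : SPNetwork) (hC : N.numCapacitors = 1) (hL : N.numInductors = 0) :
    IsRL N.impedance⁻¹ := by
  rw [← impedance_recip]
  exact N.recip.isRL_impedance (by rw [numCapacitors_recip, hL]) (by rw [numInductors_recip, hC])

theorem isQuadRatio_oneCapOneInd (N : SPNetwork) (hC : N.numCapacitors = 1)
    (hL : N.numInductors = 1) : IsQuadRatio OneCapOneInd N.impedance := by
  refine impedance_induction (m := 1) (n := 1) two_pos
    (fun _ hr h => h.add_C OneCapOneInd.add hr.le)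
    (fun _ hr h => h.inv_add_C_of_oneCapOneInd hr.le) (by omega) (by omega) ?_ N hC hL
  have key : ∀ N₁ N₂ : SPNetwork, N₁.numCapacitors = 0 → N₁.numInductors = 1 →
      N₂.numCapacitors = 1 → N₂.numInductors = 0 →
      IsQuadRatio OneCapOneInd (series N₁ N₂).impedance ∧
      IsQuadRatio OneCapOneInd (parallel N₁ N₂).impedance := by
    intro N₁ N₂ h1 h2 h3 h4
    constructor
    · have := isQuadRatio_series_RL_RC (N₁.isRL_impedance h1 h2) (N₂.isRL_inv_impedance h3 h4)
      rwa [inv_inv] at this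
    · have := isQuadRatio_series_RL_RC (N₂.isRL_inv_impedance h3 h4) (N₁.isRL_impedance h1 h2)
      rw [add_comm] at this
      exact this.inv
  intro N₁ N₂ h1 h2 h3 h4
  by_cases h : N₁.numCapacitors = 0
  · exact key N₁ N₂ h (by omega) (by omega) (by omega)
  · have := key N₂ N₁ (by omega) (by omega) (by omega) (by omega)
    simpa only [impedance, add_comm] using this

theorem isQuadRatio_twoInd (N : SPNetwork) (hC : N.numCapacitors = 0)
    (hL : N.numInductors = 2) : IsQuadRatio TwoInd N.impedance := by
  refine impedance_induction (m := 0) (n := 2) two_pos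
    (fun _ hr h => h.add_C (fun _ _ _ h => h.add) hr.le)
    (fun _ hr h => h.inv_add_C (fun _ _ _ h => h.add_right) hr.le) (by omega) (by omega) ?_ N hC hL
  intro N₁ N₂ h1 h2 h3 h4
  have r1 := N₁.isRL_impedance (by omega) (by omega)
  have r2 := N₂.isRL_impedance (by omega) (by omega)
  exact ⟨isQuadRatio_series_RL_RL r1 r2, isQuadRatio_parallel_RL_RL r1 r2⟩

end SPNetwork

/-! ### Normal form of networks with two inductors and one capacitor -/

/-- Admittances of parallel connections of a first degree and a second degree network that
together contain two inductors and one capacitor. -/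
def IsCoreAdmittance (W : RatFunc ℝ) : Prop :=
  (∃ K x : ℝ, ∃ V, 0 < K ∧ 0 ≤ x ∧ IsQuadRatio OneCapOneInd V ∧
    W = RatFunc.C K / (RatFunc.X + RatFunc.C x) + V⁻¹) ∨
  (∃ K x : ℝ, ∃ V, 0 < K ∧ 0 ≤ x ∧ IsQuadRatio TwoInd V ∧
    W = RatFunc.C K * RatFunc.X / (1 + RatFunc.C x * RatFunc.X) + V⁻¹)

theorem IsCoreAdmittance.isPosRat {W : RatFunc ℝ} (h : IsCoreAdmittance W) : IsPosRat W := by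
  rcases h with ⟨K, x, V, hK, hx, hV, rfl⟩ | ⟨K, x, V, hK, hx, hV, rfl⟩
  · refine ((IsPosRat.C hK).div ?_).add hV.isPosRat.inv
    rw [add_comm]
    exact IsPosRat.C_add hx IsPosRat.X
  · exact (((IsPosRat.C hK).mul IsPosRat.X).div (IsPosRat.one.add_C_mul hx IsPosRat.X)).add
      hV.isPosRat.inv

theorem IsCoreAdmittance.affine {W : RatFunc ℝ} (h : IsCoreAdmittance W) {k g : ℝ} (hk : 0 < k)
    (hg : 0 ≤ g) : IsCoreAdmittance (RatFunc.C k * W + RatFunc.C g) := by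
  rcases h with ⟨K, x, V, hK, hx, hV, rfl⟩ | ⟨K, x, V, hK, hx, hV, rfl⟩
  · refine Or.inl ⟨k * K, x, _, mul_pos hk hK, hx,
      (hV.smul_inv OneCapOneInd.smul_right hk).inv_add_C_of_oneCapOneInd hg, ?_⟩
    rw [inv_inv, inv_inv, map_mul]
    ring
  · refine Or.inr ⟨k * K, x, _, mul_pos hk hK, hx,
      (hV.smul_inv TwoInd.smul_right hk).inv_add_C (fun _ _ _ h => h.add_right) hg, ?_⟩
    rw [inv_inv, inv_inv, map_mul]
    ring

/-- Impedances of a resistor, possibly of zero resistance, in series with a parallel connection. -/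
def IsCoreImpedance (Z : RatFunc ℝ) : Prop :=
  ∃ R : ℝ, ∃ W, 0 ≤ R ∧ IsCoreAdmittance W ∧ Z = RatFunc.C R + W⁻¹

theorem IsCoreImpedance.add_C {Z : RatFunc ℝ} (h : IsCoreImpedance Z) {r : ℝ} (hr : 0 < r) :
    IsCoreImpedance (Z + RatFunc.C r) := by
  obtain ⟨R, W, hR, hW, rfl⟩ := h
  exact ⟨R + r, W, by positivity, hW, by rw [map_add]; ring⟩

/-- A parallel resistor outside the series `R` moves inside: `(1 + R W)/(g + (1 + g R) W)` is its
limit `R/(1 + g R)` for large `W` plus the inverse of `(1 + g R)² W + g (1 + g R)`, and that affine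
change of `W` is absorbed by `IsCoreAdmittance.affine`. -/
theorem IsCoreImpedance.inv_add_C {Z : RatFunc ℝ} (h : IsCoreImpedance Z) {g : ℝ} (hg : 0 < g) :
    IsCoreImpedance (Z⁻¹ + RatFunc.C g)⁻¹ := by
  obtain ⟨R, W, hR, hW, rfl⟩ := h
  have hk : 0 < 1 + g * R := by positivity
  refine ⟨R / (1 + g * R), _, by positivity,
    hW.affine (k := (1 + g * R) ^ 2) (g := g * (1 + g * R)) (by positivity) (by positivity), ?_⟩
  have h1 := hW.isPosRat.ne_zero
  have h2 := (IsPosRat.one.add_C_mul hR hW.isPosRat).ne_zero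
  have h3 : RatFunc.C (1 + g * R) ≠ 0 := (IsPosRat.C hk).ne_zero
  have h4 : RatFunc.C g + RatFunc.C (1 + g * R) * W ≠ 0 :=
    (IsPosRat.C_add hg.le ((IsPosRat.C hk).mul hW.isPosRat)).ne_zero
  have e1 : RatFunc.C R + W⁻¹ = (1 + RatFunc.C R * W) / W := by field_simp; ring
  have e2 : W / (1 + RatFunc.C R * W) + RatFunc.C g =
      (RatFunc.C g + RatFunc.C (1 + g * R) * W) / (1 + RatFunc.C R * W) := by
    rw [div_add' _ _ _ h2]
    simp only [map_add, map_mul, map_one]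
    ring
  have e3 : RatFunc.C ((1 + g * R) ^ 2) * W + RatFunc.C (g * (1 + g * R)) =
      RatFunc.C (1 + g * R) * (RatFunc.C g + RatFunc.C (1 + g * R) * W) := by
    simp only [map_mul, map_pow]; ring
  have e4 : RatFunc.C (1 + g * R) = 1 + RatFunc.C g * RatFunc.C R := by simp
  rw [e1, inv_div, e2, inv_div, e3, map_div₀]
  obtain ⟨D, hD⟩ : ∃ D, D = RatFunc.C g + RatFunc.C (1 + g * R) * W := ⟨_, rfl⟩
  rw [← hD] at h4 ⊢
  obtain ⟨E, hE⟩ : ∃ E, E = RatFunc.C (1 + g * R) := ⟨_, rfl⟩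
  rw [← hE] at h3 hD e4 ⊢
  field_simp
  rw [hD, e4]
  ring

namespace SPNetwork

theorem isCoreImpedance_parallel (N₁ N₂ : SPNetwork)
    (hC : N₁.numCapacitors + N₂.numCapacitors = 1) (hL : N₁.numInductors + N₂.numInductors = 2)
    (h₁ : 0 < N₁.numCapacitors + N₁.numInductors) (h₂ : 0 < N₂.numCapacitors + N₂.numInductors) :
    IsCoreImpedance (parallel N₁ N₂).impedance := by
  have key : ∀ N₁ N₂ : SPNetwork, N₁.numCapacitors + N₂.numCapacitors = 1 →
      N₁.numInductors + N₂.numInductors = 2 → N₁.numCapacitors + N₁.numInductors = 1 →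
      IsCoreImpedance (parallel N₁ N₂).impedance := by
    intro N₁ N₂ hC hL h₁
    refine ⟨0, N₁.impedance⁻¹ + N₂.impedance⁻¹, le_rfl, ?_, by simp [impedance]⟩
    by_cases h : N₁.numCapacitors = 0
    · left
      -- The constant part `p` of this admittance is a conductance; it is moved to the other branch,
      -- leaving a bare `k/(s + y)`.
      obtain ⟨p, k, y, hp, hk, hy, e⟩ := (N₁.isRL_impedance h (by omega)).exists_inv_eq
      refine ⟨k, y, _, hk, hy, (N₂.isQuadRatio_oneCapOneInd (by omega)
        (by omega)).inv_add_C_of_oneCapOneInd hp, ?_⟩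
      rw [e, inv_inv]
      ring
    · right
      obtain ⟨p, k, y, hp, hk, hy, e⟩ :=
        (N₁.isRL_inv_impedance (by omega) (by omega)).exists_eq
      refine ⟨k, y, _, hk, hy, (N₂.isQuadRatio_twoInd (by omega)
        (by omega)).inv_add_C (fun _ _ _ h => h.add_right) hp, ?_⟩
      rw [e, inv_inv]
      ring
  by_cases h : N₁.numCapacitors + N₁.numInductors = 1
  · exact key N₁ N₂ hC hL h
  · have := key N₂ N₁ (by omega) (by omega) (by omega)
    rwa [impedance, add_comm] at this

/-- Under `Z ↦ 1/Z(1/s)` a series resistor becomes a parallel one and conversely, so each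
alternative persists under both kinds of resistor. A series connection of reactive parts has a
parallel dual. -/
theorem isCoreImpedance_or_dual (N : SPNetwork) (hC : N.numCapacitors = 1)
    (hL : N.numInductors = 2) :
    IsCoreImpedance N.impedance ∨ IsCoreImpedance (substInv N.impedance)⁻¹ := by
  refine impedance_induction (P := fun Z => IsCoreImpedance Z ∨ IsCoreImpedance (substInv Z)⁻¹)
    (m := 1) (n := 2) three_pos ?_ ?_ (by omega) (by omega) ?_ N hC hL
  · rintro Z r - hr (h | h)
    · exact Or.inl (h.add_C hr)
    · right
      simpa using h.inv_add_C hr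
  · rintro Z r - hr (h | h)
    · exact Or.inl (h.inv_add_C hr)
    · right
      simpa using h.add_C hr
  · intro N₁ N₂ h1 h2 h3 h4
    refine ⟨Or.inr ?_, Or.inl (isCoreImpedance_parallel N₁ N₂ h1 h2 h3 h4)⟩
    rw [← impedance_dual]
    exact isCoreImpedance_parallel N₁.dual N₂.dual (by simpa only [numCapacitors_dual] using h1)
      (by simpa only [numInductors_dual] using h2)
      (by simpa only [numCapacitors_dual, numInductors_dual] using h3)
      (by simpa only [numCapacitors_dual, numInductors_dual] using h4)

end SPNetwork

/-! ### From the normal form to the conditions -/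

theorem cubic_eq (p : Fin 4 → ℝ) : cubic p = RatFunc.C (p 0) + RatFunc.C (p 1) * RatFunc.X +
    RatFunc.C (p 2) * RatFunc.X ^ 2 + RatFunc.C (p 3) * RatFunc.X ^ 3 := by
  simp [cubic, Fin.sum_univ_succ]; ring

theorem cubic_synthDen (K x : ℝ) (c d : Fin 3 → ℝ) : cubic (synthDen K x c d) =
    RatFunc.C K * quad c + (RatFunc.X + RatFunc.C x) * quad d := by
  simp [cubic_eq, synthDen, quad]; ring

theorem cubic_synthNum (R K x : ℝ) (c d : Fin 3 → ℝ) : cubic (synthNum R K x c d) =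
    RatFunc.C R * cubic (synthDen K x c d) + (RatFunc.X + RatFunc.C x) * quad c := by
  rw [cubic_synthDen]
  simp [cubic_eq, synthNum, quad]; ring

theorem cubic_rev_synthDen (K x : ℝ) (c d : Fin 3 → ℝ) :
    cubic (rev₄ (synthDen K x (rev₃ c) (rev₃ d))) =
      RatFunc.C K * RatFunc.X * quad c + (1 + RatFunc.C x * RatFunc.X) * quad d := by
  simp [cubic_eq, synthDen, quad, rev₄, rev₃]; ring

theorem cubic_rev_synthNum (R K x : ℝ) (c d : Fin 3 → ℝ) :
    cubic (rev₄ (synthNum R K x (rev₃ c) (rev₃ d))) =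
      RatFunc.C R * cubic (rev₄ (synthDen K x (rev₃ c) (rev₃ d))) +
        (1 + RatFunc.C x * RatFunc.X) * quad c := by
  rw [cubic_rev_synthDen]
  simp [cubic_eq, synthNum, quad, rev₄, rev₃]; ring

/-- The impedance of a resistor in series with a parallel connection, as a single fraction. -/
theorem add_inv_add_inv {R A B c d : RatFunc ℝ} (hB : B ≠ 0) (hc : c ≠ 0)
    (h : A * c + B * d ≠ 0) :
    R + (A / B + (c / d)⁻¹)⁻¹ = (R * (A * c + B * d) + B * c) / (A * c + B * d) := by
  have e : A / B + (c / d)⁻¹ = (A * c + B * d) / (B * c) := by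
    rw [inv_div, div_add_div _ _ hB hc]
  rw [e, inv_div, add_div, mul_div_cancel_right₀ _ h]

theorem isPosRat_X_add_C {x : ℝ} (hx : 0 ≤ x) : IsPosRat (RatFunc.X + RatFunc.C x) := by
  rw [add_comm]
  exact IsPosRat.C_add hx IsPosRat.X

section Synth

variable {R K x : ℝ} {c d : Fin 3 → ℝ}

theorem synth_ratio (hK : 0 < K) (hx : 0 ≤ x) (hc : ∀ i, 0 ≤ c i) (hd : ∀ i, 0 ≤ d i)
    (hc0 : c ≠ 0) (hd0 : d ≠ 0) :
    RatFunc.C R + (RatFunc.C K / (RatFunc.X + RatFunc.C x) + (quad c / quad d)⁻¹)⁻¹ =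
      cubic (synthNum R K x c d) / cubic (synthDen K x c d) := by
  have h1 := isPosRat_X_add_C hx
  have h2 := isPosRat_quad hc hc0
  have h3 := isPosRat_quad hd hd0
  rw [cubic_synthNum, cubic_synthDen]
  exact add_inv_add_inv h1.ne_zero h2.ne_zero
    (((IsPosRat.C hK).mul h2).add (h1.mul h3)).ne_zero

theorem rev_synth_ratio (hK : 0 < K) (hx : 0 ≤ x) (hc : ∀ i, 0 ≤ c i) (hd : ∀ i, 0 ≤ d i)
    (hc0 : c ≠ 0) (hd0 : d ≠ 0) :
    RatFunc.C R + (RatFunc.C K * RatFunc.X / (1 + RatFunc.C x * RatFunc.X) +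
      (quad c / quad d)⁻¹)⁻¹ =
      cubic (rev₄ (synthNum R K x (rev₃ c) (rev₃ d))) /
        cubic (rev₄ (synthDen K x (rev₃ c) (rev₃ d))) := by
  have h0 := (IsPosRat.C hK).mul IsPosRat.X
  have h1 := IsPosRat.one.add_C_mul hx IsPosRat.X
  have h2 := isPosRat_quad hc hc0
  have h3 := isPosRat_quad hd hd0
  rw [cubic_rev_synthNum, cubic_rev_synthDen]
  exact add_inv_add_inv h1.ne_zero h2.ne_zero
    ((h0.mul h2).add (h1.mul h3)).ne_zero

theorem synthDen_nonneg (hK : 0 ≤ K) (hx : 0 ≤ x) (hc : ∀ i, 0 ≤ c i) (hd : ∀ i, 0 ≤ d i)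
    (i : Fin 4) : 0 ≤ synthDen K x c d i := by
  have := hc 0
  have := hc 1
  have := hc 2
  have := hd 0
  have := hd 1
  have := hd 2
  fin_cases i <;> simp [synthDen] <;> positivity

theorem synthNum_nonneg (hR : 0 ≤ R) (hK : 0 ≤ K) (hx : 0 ≤ x) (hc : ∀ i, 0 ≤ c i)
    (hd : ∀ i, 0 ≤ d i) (i : Fin 4) : 0 ≤ synthNum R K x c d i := by
  have := hc 0
  have := hc 1
  have := hc 2
  have := hd 0
  have := hd 1
  have := hd 2
  fin_cases i <;> simp [synthNum] <;> positivity

/-- The signs of the quantities attached to the numerator and denominator of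
`R + 1 / (K / (s + x) + d / c)`. -/
theorem signs_synth (hR : 0 ≤ R) (hK : 0 < K) (hc : ∀ i, 0 ≤ c i) (hd : ∀ i, 0 ≤ d i)
    (hg : c 0 - c 1 * x + c 2 * x ^ 2 ≠ 0) :
    let P := paramsL (synthNum R K x c d) (synthDen K x c d) x
    (∀ r, 0 ≤ P.tb * r → P.SameSignWith r) ∧ 0 ≤ P.tc ∧
      ∃ u v w : ℝ, 0 < u ∧ 0 < v ∧ 0 < w ∧ P.α₂ = u * (quadPair c d).α₂ ∧
        P.tb * P.lam₁ = v * (quadPair c d).lam₁ ∧ P.tb * P.lam₂ = w * (quadPair c d).lam₂ ∧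
        P.tb * P.lam₃ = v * (quadPair c d).lam₃ ∧ P.tb * P.lam₄ = w * (quadPair c d).lam₄ := by
  rw [paramsL_synth R K x c d _ rfl]
  generalize c 0 - c 1 * x + c 2 * x ^ 2 = g at *
  intro P
  have ht : P.tb ≠ 0 := mul_ne_zero hK.ne' hg
  -- The three factors are `K³ g⁴`, `K⁶ g⁸` and `K⁵ g⁶`. All powers of `g` are even, so the sign of
  -- `g = c(-x)` is irrelevant; this is why the conditions ask only for a common sign.
  refine ⟨fun r hr => (Params.sameSignWith_iff ht).2 ⟨⟨ht, ?_, fun i => ?_, fun i => ?_⟩, hr⟩,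
    by positivity, K * g * (K ^ 2 * g ^ 3), K * g * (K * g * (K ^ 2 * g ^ 3) ^ 2),
    K * g * ((K * g) ^ 2 * (K ^ 2 * g ^ 3)), ?_, ?_, ?_, ?_, ?_, ?_, ?_, ?_⟩
  · show 0 ≤ K * g * (R * (K * g))
    rw [show K * g * (R * (K * g)) = R * (K * g) ^ 2 by ring]
    positivity
  · show 0 ≤ K * g * (K * g * c i)
    rw [← mul_assoc]
    exact mul_nonneg (mul_self_nonneg _) (hc i)
  · show 0 ≤ K * g * (K ^ 2 * g ^ 3 * d i)
    rw [show K * g * (K ^ 2 * g ^ 3 * d i) = K ^ 3 * g ^ 4 * d i by ring]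
    have := hd i
    positivity
  · rw [show K * g * (K ^ 2 * g ^ 3) = K ^ 3 * g ^ 4 by ring]; positivity
  · rw [show K * g * (K * g * (K ^ 2 * g ^ 3) ^ 2) = K ^ 6 * g ^ 8 by ring]; positivity
  · rw [show K * g * ((K * g) ^ 2 * (K ^ 2 * g ^ 3)) = K ^ 5 * g ^ 6 by ring]; positivity
  · exact α₂_smul
  · exact (congrArg (K * g * ·) lam₁_smul).trans (mul_assoc _ _ _).symm
  · exact (congrArg (K * g * ·) lam₂_smul).trans (mul_assoc _ _ _).symm
  · exact (congrArg (K * g * ·) lam₃_smul).trans (mul_assoc _ _ _).symm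
  · exact (congrArg (K * g * ·) lam₄_smul).trans (mul_assoc _ _ _).symm

end Synth

/-- The conclusion of the classification, for given coefficients and given `x`. -/
def TightCond (a b : Fin 4 → ℝ) (x : ℝ) : Prop :=
  (CondC1 a b x ∧ (x = 0 ∨ (paramsL a b x).lam₁ = 0 ∨ (paramsL a b x).c 0 = 0)) ∨
  (CondC2 a b x ∧ (x = 0 ∨ (paramsL a b x).lam₃ = 0 ∨ (paramsL a b x).c 2 = 0)) ∨
  (CondC3 a b x ∧ (x = 0 ∨ (paramsL a b x).lam₄ = 0 ∨ (paramsL a b x).d 0 = 0)) ∨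
  (CondC4 a b x ∧ (x = 0 ∨ (paramsL a b x).lam₂ = 0 ∨ (paramsL a b x).d 2 = 0)) ∨
  (CondC5 a b x ∧ (x = 0 ∨ (paramsC a b x).c 0 = 0 ∨ (paramsC a b x).d 2 = 0))

theorem TightCond.condBase {a b : Fin 4 → ℝ} {x : ℝ} (h : TightCond a b x) : CondBase a b := by
  rcases h with h | h | h | h | h <;> exact h.1.1

theorem exists_tightCond {a b : Fin 4 → ℝ} {x : ℝ} (hx : 0 ≤ x)
    (h : CondC1 a b x ∨ CondC2 a b x ∨ CondC3 a b x ∨ CondC4 a b x ∨ CondC5 a b x) :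
    ∃ y, 0 ≤ y ∧ TightCond a b y := by
  rcases h with h | h | h | h | h
  · obtain ⟨y, hy, h | h⟩ := exists_tight_of_condC1_or_condC2 hx (Or.inl h)
    exacts [⟨y, hy, Or.inl h⟩, ⟨y, hy, Or.inr (Or.inl h)⟩]
  · obtain ⟨y, hy, h | h⟩ := exists_tight_of_condC1_or_condC2 hx (Or.inr h)
    exacts [⟨y, hy, Or.inl h⟩, ⟨y, hy, Or.inr (Or.inl h)⟩]
  · obtain ⟨y, hy, h | h⟩ := exists_tight_of_condC3_or_condC4 hx (Or.inl h)
    exacts [⟨y, hy, Or.inr (Or.inr (Or.inl h))⟩, ⟨y, hy, Or.inr (Or.inr (Or.inr (Or.inl h)))⟩]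
  · obtain ⟨y, hy, h | h⟩ := exists_tight_of_condC3_or_condC4 hx (Or.inr h)
    exacts [⟨y, hy, Or.inr (Or.inr (Or.inl h))⟩, ⟨y, hy, Or.inr (Or.inr (Or.inr (Or.inl h)))⟩]
  · obtain ⟨y, hy, h⟩ := exists_tight_of_condC5 hx h
    exact ⟨y, hy, Or.inr (Or.inr (Or.inr (Or.inr h)))⟩

theorem IsCoreImpedance.exists_tightCond {Z : RatFunc ℝ} (h : IsCoreImpedance Z) :
    ∃ a b : Fin 4 → ℝ, Z = cubic a / cubic b ∧
      (resultantZero a b ≠ 0 → ∃ x, 0 ≤ x ∧ TightCond a b x) := by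
  obtain ⟨R, W, hR, ⟨K, x, V, hK, hx, ⟨c, d, hc, hd, hc0, hd0, hcd, rfl⟩, rfl⟩ |
    ⟨K, x, V, hK, hx, ⟨c, d, hc, hd, hc0, hd0, hcd, rfl⟩, rfl⟩, rfl⟩ := h
  · refine ⟨_, _, synth_ratio hK hx hc hd hc0 hd0, fun hres => ?_⟩
    rw [resultantZero_synth] at hres
    have hg : c 0 - c 1 * x + c 2 * x ^ 2 ≠ 0 := by rintro h0; simp [h0] at hres
    have hr : (quadPair c d).res < 0 :=
      lt_of_le_of_ne hcd.2 (by rintro h0; simp [h0] at hres)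
    have hbase : CondBase (synthNum R K x c d) (synthDen K x c d) := by
      refine ⟨fun i => ⟨synthNum_nonneg hR hK.le hx hc hd i, synthDen_nonneg hK.le hx hc hd i⟩, ?_⟩
      rw [resultantZero_synth, ← mul_neg]
      exact mul_pos (by positivity) (neg_pos.2 hr)
    obtain ⟨h1, h2, u, v, w, hu, hv, hw, e, e1, e2, e3, e4⟩ := signs_synth hR hK hc hd hg
    refine _root_.exists_tightCond hx ?_
    rcases hcd.1 with ⟨hl, hα⟩ | ⟨hl, hα⟩ | ⟨hl, hα⟩ | ⟨hl, hα⟩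
    · exact Or.inl ⟨hbase, h1 _ (by rw [e1]; positivity), h2, by rw [e]; positivity⟩
    · refine Or.inr (Or.inl ⟨hbase, h1 _ (by rw [e3]; positivity), h2, ?_⟩)
      rw [e, ← mul_neg]
      exact mul_nonneg hu.le (neg_nonneg.2 hα)
    · refine Or.inr (Or.inr (Or.inl ⟨hbase, h1 _ (by rw [e4]; positivity), h2, ?_⟩))
      rw [e, ← mul_neg]
      exact mul_nonneg hu.le (neg_nonneg.2 hα)
    · exact Or.inr (Or.inr (Or.inr (Or.inl
        ⟨hbase, h1 _ (by rw [e2]; positivity), h2, by rw [e]; positivity⟩)))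
  · refine ⟨_, _, rev_synth_ratio hK hx hc hd hc0 hd0, fun hres => ?_⟩
    rw [resultantZero_rev, resultantZero_synth, neg_neg, res_rev] at hres
    have hg : rev₃ c 0 - rev₃ c 1 * x + rev₃ c 2 * x ^ 2 ≠ 0 := by
      intro h0
      rw [h0] at hres
      simp at hres
    have hr : 0 < (quadPair c d).res :=
      lt_of_le_of_ne hcd.2.2.2 (by rintro h0; simp [← h0] at hres)
    have hc' : ∀ i, 0 ≤ rev₃ c i := by intro i; fin_cases i; exacts [hc 2, hc 1, hc 0]
    have hd' : ∀ i, 0 ≤ rev₃ d i := by intro i; fin_cases i; exacts [hd 2, hd 1, hd 0]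
    have hbase : CondBase (rev₄ (synthNum R K x (rev₃ c) (rev₃ d)))
        (rev₄ (synthDen K x (rev₃ c) (rev₃ d))) := by
      have hn := synthNum_nonneg hR hK.le hx hc' hd'
      have hdn := synthDen_nonneg hK.le hx hc' hd'
      refine ⟨fun i => ?_, ?_⟩
      · fin_cases i
        exacts [⟨hn 3, hdn 3⟩, ⟨hn 2, hdn 2⟩, ⟨hn 1, hdn 1⟩, ⟨hn 0, hdn 0⟩]
      · rw [resultantZero_rev, resultantZero_synth, neg_neg, res_rev]
        positivity
    obtain ⟨h1, h2, u, v, w, hu, hv, hw, e, -, -, e3, -⟩ := signs_synth hR hK hc' hd' hg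
    refine _root_.exists_tightCond hx ?_
    refine Or.inr (Or.inr (Or.inr (Or.inr (condC5_iff.2 ?_))))
    rw [rev₄_rev₄, rev₄_rev₄]
    refine ⟨hbase, h1 _ ?_, h2, ?_⟩
    · rw [e3, lam₃_rev]
      exact mul_nonneg hv.le (hcd.lam₁_nonneg hd)
    · rw [e, α₂_rev, ← mul_neg, neg_neg]
      exact mul_nonneg hu.le hcd.2.1

open Polynomial in
-- A left kernel vector of the Sylvester matrix consists of the coefficients of `U, V` of degree at
-- most two with `U b + V a = 0`. Then `a/b = -U/V` has McMillan degree at most two.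
theorem IsBicubic.resultantZero_ne_zero {a b : Fin 4 → ℝ} (h : IsBicubic (cubic a / cubic b))
    (hb : cubic b ≠ 0) : resultantZero a b ≠ 0 := by
  intro h0
  obtain ⟨v, hv, hv0⟩ := Matrix.exists_vecMul_eq_zero_iff.2 h0
  have f0 := congrFun hv0 0
  have f1 := congrFun hv0 1
  have f2 := congrFun hv0 2
  have f3 := congrFun hv0 3
  have f4 := congrFun hv0 4
  have f5 := congrFun hv0 5
  simp [Matrix.vecMul, dotProduct, sylvesterZero, Fin.sum_univ_succ] at f0 f1 f2 f3 f4 f5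
  have g0 := congrArg (RatFunc.C (K := ℝ)) f0
  have g1 := congrArg (RatFunc.C (K := ℝ)) f1
  have g2 := congrArg (RatFunc.C (K := ℝ)) f2
  have g3 := congrArg (RatFunc.C (K := ℝ)) f3
  have g4 := congrArg (RatFunc.C (K := ℝ)) f4
  have g5 := congrArg (RatFunc.C (K := ℝ)) f5
  simp only [map_add, map_mul, map_zero] at g0 g1 g2 g3 g4 g5
  set U : ℝ[X] := C (v 0) * X ^ 2 + C (v 2) * X + C (v 4) with hU
  set V : ℝ[X] := C (v 1) * X ^ 2 + C (v 3) * X + C (v 5) with hV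
  have e : algebraMap ℝ[X] (RatFunc ℝ) U * cubic b + algebraMap ℝ[X] (RatFunc ℝ) V * cubic a = 0 := by
    simp only [hU, hV, cubic_eq, map_add, map_mul, map_pow, RatFunc.algebraMap_C,
      RatFunc.algebraMap_X]
    linear_combination RatFunc.X ^ 5 * g0 + RatFunc.X ^ 4 * g1 + RatFunc.X ^ 3 * g2 +
      RatFunc.X ^ 2 * g3 + RatFunc.X * g4 + g5
  have hdeg : ∀ p q r : ℝ, (C p * X ^ 2 + C q * X + C r : ℝ[X]).natDegree ≤ 2 :=
    fun p q r => natDegree_quadratic_le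
  have hV0 : V ≠ 0 := by
    intro hV0
    rw [hV0, map_zero, zero_mul, add_zero] at e
    have hU0 : U = 0 := by
      have := (mul_eq_zero.1 e).resolve_right hb
      exact (map_eq_zero_iff _ (RatFunc.algebraMap_injective ℝ)).1 this
    apply hv
    have u0 := congrArg (coeff · 0) hU0
    have u1 := congrArg (coeff · 1) hU0
    have u2 := congrArg (coeff · 2) hU0
    have v0 := congrArg (coeff · 0) hV0
    have v1 := congrArg (coeff · 1) hV0
    have v2 := congrArg (coeff · 2) hV0
    simp [hU, hV, coeff_X, coeff_C] at u0 u1 u2 v0 v1 v2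
    ext i
    fin_cases i <;> assumption
  have hZ : cubic a / cubic b =
      algebraMap ℝ[X] (RatFunc ℝ) (-U) / algebraMap ℝ[X] (RatFunc ℝ) V := by
    rw [div_eq_div_iff hb (RatFunc.algebraMap_ne_zero hV0), map_neg]
    linear_combination e
  have := mcMillanDegree_le (p := -U) (n := 2) hV0 (by rw [natDegree_neg]; exact hdeg _ _ _)
    (hdeg _ _ _)
  rw [← hZ, show mcMillanDegree (cubic a / cubic b) = 3 from h] at this
  omega

/-! ### Realizing networks from the sign conditions -/

section Realization

variable {m n m' n' : ℕ} {Z W : RatFunc ℝ}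

theorem add_mem_impedanceSet (h : Z ∈ impedanceSet m n) (h' : W ∈ impedanceSet m' n') :
    Z + W ∈ impedanceSet (m + m') (n + n') := by
  obtain ⟨N, h1, h2, rfl⟩ := h
  obtain ⟨N', h1', h2', rfl⟩ := h'
  exact ⟨.series N N', add_le_add h1 h1', add_le_add h2 h2', rfl⟩

theorem inv_mem_impedanceSet (h : Z ∈ impedanceSet m n) : Z⁻¹ ∈ impedanceSet n m := by
  obtain ⟨N, h1, h2, rfl⟩ := h
  exact ⟨N.recip, by rwa [N.numCapacitors_recip], by rwa [N.numInductors_recip],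
    N.impedance_recip⟩

theorem dual_mem_impedanceSet (h : Z ∈ impedanceSet m n) : (substInv Z)⁻¹ ∈ impedanceSet m n := by
  obtain ⟨N, h1, h2, rfl⟩ := h
  exact ⟨N.dual, by rwa [N.numCapacitors_dual], by rwa [N.numInductors_dual],
    N.impedance_dual⟩

theorem C_add_mem_impedanceSet {r : ℝ} (hr : 0 ≤ r) (h : Z ∈ impedanceSet m n) :
    RatFunc.C r + Z ∈ impedanceSet m n := by
  rcases hr.lt_or_eq with h0 | rfl
  · have : RatFunc.C r ∈ impedanceSet 0 0 := ⟨.resistor r h0, le_rfl, le_rfl, rfl⟩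
    simpa using add_mem_impedanceSet this h
  · simpa using h

theorem inductor_mem_impedanceSet {L : ℝ} (hL : 0 < L) :
    RatFunc.C L * RatFunc.X ∈ impedanceSet 0 1 := ⟨.inductor L hL, le_rfl, le_rfl, rfl⟩

/-- A resistor in series with an inductor, as an admittance. -/
theorem div_linear_mem_impedanceSet {K α β : ℝ} (hK : 0 < K) (hα : 0 < α) (hβ : 0 ≤ β) :
    RatFunc.C K / (RatFunc.C α * RatFunc.X + RatFunc.C β) ∈ impedanceSet 1 0 := by
  have h := inv_mem_impedanceSet (C_add_mem_impedanceSet (r := β / K) (by positivity)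
    (inductor_mem_impedanceSet (L := α / K) (by positivity)))
  convert! h using 1
  have hK' := (IsPosRat.C hK).ne_zero
  rw [map_div₀, map_div₀, ← inv_div]
  congr 1
  field_simp
  ring

/-- A resistor in series with a capacitor, as an admittance. -/
theorem mul_X_div_linear_mem_impedanceSet {K α β : ℝ} (hK : 0 < K) (hα : 0 ≤ α) (hβ : 0 < β) :
    RatFunc.C K * RatFunc.X / (RatFunc.C α * RatFunc.X + RatFunc.C β) ∈ impedanceSet 0 1 := by
  have h := inv_mem_impedanceSet (C_add_mem_impedanceSet (r := α / K) (by positivity)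
    (inv_mem_impedanceSet (inductor_mem_impedanceSet (L := K / β) (by positivity))))
  convert! h using 1
  have hK' := (IsPosRat.C hK).ne_zero
  have hβ' := (IsPosRat.C hβ).ne_zero
  have hX := IsPosRat.X.ne_zero
  rw [map_div₀, map_div₀, ← inv_div]
  congr 1
  field_simp

variable {c d : Fin 3 → ℝ}

/-- A continued fraction at `s = 0`: remove the value `c₀/d₀`, invert the remainder `s (α₂ s +
α₁)/(d₀ d)`, remove its pole at `0`, then its constant term. The coefficient of the last term comes
from `lam₁_mul_α₂`. -/
theorem quad_div_quad_eq (hd : ∀ i, 0 ≤ d i) (hd0 : 0 < d 0) (hα₁ : 0 < (quadPair c d).α₁)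
    (hα₂ : 0 ≤ (quadPair c d).α₂) :
    quad c / quad d = RatFunc.C (c 0 / d 0) +
      (RatFunc.C (d 0 ^ 2 / (quadPair c d).α₁) / RatFunc.X +
        (RatFunc.C ((quadPair c d).lam₁ * d 0 / (quadPair c d).α₁ ^ 2) +
          RatFunc.C (d 0 ^ 2 * -(quadPair c d).res / (quadPair c d).α₁ ^ 2) * RatFunc.X /
          (RatFunc.C (quadPair c d).α₂ * RatFunc.X + RatFunc.C (quadPair c d).α₁)))⁻¹ := by
  have hD := (isPosRat_linear hα₂ hα₁.le (by linarith)).ne_zero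
  have hX := IsPosRat.X.ne_zero
  have hq := (isPosRat_quad hd (by rintro rfl; simp at hd0)).ne_zero
  have h0 := (IsPosRat.C hd0).ne_zero
  have h1 := (IsPosRat.C hα₁).ne_zero
  have e1 : RatFunc.C (d 0) * quad c = RatFunc.C (c 0) * quad d +
      RatFunc.X * (RatFunc.C (quadPair c d).α₂ * RatFunc.X + RatFunc.C (quadPair c d).α₁) := by
    simp [quad, Params.α₁, Params.α₂, quadPair]; ring
  have c1 : d 1 * (quadPair c d).α₁ = d 0 * (quadPair c d).α₂ + (quadPair c d).lam₁ := by
    simp [Params.lam₁, Params.α₁, Params.α₂, quadPair]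
  have c2 := lam₁_mul_α₂ (c := c) (d := d)
  have C1 := congrArg (RatFunc.C (K := ℝ)) c1
  have C2 := congrArg (RatFunc.C (K := ℝ)) c2
  simp only [map_add, map_mul, map_pow] at C1 C2
  have e2 : RatFunc.C (d 0 ^ 2 / (quadPair c d).α₁) / RatFunc.X +
        (RatFunc.C ((quadPair c d).lam₁ * d 0 / (quadPair c d).α₁ ^ 2) +
          RatFunc.C (d 0 ^ 2 * -(quadPair c d).res / (quadPair c d).α₁ ^ 2) * RatFunc.X /
          (RatFunc.C (quadPair c d).α₂ * RatFunc.X + RatFunc.C (quadPair c d).α₁)) =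
      RatFunc.C (d 0) * quad d / (RatFunc.X *
        (RatFunc.C (quadPair c d).α₂ * RatFunc.X + RatFunc.C (quadPair c d).α₁)) := by
    obtain ⟨D, hD'⟩ : ∃ D, D = RatFunc.C (quadPair c d).α₂ * RatFunc.X +
      RatFunc.C (quadPair c d).α₁ := ⟨_, rfl⟩
    rw [← hD'] at hD ⊢
    simp only [map_div₀, map_mul, map_pow, map_neg, quad]
    field_simp
    rw [hD']
    linear_combination (-RatFunc.C (quadPair c d).α₁ * RatFunc.X) * C1 + RatFunc.X ^ 2 * C2
  rw [e2, inv_div, map_div₀, div_add_div _ _ h0 (mul_ne_zero h0 hq), div_eq_div_iff hq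
    (mul_ne_zero h0 (mul_ne_zero h0 hq))]
  linear_combination (RatFunc.C (d 0) * quad d) * e1

theorem quad_div_quad_mem_of_lam₁ (hc : ∀ i, 0 ≤ c i) (hd : ∀ i, 0 ≤ d i)
    (hl : 0 ≤ (quadPair c d).lam₁) (hα : 0 ≤ (quadPair c d).α₂) (hr : (quadPair c d).res < 0) :
    quad c / quad d ∈ impedanceSet 1 1 := by
  obtain ⟨hd0, hα₁⟩ := α₁_pos_of_lam₁ hc hd hl hα hr.ne
  have hr' := neg_pos.2 hr
  have := hc 0
  rw [quad_div_quad_eq hd hd0 hα₁ hα]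
  -- Inside the inverse the summands are admittances, so the two counts are exchanged: the inductor
  -- appears as `(1, 0)` and the resistor-capacitor branch as `(0, 1)`. Here `λ₁ ≥ 0` is a
  -- conductance and `res < 0` makes the capacitor positive.
  refine C_add_mem_impedanceSet (by positivity) (inv_mem_impedanceSet (m := 1) (n := 1)
    (add_mem_impedanceSet (m := 1) (n := 0) (m' := 0) (n' := 1) ?_
      (C_add_mem_impedanceSet (by positivity)
        (mul_X_div_linear_mem_impedanceSet (by positivity) hα hα₁))))
  have h := div_linear_mem_impedanceSet (K := d 0 ^ 2 / (quadPair c d).α₁) (α := 1) (β := 0)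
    (by positivity) one_pos le_rfl
  rwa [map_one, one_mul, map_zero, add_zero] at h

theorem quad_div_quad_mem_of_res_pos (hc : ∀ i, 0 ≤ c i) (hd : ∀ i, 0 ≤ d i)
    (hl : 0 ≤ (quadPair c d).lam₁) (hα : 0 ≤ (quadPair c d).α₂) (hr : 0 < (quadPair c d).res) :
    quad c / quad d ∈ impedanceSet 0 2 := by
  obtain ⟨hd0, hα₁⟩ := α₁_pos_of_lam₁ hc hd hl hα hr.ne'
  have := hc 0
  have hd2 := hd 2
  have e := lam₁_mul_α₂ (c := c) (d := d)
  have hα₂ : 0 < (quadPair c d).α₂ := lt_of_le_of_ne hα (by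
    rintro h0
    rw [← h0, mul_zero] at e
    have : 0 < d 0 * (quadPair c d).res := by positivity
    nlinarith [mul_nonneg hd2 (sq_nonneg (quadPair c d).α₁)])
  rw [quad_div_quad_eq hd hd0 hα₁ hα]
  have h1 := (IsPosRat.C hα₁).ne_zero
  have h2 := (IsPosRat.C hα₂).ne_zero
  have hD := (isPosRat_linear hα hα₁.le (by linarith)).ne_zero
  -- With `res > 0` the capacitive term would be negative. Splitting the same fraction at `s = ∞`
  -- instead of `s = 0` gives a resistor and a second resistor-inductor branch, both positive.
  have e' : RatFunc.C ((quadPair c d).lam₁ * d 0 / (quadPair c d).α₁ ^ 2) +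
      RatFunc.C (d 0 ^ 2 * -(quadPair c d).res / (quadPair c d).α₁ ^ 2) * RatFunc.X /
      (RatFunc.C (quadPair c d).α₂ * RatFunc.X + RatFunc.C (quadPair c d).α₁) =
      RatFunc.C (d 0 * d 2 / (quadPair c d).α₂) +
      RatFunc.C (d 0 ^ 2 * (quadPair c d).res / ((quadPair c d).α₁ * (quadPair c d).α₂)) /
      (RatFunc.C (quadPair c d).α₂ * RatFunc.X + RatFunc.C (quadPair c d).α₁) := by
    have C2 := congrArg (RatFunc.C (K := ℝ)) e
    simp only [map_add, map_mul, map_pow] at C2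
    obtain ⟨D, hD'⟩ : ∃ D, D = RatFunc.C (quadPair c d).α₂ * RatFunc.X +
      RatFunc.C (quadPair c d).α₁ := ⟨_, rfl⟩
    rw [← hD'] at hD ⊢
    simp only [map_div₀, map_mul, map_pow, map_neg]
    field_simp
    rw [hD']
    linear_combination (RatFunc.C (d 0) *
      (RatFunc.C (quadPair c d).α₂ * RatFunc.X + RatFunc.C (quadPair c d).α₁)) * C2
  rw [e']
  refine C_add_mem_impedanceSet (by positivity) (inv_mem_impedanceSet (m := 2) (n := 0)
    (add_mem_impedanceSet (m := 1) (n := 0) (m' := 1) (n' := 0) ?_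
      (C_add_mem_impedanceSet (by positivity)
        (div_linear_mem_impedanceSet (by positivity) hα₂ hα₁.le))))
  have h := div_linear_mem_impedanceSet (K := d 0 ^ 2 / (quadPair c d).α₁) (α := 1) (β := 0)
    (by positivity) one_pos le_rfl
  rwa [map_one, one_mul, map_zero, add_zero] at h

end Realization

section Realization

variable {c d : Fin 3 → ℝ}

theorem quad_rev (c : Fin 3 → ℝ) : quad (rev₃ c) = RatFunc.X ^ 2 * substInv (quad c) := by
  have hX := IsPosRat.X.ne_zero
  simp only [quad, map_add, map_mul, map_pow, substInv_C, substInv_X, rev₃_zero, rev₃_one,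
    rev₃_two]
  field_simp
  ring

/-- Reversing both quadratics is `s ↦ 1/s`, the composite of duality and reciprocation, which
exchanges inductors and capacitors. -/
theorem quad_div_quad_mem_iff_rev {m n : ℕ} :
    quad (rev₃ c) / quad (rev₃ d) ∈ impedanceSet m n ↔ quad c / quad d ∈ impedanceSet n m := by
  have hX := IsPosRat.X.ne_zero
  have key : ∀ {c d : Fin 3 → ℝ} {m n : ℕ}, quad c / quad d ∈ impedanceSet n m →
      quad (rev₃ c) / quad (rev₃ d) ∈ impedanceSet m n := by
    intro c d m n h
    have := inv_mem_impedanceSet (dual_mem_impedanceSet h)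
    rw [inv_inv, map_div₀] at this
    rwa [quad_rev, quad_rev, mul_div_mul_left _ _ (pow_ne_zero 2 hX)]
  refine ⟨fun h => ?_, key⟩
  simpa using key h

theorem quad_div_quad_mem_of_regularPair (hc : ∀ i, 0 ≤ c i) (hd : ∀ i, 0 ≤ d i)
    (h : RegularPair c d) (hr : (quadPair c d).res < 0) : quad c / quad d ∈ impedanceSet 1 1 := by
  have low : ∀ {c d : Fin 3 → ℝ}, (∀ i, 0 ≤ c i) → (∀ i, 0 ≤ d i) → 0 ≤ (quadPair c d).lam₃ →
      (quadPair c d).α₂ ≤ 0 → (quadPair c d).res < 0 → quad c / quad d ∈ impedanceSet 1 1 := by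
    intro c d hc hd hl hα hr
    rw [← quad_div_quad_mem_iff_rev]
    refine quad_div_quad_mem_of_lam₁ ?_ ?_ ?_ ?_ ?_
    · intro i; fin_cases i; exacts [hc 2, hc 1, hc 0]
    · intro i; fin_cases i; exacts [hd 2, hd 1, hd 0]
    · rwa [lam₁_rev]
    · rw [α₂_rev]; linarith
    · rwa [res_rev]
  have hr' : (quadPair d c).res < 0 := by rwa [res_swap c d]
  rcases h with ⟨hl, hα⟩ | ⟨hl, hα⟩ | ⟨hl, hα⟩ | ⟨hl, hα⟩
  · exact quad_div_quad_mem_of_lam₁ hc hd hl hα hr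
  · exact low hc hd hl hα hr
  · rw [← inv_div]
    exact inv_mem_impedanceSet (quad_div_quad_mem_of_lam₁ hd hc (by rwa [lam₁_swap c d])
      (by rw [α₂_swap c d]; linarith) hr')
  · rw [← inv_div]
    exact inv_mem_impedanceSet (low hd hc (by rwa [lam₃_swap c d])
      (by rw [α₂_swap c d]; linarith) hr')

theorem ne_zero_of_res_ne_zero (h : (quadPair c d).res ≠ 0) : c ≠ 0 ∧ d ≠ 0 := by
  constructor <;> rintro rfl <;>
    simp [Params.res, Params.α₁, Params.α₂, Params.α₃, quadPair] at h

/-- A first degree network in parallel with a network of impedance `c / d`, in series with a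
resistor. -/
theorem synth_mem_impedanceSet {R K x : ℝ} (hR : 0 ≤ R) (hK : 0 < K) (hx : 0 ≤ x)
    (hc : ∀ i, 0 ≤ c i) (hd : ∀ i, 0 ≤ d i) (hr : (quadPair c d).res ≠ 0)
    (h : quad c / quad d ∈ impedanceSet 1 1) :
    cubic (synthNum R K x c d) / cubic (synthDen K x c d) ∈ impedanceSet 1 2 := by
  obtain ⟨hc0, hd0⟩ := ne_zero_of_res_ne_zero hr
  rw [← synth_ratio hK hx hc hd hc0 hd0]
  refine C_add_mem_impedanceSet hR (inv_mem_impedanceSet (m := 2) (n := 1)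
    (add_mem_impedanceSet (m := 1) (n := 0) (m' := 1) (n' := 1) ?_ (inv_mem_impedanceSet h)))
  have := div_linear_mem_impedanceSet hK one_pos hx
  rwa [map_one, one_mul] at this

theorem rev_synth_mem_impedanceSet {R K x : ℝ} (hR : 0 ≤ R) (hK : 0 < K) (hx : 0 ≤ x)
    (hc : ∀ i, 0 ≤ c i) (hd : ∀ i, 0 ≤ d i) (hr : (quadPair c d).res ≠ 0)
    (h : quad c / quad d ∈ impedanceSet 0 2) :
    cubic (rev₄ (synthNum R K x (rev₃ c) (rev₃ d))) /
      cubic (rev₄ (synthDen K x (rev₃ c) (rev₃ d))) ∈ impedanceSet 1 2 := by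
  obtain ⟨hc0, hd0⟩ := ne_zero_of_res_ne_zero hr
  rw [← rev_synth_ratio hK hx hc hd hc0 hd0]
  refine C_add_mem_impedanceSet hR (inv_mem_impedanceSet (m := 2) (n := 1)
    (add_mem_impedanceSet (m := 0) (n := 1) (m' := 2) (n' := 0) ?_ (inv_mem_impedanceSet h)))
  have := mul_X_div_linear_mem_impedanceSet hK hx one_pos
  rwa [map_one, add_comm] at this

end Realization

/-! ### Sufficiency of the conditions and the classification -/

/-- The data of a network with given `a`, `b`, `x`, with their signs. -/
theorem Params.SignBase.exists_synth {a b : Fin 4 → ℝ} {x : ℝ} (h : (paramsL a b x).SignBase)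
    (hc : 0 < (paramsL a b x).tc) :
    ∃ R K : ℝ, ∃ c d : Fin 3 → ℝ, ∃ u v w t : ℝ, 0 ≤ R ∧ 0 < K ∧ (∀ i, 0 ≤ c i) ∧ (∀ i, 0 ≤ d i) ∧
      a = synthNum R K x c d ∧ b = synthDen K x c d ∧ 0 < u ∧ 0 < v ∧ 0 < w ∧ 0 < t ∧
      (quadPair c d).α₂ = u * (paramsL a b x).α₂ ∧
      (quadPair c d).lam₁ = v * ((paramsL a b x).tb * (paramsL a b x).lam₁) ∧
      (quadPair c d).lam₂ = w * ((paramsL a b x).tb * (paramsL a b x).lam₂) ∧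
      (quadPair c d).lam₃ = v * ((paramsL a b x).tb * (paramsL a b x).lam₃) ∧
      (quadPair c d).lam₄ = w * ((paramsL a b x).tb * (paramsL a b x).lam₄) ∧
      (quadPair c d).res = t * (paramsL a b x).res := by
  obtain ⟨ea, eb⟩ := eq_synth h.ne hc.ne'
  have ht := h.ne
  refine ⟨_, _, _, _, 1 / ((paramsL a b x).tb ^ 2 * (paramsL a b x).tc),
    1 / ((paramsL a b x).tb ^ 4 * (paramsL a b x).tc ^ 2),
    1 / ((paramsL a b x).tb ^ 4 * (paramsL a b x).tc), _, ?_, ?_, ?_, ?_, ea, eb,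
    by positivity, by positivity, by positivity, ?_, α₂_smul.trans ?_, lam₁_smul.trans ?_,
    lam₂_smul.trans ?_, lam₃_smul.trans ?_, lam₄_smul.trans ?_, res_smul⟩
  · have := h.ta
    rw [show (paramsL a b x).ta / (paramsL a b x).tb =
      (paramsL a b x).tb * (paramsL a b x).ta / (paramsL a b x).tb ^ 2 by field_simp]
    positivity
  · positivity
  · intro i
    have := h.c i
    rw [Pi.smul_apply, smul_eq_mul, show (paramsL a b x).tb⁻¹ * (paramsL a b x).c i =
      (paramsL a b x).tb * (paramsL a b x).c i / (paramsL a b x).tb ^ 2 by field_simp]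
    positivity
  · intro i
    have := h.d i
    rw [Pi.smul_apply, smul_eq_mul,
      show ((paramsL a b x).tb * (paramsL a b x).tc)⁻¹ * (paramsL a b x).d i =
      (paramsL a b x).tb * (paramsL a b x).d i /
        ((paramsL a b x).tb ^ 2 * (paramsL a b x).tc) by field_simp]
    positivity
  · positivity
  · show _ * (paramsL a b x).α₂ = _
    field_simp
  · show _ * (paramsL a b x).lam₁ = _
    field_simp
  · show _ * (paramsL a b x).lam₂ = _
    field_simp
  · show _ * (paramsL a b x).lam₃ = _
    field_simp
  · show _ * (paramsL a b x).lam₄ = _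
    field_simp

theorem TightCond.mem_impedanceSet {a b : Fin 4 → ℝ} {x : ℝ} (hx : 0 ≤ x)
    (h : TightCond a b x) : cubic a / cubic b ∈ impedanceSet 1 2 := by
  have key : ∀ {r : ℝ}, CondBase a b → (paramsL a b x).SameSignWith r → 0 ≤ (paramsL a b x).tc →
      ((∀ c d : Fin 3 → ℝ, ∀ u v w : ℝ, 0 < u → 0 < v → 0 < w →
        0 ≤ (paramsL a b x).tb * r →
        (quadPair c d).α₂ = u * (paramsL a b x).α₂ →
        (quadPair c d).lam₁ = v * ((paramsL a b x).tb * (paramsL a b x).lam₁) →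
        (quadPair c d).lam₂ = w * ((paramsL a b x).tb * (paramsL a b x).lam₂) →
        (quadPair c d).lam₃ = v * ((paramsL a b x).tb * (paramsL a b x).lam₃) →
        (quadPair c d).lam₄ = w * ((paramsL a b x).tb * (paramsL a b x).lam₄) →
        RegularPair c d)) → cubic a / cubic b ∈ impedanceSet 1 2 := by
    intro r hb hs htc hreg
    obtain ⟨p1, p2, p3, p4⟩ := hb.signBase hx hs htc
    obtain ⟨R, K, c, d, u, v, w, t, hR, hK, hc, hd, ea, eb, hu, hv, hw, ht, e, e1, e2, e3, e4, er⟩ :=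
      p1.exists_synth p3
    have hres : (quadPair c d).res < 0 := by rw [er]; exact mul_neg_of_pos_of_neg ht p4
    have hQ := hreg c d u v w hu hv hw p2 e e1 e2 e3 e4
    rw [ea, eb]
    exact synth_mem_impedanceSet hR hK hx hc hd hres.ne
      (quad_div_quad_mem_of_regularPair hc hd hQ hres)
  rcases h with ⟨⟨hb, hs, htc, hα⟩, -⟩ | ⟨⟨hb, hs, htc, hα⟩, -⟩ | ⟨⟨hb, hs, htc, hα⟩, -⟩ |
    ⟨⟨hb, hs, htc, hα⟩, -⟩ | ⟨h5, -⟩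
  · exact key hb hs htc fun c d u v w hu hv hw hr e e1 _ _ _ =>
      Or.inl ⟨by rw [e1]; positivity, by rw [e]; positivity⟩
  · refine key hb hs htc fun c d u v w hu hv hw hr e _ _ e3 _ =>
      Or.inr (Or.inl ⟨by rw [e3]; positivity, ?_⟩)
    rw [e]
    exact mul_nonpos_of_nonneg_of_nonpos hu.le (neg_nonneg.1 hα)
  · refine key hb hs htc fun c d u v w hu hv hw hr e _ _ _ e4 =>
      Or.inr (Or.inr (Or.inl ⟨by rw [e4]; positivity, ?_⟩))
    rw [e]
    exact mul_nonpos_of_nonneg_of_nonpos hu.le (neg_nonneg.1 hα)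
  · exact key hb hs htc fun c d u v w hu hv hw hr e _ e2 _ _ =>
      Or.inr (Or.inr (Or.inr ⟨by rw [e2]; positivity, by rw [e]; positivity⟩))
  · obtain ⟨p1, p2, p3, p4, p5⟩ := h5.signBase hx
    obtain ⟨R, K, c, d, u, v, w, t, hR, hK, hc, hd, ea, eb, hu, hv, hw, ht, e, -, -, e3, -, er⟩ :=
      p1.exists_synth p2
    have hres : 0 < (quadPair (rev₃ c) (rev₃ d)).res := by rw [res_rev, er]; positivity
    have hc' : ∀ i, 0 ≤ rev₃ c i := by intro i; fin_cases i; exacts [hc 2, hc 1, hc 0]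
    have hd' : ∀ i, 0 ≤ rev₃ d i := by intro i; fin_cases i; exacts [hd 2, hd 1, hd 0]
    have hmem : quad (rev₃ c) / quad (rev₃ d) ∈ impedanceSet 0 2 := by
      refine quad_div_quad_mem_of_res_pos hc' hd' ?_ ?_ hres
      · rw [lam₁_rev, e3]; positivity
      · rw [α₂_rev, e, ← mul_neg]; positivity
    have := rev_synth_mem_impedanceSet hR hK hx hc' hd' hres.ne' hmem
    rwa [rev₃_rev₃, rev₃_rev₃, ← ea, ← eb, rev₄_rev₄, rev₄_rev₄] at this

theorem cubic_rev (p : Fin 4 → ℝ) : cubic (rev₄ p) = RatFunc.X ^ 3 * substInv (cubic p) := by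
  have hX := IsPosRat.X.ne_zero
  simp only [cubic_eq, map_add, map_mul, map_pow, substInv_C, substInv_X, rev₄, Matrix.cons_val]
  field_simp
  ring

theorem inv_substInv_cubic_div (a b : Fin 4 → ℝ) :
    (substInv (cubic a / cubic b))⁻¹ = cubic (rev₄ b) / cubic (rev₄ a) := by
  rw [map_div₀, inv_div, cubic_rev, cubic_rev,
    mul_div_mul_left _ _ (pow_ne_zero 3 IsPosRat.X.ne_zero)]

theorem CondBase.exists_pos {a b : Fin 4 → ℝ} (h : CondBase a b) :
    (∃ i, 0 < a i) ∧ ∃ i, 0 < b i := by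
  constructor
  · by_contra! h0
    have : a = 0 := by ext i; exact le_antisymm (h0 i) (h.1 i).1
    have h2 := h.2
    rw [this, resultantZero_eq, Matrix.det_fin_three] at h2
    simp [bezoutian] at h2
  · by_contra! h0
    have : b = 0 := by ext i; exact le_antisymm (h0 i) (h.1 i).2
    have h2 := h.2
    rw [this, resultantZero_eq, Matrix.det_fin_three] at h2
    simp [bezoutian] at h2

theorem IsBicubic.ne_zero_of_eq_div {Z p q : RatFunc ℝ} (h : IsBicubic Z) (e : Z = p / q) :
    q ≠ 0 := by
  rintro rfl
  rw [div_zero] at e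
  subst e
  simp [IsBicubic, mcMillanDegree] at h

theorem theorem26 (Z : RatFunc ℝ) (hZ : IsBicubic Z) :
    Z ∈ impedanceSet 1 2 ↔
      ∃ x : ℝ, 0 ≤ x ∧ ∃ a b : Fin 4 → ℝ,
        (HasDirectForm Z a b ∨ HasDualForm Z a b) ∧
        ((CondC1 a b x ∧
            (x = 0 ∨ (paramsL a b x).lam₁ = 0 ∨ (paramsL a b x).c 0 = 0)) ∨
          (CondC2 a b x ∧
            (x = 0 ∨ (paramsL a b x).lam₃ = 0 ∨ (paramsL a b x).c 2 = 0)) ∨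
          (CondC3 a b x ∧
            (x = 0 ∨ (paramsL a b x).lam₄ = 0 ∨ (paramsL a b x).d 0 = 0)) ∨
          (CondC4 a b x ∧
            (x = 0 ∨ (paramsL a b x).lam₂ = 0 ∨ (paramsL a b x).d 2 = 0)) ∨
          (CondC5 a b x ∧
            (x = 0 ∨ (paramsC a b x).c 0 = 0 ∨ (paramsC a b x).d 2 = 0))) := by
  constructor
  · rintro ⟨N, hC, hL, rfl⟩
    -- Degree three together with the bounds one and two forces exactly one capacitor and two
    -- inductors.
    have hdeg := N.mcMillanDegree_impedance_le
    rw [show mcMillanDegree N.impedance = 3 from hZ] at hdeg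
    rcases N.isCoreImpedance_or_dual (by omega) (by omega) with h | h
    · obtain ⟨a, b, e, h⟩ := h.exists_tightCond
      have hR : resultantZero a b ≠ 0 :=
        IsBicubic.resultantZero_ne_zero (e ▸ hZ) (hZ.ne_zero_of_eq_div e)
      obtain ⟨x, hx, ht⟩ := h hR
      exact ⟨x, hx, a, b, Or.inl ⟨ht.condBase.exists_pos.2, e⟩, ht⟩
    · obtain ⟨a, b, e, h⟩ := h.exists_tightCond
      have e' : N.impedance = cubic (rev₄ b) / cubic (rev₄ a) := by
        rw [← inv_substInv_cubic_div, ← e, map_inv₀, inv_inv, substInv_substInv]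
      have hR : resultantZero (rev₄ b) (rev₄ a) ≠ 0 :=
        IsBicubic.resultantZero_ne_zero (e' ▸ hZ) (hZ.ne_zero_of_eq_div e')
      -- Reversal and interchange each change the sign of the resultant, so the dual form has the
      -- same `R₀(a, b)`.
      rw [resultantZero_rev, resultantZero_swap, neg_neg] at hR
      obtain ⟨x, hx, ht⟩ := h hR
      exact ⟨x, hx, a, b, Or.inr ⟨ht.condBase.exists_pos.1, e'⟩, ht⟩
  · rintro ⟨x, hx, a, b, hform, ht⟩
    have hmem := TightCond.mem_impedanceSet hx ht
    rcases hform with ⟨-, e⟩ | ⟨-, e⟩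
    · rwa [e]
    · have := dual_mem_impedanceSet hmem
      rw [inv_substInv_cubic_div] at this
      rw [e]
      exact this
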